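/- Let $m\ge 1$, $n\ge 0$, $N=2m+2n+1$, $\mathbb K=\mathbb C(q^{1/2})$, $\zeta=q^{2m-2n-1}$ and $V=\mathbb C^{2m+1|2n}$. For $1\le a\le N$ put $\bar a=N+1-a$; put $[a]=0$ if $n+1\le a\le n+2m+1$ and $[a]=1$ otherwise; put $\xi_a=1$ if $[a]=0$, $\xi_a=(-1)^a$ if $a\le n$, $\xi_a=-(-1)^a$ if $a\ge\bar n$. Let $\varepsilon_1,\dots,\varepsilon_{m+n}$ be orthogonal with $(\varepsilon_a,\varepsilon_a)=-1$ for $a\le n$ and $1$ for $n<a\le n+m$, let $\varepsilon_{\bar a}=-\varepsilon_a$, $\varepsilon_{m+n+1}=0$, and $\rho=\frac12\sum_{\mu=1}^n(2n-2m+1-2\mu)\varepsilon_\mu+\frac12\sum_{i=1}^m(2m+1-2i)\varepsilon_{n+i}$. Let $E^a_b$ be the elementary matrices, of parity $[a]+[b]$; all tensor products are graded, $(X\otimes Y)(Z\otimes W)=(-1)^{[Y][Z]}XZ\otimes YW$. Put $$P=\sum_{a,b}(-1)^{[b]}E^a_b\otimes E^b_a,\qquad Q=\sum_{a,b}(-1)^{[a][b]}\xi_a\xi_b\,q^{(\rho,\varepsilon_a-\varepsilon_b)}E^a_b\otimes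 E^{\bar a}_{\bar b},$$ $$\hat\sigma^a_a=q^{(\varepsilon_a,\varepsilon_a)/2}E^a_a-q^{-(\varepsilon_a,\varepsilon_a)/2}E^{\bar a}_{\bar a},\qquad \hat\sigma^a_b=E^a_b-(-1)^{[a]([a]+[b])}\xi_a\xi_b\,q^{(\rho,\varepsilon_b-\varepsilon_a)}E^{\bar b}_{\bar a}\quad(a\ne b),$$ \begin{align*}\widetilde R(z)={}&\frac{(q-q^{-1})z}{q-q^{-1}z}P-\frac{(q-q^{-1})z(z-1)}{(q-q^{-1}z)(z-\zeta)}Q\\&-\frac{z-1}{q-q^{-1}z}\Bigl\{I+(q^{\frac12}-q^{-\frac12})\sum_{a\ne\bar a}(-1)^{[a]}E^a_a\otimes\hat\sigma^a_a+(q-q^{-1})\sum_{a>b}(-1)^{[b]}E^a_b\otimes\hat\sigma^b_a\Bigr\},\end{align*} and $R(z)=f(z)(z-q^2)(z-\zeta)\widetilde R(z)$, where $f(z)\in\mathbb K[[z]]$ is the expansion of $$\prod_{i\ge0}\frac{(1-z\zeta^{2i})(1-zq^{-2}\zeta^{2i+1})(1-zq^2\zeta^{2i+1})(1-z\zeta^{2i+2})}{(1-z\zeta^{2i-1})(1-z\zeta^{2i+1})(1-zq^2\zeta^{2i})(1-zq^{-2}\zeta^{2i})},$$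 that is, the unique series with $f(0)=1$ and $f(z)f(z\zeta)(1-zq^2)(1-zq^{-2})(1-z\zeta^{-1})(1-z\zeta)=1$. Let $U(\widetilde R)=U(\widetilde R^{(m|n)})$ be the superalgebra over $\mathbb K$ generated by an invertible central element $q^{c/2}$ and elements $l^\pm_{ij}[\mp p]$ ($1\le i,j\le N$, $p\ge0$) of parity $[i]+[j]$, with the relations $l^+_{ii}[0]l^-_{ii}[0]=l^-_{ii}[0]l^+_{ii}[0]=1$; $l^+_{ij}[0]=0$ for $i<j$; $l^-_{ij}[0]=0$ for $i>j$; and $$\widetilde R(z/w)\mathcal L_1^\pm(z)\mathcal L_2^\pm(w)=\mathcal L_2^\pm(w)\mathcal L_1^\pm(z)\widetilde R(z/w),\qquad \widetilde R(q^{c}z/w)\mathcal L_1^+(z)\mathcal L_2^-(w)=\mathcal L_2^-(w)\mathcal L_1^+(z)\widetilde R(q^{-c}z/w),$$ where $l^\pm_{ij}(z)=\sum_{p\ge0}l^\pm_{ij}[\mp p]z^{\pm p}$, $\mathcal L^\pm(z)=\sum_{i,j}E^i_j\otimes l^\pm_{ij}(z)$, and $\widetilde R$ is expanded in powers of its argument.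 Let $U(R)=U(R^{(m|n)})$ be defined in the same way, with $R$ in place of $\widetilde R$ and $L^\pm$ in place of $\mathcal L^\pm$. Let $\mathcal L^\pm(z)=\widetilde F^\pm(z)\widetilde H^\pm(z)\widetilde E^\pm(z)$ be the Gauss decomposition in the graded algebra $\operatorname{End}V\otimes U(\widetilde R)[[z^{\pm1}]]$ into a lower unitriangular, a diagonal and an upper unitriangular factor, and $\mathfrak h^\pm_i(z)$ the $i$-th entry of $\widetilde H^\pm(z)$. Equivalently, $\mathfrak h_i^\pm(z)$ is the quasideterminant with boxed entry $(i,i)$ of the upper left $i\times i$ block of $\bigl((-1)^{([a]+[b])[b]}l^\pm_{ab}(z)\bigr)_{a,b}$. Let $h^\pm_i(z)$ be the same for $L^\pm(z)$ in $U(R)$. Let $(E^i_j)^t=(-1)^{[i][j]+[j]}\xi_{\bar i}\xi_{\bar j}E^{\bar j}_{\bar i}$, and let $D$ be the diagonal matrix with entries $q^{-(\rho,\varepsilon_i)}$. Then all the blocks inverted in these quasideterminants and all the series $\mathfrak h_i^\pm(z)$, $h_i^\pm(z)$ are invertible, the coefficients of $\mathfrak h^\pm_i(z)$ and $\mathfrak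 h^\pm_j(z)$ (with the same sign), $1\le i,j\le m+n+1$, commute, and so do those of $h^\pm_i(z)$ and $h^\pm_j(z)$. In $U(\widetilde R)$ there is exactly one series $\widetilde c^\pm(z)$ with $$D\mathcal L^\pm(z\zeta)^tD^{-1}\mathcal L^\pm(z)=\mathcal L^\pm(z)D\mathcal L^\pm(z\zeta)^tD^{-1}=\widetilde c^\pm(z),$$ and in $U(R)$ exactly one series $c^\pm(z)$ with the same property for $L^\pm$; they are \begin{gather*} c^{\pm}(z)=\prod_{i=1}^n\frac{h_i^{\pm}(z\zeta q^{2i-2})}{h_i^{\pm}(z\zeta q^{2i})}\prod_{i=1}^m\frac{h_{n+i}^{\pm}(zq^{2m-2i+1})}{h_{n+i}^{\pm}(zq^{2m-2i-1})}\,h_{m+n+1}^{\pm}(z)\,h_{m+n+1}^{\pm}(q^{-1}z),\\ \widetilde c^{\pm}(z)=\prod_{i=1}^n\frac{\mathfrak h_i^{\pm}(z\zeta q^{2i-2})}{\mathfrak h_i^{\pm}(z\zeta q^{2i})}\prod_{i=1}^m\frac{\mathfrak h_{n+i}^{\pm}(zq^{2m-2i+1})}{\mathfrak h_{n+i}^{\pm}(zq^{2m-2i-1})}\,\mathfrak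 h_{m+n+1}^{\pm}(z)\,\mathfrak h_{m+n+1}^{\pm}(q^{-1}z). \end{gather*} -/

import Mathlib

/-! The ground field `ℂ(q^{1/2})`; its generator `q^{1/2}` is `qh`. -/

namespace OspRTT

/-- The field `ℂ(q^{1/2})`. -/
abbrev K : Type := RatFunc ℂ

/-- The element `q^{1/2}`. -/
noncomputable def qh : K := RatFunc.X

/-- The element `q`. -/
noncomputable def q : K := qh ^ 2

/-- The index set `{1, …, 2m+2n+1}`, shifted to `{0, …, 2m+2n}`: the element `i` stands for the
index `i + 1`, and the involution `a ↦ 2n+2m+2-a` is `Fin.rev`. -/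
abbrev Idx (m n : ℕ) : Type := Fin (2 * n + 2 * m + 1)

section Data

variable {m n : ℕ}

/-- The grading: `0` for the indices `n+1, …, n+2m+1` and `1` for the others. -/
def par (i : Idx m n) : ℕ := if n ≤ i.val ∧ i.val < n + 2 * m + 1 then 0 else 1

/-- The sign `(-1)^k`. -/
def sgn (k : ℕ) : ℤ := (-1) ^ k

/-- The signs `ξ_a`: `1` for even `a`, `(-1)^a` for `a ≤ n`, and `-(-1)^a` for the remaining odd
indices. -/
def xi (i : Idx m n) : ℤ :=
  if par i = 0 then 1 else if i.val < n then sgn (i.val + 1) else -sgn (i.val + 1)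

/-- `2(ρ, ε_a)` for an index `a` among the first `m + n + 1`, where
`2ρ = ∑_{μ=1}^n (2n-2m+1-2μ) ε_μ + ∑_{i=1}^m (2m+1-2i) ε_{n+i}`,
`(ε_μ, ε_μ) = -1` for `μ ≤ n`, `(ε_{n+i}, ε_{n+i}) = 1` for `i ≤ m`, and `ε_{m+n+1} = 0`. -/
def twoRhoHalf (i : Idx m n) : ℤ :=
  if i.val < n then -(2 * n - 2 * m + 1 - 2 * ((i.val : ℤ) + 1))
  else if i.val < n + m then 2 * m + 1 - 2 * ((i.val : ℤ) + 1 - n)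
  else 0

/-- `2(ρ, ε_a)` for every index, with `ε_{\bar a} = -ε_a`. -/
def twoRho (i : Idx m n) : ℤ :=
  if i.val ≤ n + m then twoRhoHalf i else -twoRhoHalf i.rev

/-- `(ε_a, ε_a)`: `-1` for odd `a`, `0` for the middle index, `1` for the other even indices. -/
def epsSq (i : Idx m n) : ℤ := if i.rev = i then 0 else sgn (par i)

/-- `q^{(ρ, ε_a - ε_b)}`. -/
noncomputable def qRho (a b : Idx m n) : K := qh ^ (twoRho a - twoRho b)

/-- `a_i = -(ρ, ε_i)`, so that `a_{\bar i} - a_{\bar j} = (ρ, ε_i - ε_j)`, `a_{\bar i} = -a_i`, and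
the middle one is `0`. This is the diagonal entry `q^{a_i}` of `D`. -/
noncomputable def dEntry (i : Idx m n) : K := qh ^ (-twoRho i)

/-- A family `x` of coefficients, `x i j k l` being the one of `E^i_j ⊗ E^k_l`. -/
abbrev Coeffs (m n : ℕ) (S : Type) : Type := Idx m n → Idx m n → Idx m n → Idx m n → S

/-- `P = ∑_{a,b} (-1)^{[b]} E^a_b ⊗ E^b_a`. -/
noncomputable def P : Coeffs m n K := fun i j k l =>
  if k = j ∧ l = i then (sgn (par j) : K) else 0

/-- `Q = ∑_{a,b} (-1)^{[a][b]} ξ_a ξ_b q^{(ρ, ε_a - ε_b)} E^a_b ⊗ E^{\bar a}_{\bar b}`. -/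
noncomputable def Q : Coeffs m n K := fun i j k l =>
  if k = i.rev ∧ l = j.rev then
    (sgn (par i * par j) : K) * (xi i : K) * (xi j : K) * qRho i j
  else 0

/-- `\hat σ^a_a = q^{(ε_a,ε_a)/2} E^a_a - q^{-(ε_a,ε_a)/2} E^{\bar a}_{\bar a}`:
the coefficient of `E^k_l`. -/
noncomputable def sigmaDiag (a k l : Idx m n) : K :=
  (if k = a ∧ l = a then qh ^ epsSq a else 0) -
    (if k = a.rev ∧ l = a.rev then qh ^ (-epsSq a) else 0)

/-- `\hat σ^a_b = E^a_b - (-1)^{[a]([a]+[b])} ξ_a ξ_b q^{(ρ, ε_b - ε_a)} E^{\bar b}_{\bar a}`: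
the coefficient of `E^k_l`. -/
noncomputable def sigmaOff (a b k l : Idx m n) : K :=
  (if k = a ∧ l = b then 1 else 0) -
    (if k = b.rev ∧ l = a.rev then
      (sgn (par a * (par a + par b)) : K) * (xi a : K) * (xi b : K) * qRho b a
    else 0)

/-- `I + (q^{1/2} - q^{-1/2}) ∑_{a ≠ \bar a} (-1)^{[a]} E^a_a ⊗ \hat σ^a_a
  + (q - q^{-1}) ∑_{a > b} (-1)^{[b]} E^a_b ⊗ \hat σ^b_a`. -/
noncomputable def B : Coeffs m n K := fun i j k l =>
  (if i = j ∧ k = l then 1 else 0) +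
    (if i = j ∧ i ≠ i.rev then (qh - qh⁻¹) * (sgn (par i) : K) * sigmaDiag i k l else 0) +
    (if j < i then (q - q⁻¹) * (sgn (par j) : K) * sigmaOff j i k l else 0)

end Data

/-- `ζ = q^{2m-2n-1}`. -/
noncomputable def zeta (m n : ℕ) : K := q ^ (2 * (m : ℤ) - 2 * n - 1)

open PowerSeries in
/-- The normalized `R`-matrix `\tilde R(z)`, expanded in powers of `z`:
`\tilde R(z) = (q - q⁻¹) z P / (q - q⁻¹ z) - (q - q⁻¹) z (z - 1) Q / ((q - q⁻¹ z)(z - ζ))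
  - (z - 1) B / (q - q⁻¹ z)`. -/
noncomputable def Rtilde (m n : ℕ) : Coeffs m n (PowerSeries K) := fun i j k l =>
  C (q - q⁻¹) * X * (C q - C q⁻¹ * X)⁻¹ * C (P i j k l)
    - C (q - q⁻¹) * X * (X - 1) * (C q - C q⁻¹ * X)⁻¹ * (X - C (zeta m n))⁻¹ * C (Q i j k l)
    - (X - 1) * (C q - C q⁻¹ * X)⁻¹ * C (B i j k l)

/-- The coefficients of `z f'(z) / f(z)` in positive degree `k`, for the product
`f(z) = ∏_{i ≥ 0} (1-zζ^{2i})(1-zq^{-2}ζ^{2i+1})(1-zq^2ζ^{2i+1})(1-zζ^{2i+2}) /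
  ((1-zζ^{2i-1})(1-zζ^{2i+1})(1-zq^2ζ^{2i})(1-zq^{-2}ζ^{2i}))`:
a factor `1 - z a ζ^{2i}` contributes `-a^k ζ^{2ik}`, and the geometric series over `i` is summed
in `ℂ(q^{1/2})`. -/
noncomputable def logDerivF (m n k : ℕ) : K :=
  -((1 + (q⁻¹ ^ 2 * zeta m n) ^ k + (q ^ 2 * zeta m n) ^ k + (zeta m n ^ 2) ^ k)
      - ((zeta m n)⁻¹ ^ k + zeta m n ^ k + (q ^ 2) ^ k + (q⁻¹ ^ 2) ^ k))
    / (1 - (zeta m n ^ 2) ^ k)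

/-- The scalar series `f(z)`, as `exp (∑_{k ≥ 1} logDerivF k z^k / k)`. It is the series with
`f(0) = 1` and `f(z) f(zζ) (1-zq^2)(1-zq^{-2})(1-zζ^{-1})(1-zζ) = 1`. -/
noncomputable def f (m n : ℕ) : PowerSeries K :=
  (PowerSeries.exp K).subst
    (PowerSeries.mk fun k : ℕ => if k = 0 then 0 else logDerivF m n k / (k : K))

open PowerSeries in
/-- The `R`-matrix `R(z) = g(z) \tilde R(z)` with `g(z) = f(z) (z - q^2) (z - ζ)`. -/
noncomputable def Rfull (m n : ℕ) : Coeffs m n (PowerSeries K) := fun i j k l =>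
  f m n * (X - C (q ^ 2)) * (X - C (zeta m n)) * Rtilde m n i j k l

/-! ### Even elements of `End V ⊗ A` and `End V ⊗ End V ⊗ A` as matrices

For a superalgebra `A`, the graded tensor product `End V ⊗ A` acts on `V ⊗ A` by the sign rule: if
`x` has parity `[i] + [j]` then `E^i_j ⊗ x` sends `v_j ⊗ y` to `(-1)^{([i]+[j])[j]} v_i ⊗ x y`. This
turns the graded product of even elements into the product of matrices over `A`. Likewise
`E^i_j ⊗ E^k_l ⊗ x`, with `x` of parity `[i]+[j]+[k]+[l]`, sends `v_j ⊗ v_l ⊗ y` to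
`(-1)^{([k]+[l])[j] + ([i]+[j]+[k]+[l])([j]+[l])} v_i ⊗ v_k ⊗ x y`. -/

section Super

variable {m n : ℕ} {A : Type} [Ring A]

/-- The matrix of the even element `∑ E^i_j ⊗ x i j`. -/
def op₁ (x : Idx m n → Idx m n → A) : Matrix (Idx m n) (Idx m n) A :=
  Matrix.of fun i j => sgn ((par i + par j) * par j) • x i j

/-- The matrix of the even element `∑ E^i_j ⊗ E^k_l ⊗ x i j k l`. -/
def op₂ (x : Coeffs m n A) : Matrix (Idx m n × Idx m n) (Idx m n × Idx m n) A :=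
  Matrix.of fun r c =>
    sgn ((par r.2 + par c.2) * par c.1
        + (par r.1 + par c.1 + par r.2 + par c.2) * (par c.1 + par c.2))
      • x r.1 c.1 r.2 c.2

/-- The super-transposition `(E^i_j)^t = (-1)^{[i][j]+[j]} ξ_{\bar i} ξ_{\bar j} E^{\bar j}_{\bar i}`
in the first factor: the coefficients of `∑ (E^i_j)^t ⊗ x i j`. -/
def superT (x : Idx m n → Idx m n → A) : Idx m n → Idx m n → A := fun a b =>
  (sgn (par b.rev * par a.rev + par a.rev) * xi b * xi a) • x b.rev a.rev

/-- A family `l^±_{ij}[∓p]`; the sign is an element of `ℤˣ = {1, -1}`. -/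
abbrev LFam (m n : ℕ) (A : Type) : Type := ℤˣ → Idx m n → Idx m n → ℕ → A

/-- The coefficient of `z^e`, `e ∈ ℤ`, in `l^±_{ij}(z) = ∑_{p ≥ 0} l^±_{ij}[∓p] z^{±p}`. -/
def mode (l : LFam m n A) (s : ℤˣ) (i j : Idx m n) (e : ℤ) : A :=
  if 0 ≤ (s : ℤ) * e then l s i j ((s : ℤ) * e).toNat else 0

/-- The coefficient of `z^e` in `L_1^±(z) = ∑ E^i_j ⊗ 1 ⊗ l^±_{ij}(z)`. -/
def L1 (l : LFam m n A) (s : ℤˣ) (e : ℤ) :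
    Matrix (Idx m n × Idx m n) (Idx m n × Idx m n) A :=
  op₂ fun i j k k' => if k = k' then mode l s i j e else 0

/-- The coefficient of `w^e` in `L_2^±(w) = ∑ 1 ⊗ E^i_j ⊗ l^±_{ij}(w)`. -/
def L2 (l : LFam m n A) (s : ℤˣ) (e : ℤ) :
    Matrix (Idx m n × Idx m n) (Idx m n × Idx m n) A :=
  op₂ fun i j k k' => if i = j then mode l s k k' e else 0

variable [Algebra K A]

/-- The coefficient of `x^k` in the `R`-matrix `R(x)`. -/
noncomputable def Rcoeff (R : Coeffs m n (PowerSeries K)) (k : ℕ) :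
    Matrix (Idx m n × Idx m n) (Idx m n × Idx m n) A :=
  op₂ fun i j i' j' => algebraMap K A (PowerSeries.coeff k (R i j i' j'))

/-- The coefficient of `z^a w^b` in `R(g z / w) L_1^s(z) L_2^t(w)`, for central `g`, with `R(x)`
expanded in powers of `x`. For `(s, t) = (+, +), (-, -), (+, -)` the terms with `k > |a| + |b|`
vanish, since `L_1^+` has no negative powers and `L_2^-` no positive ones. -/
noncomputable def rttLeft (R : Coeffs m n (PowerSeries K)) (g : A) (l : LFam m n A) (s t : ℤˣ)
    (a b : ℤ) : Matrix (Idx m n × Idx m n) (Idx m n × Idx m n) A :=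
  ∑ k ∈ Finset.range (a.natAbs + b.natAbs + 1),
    g ^ k • (Rcoeff R k * L1 l s (a - k) * L2 l t (b + k))

/-- The coefficient of `z^a w^b` in `L_2^t(w) L_1^s(z) R(g z / w)`. -/
noncomputable def rttRight (R : Coeffs m n (PowerSeries K)) (g : A) (l : LFam m n A) (s t : ℤˣ)
    (a b : ℤ) : Matrix (Idx m n × Idx m n) (Idx m n × Idx m n) A :=
  ∑ k ∈ Finset.range (a.natAbs + b.natAbs + 1),
    g ^ k • (L2 l t (b + k) * L1 l s (a - k) * Rcoeff R k)

end Super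

/-! ### The algebra attached to an `R`-matrix -/

/-- The generators `q^{c/2}`, `q^{-c/2}` and `l^±_{ij}[∓p]`. -/
inductive Gen (m n : ℕ) : Type
  | gamma : Gen m n
  | gammaInv : Gen m n
  | l (s : ℤˣ) (i j : Idx m n) (p : ℕ) : Gen m n

section Algebra

variable {m n : ℕ}

/-- The free algebra over `ℂ(q^{1/2})` on the generators. -/
abbrev Free (m n : ℕ) : Type := FreeAlgebra K (Gen m n)

/-- `q^{c/2}` in the free algebra. -/
noncomputable def freeGamma : Free m n := FreeAlgebra.ι K Gen.gamma

/-- `q^{-c/2}` in the free algebra. -/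
noncomputable def freeGammaInv : Free m n := FreeAlgebra.ι K Gen.gammaInv

/-- `l^±_{ij}[∓p]` in the free algebra. -/
noncomputable def freeL : LFam m n (Free m n) := fun s i j p => FreeAlgebra.ι K (Gen.l s i j p)

/-- The defining relations. The RTT relations are imposed on all coefficients of `z^a w^b`. In the
mixed relation `z_+ / w_- = q^c z / w` and `z_- / w_+ = q^{-c} z / w`. All relations are homogeneous
for the parity `[l_{ij}] = [i] + [j]`, so that the quotient is a superalgebra. -/
inductive Rel (R : Coeffs m n (PowerSeries K)) : Free m n → Free m n → Prop
  | gamma_mul_gammaInv : Rel R (freeGamma * freeGammaInv) 1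
  | gammaInv_mul_gamma : Rel R (freeGammaInv * freeGamma) 1
  | gamma_central (x : Gen m n) :
      Rel R (freeGamma * FreeAlgebra.ι K x) (FreeAlgebra.ι K x * freeGamma)
  | diag_mul (s : ℤˣ) (i : Idx m n) : Rel R (freeL s i i 0 * freeL (-s) i i 0) 1
  | lower (i j : Idx m n) (h : i < j) : Rel R (freeL 1 i j 0) 0
  | upper (i j : Idx m n) (h : j < i) : Rel R (freeL (-1) i j 0) 0
  | rtt (s : ℤˣ) (a b : ℤ) (x y : Idx m n × Idx m n) :
      Rel R (rttLeft R 1 freeL s s a b x y) (rttRight R 1 freeL s s a b x y)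
  | rttMixed (a b : ℤ) (x y : Idx m n × Idx m n) :
      Rel R (rttLeft R (freeGamma ^ 2) freeL 1 (-1) a b x y)
        (rttRight R (freeGammaInv ^ 2) freeL 1 (-1) a b x y)

/-- The algebra attached to the `R`-matrix `R(z)`. -/
abbrev U (R : Coeffs m n (PowerSeries K)) : Type := RingQuot (Rel R)

/-- The series `l^±_{ij}(z)`, as power series in the variable `z^{±1}`. -/
noncomputable def lSer (R : Coeffs m n (PowerSeries K)) (s : ℤˣ) (i j : Idx m n) :
    PowerSeries (U R) :=
  PowerSeries.mk fun p => RingQuot.mkAlgHom K (Rel R) (freeL s i j p)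

end Algebra

/-! ### Gaussian generators and the series `c^±(z)` -/

section Gauss

variable {m n : ℕ}

/-- For a power series `x(z)` in the variable `z^{±1}` (the sign being `s`), the series `x(a z)`. -/
noncomputable def shift {A : Type} [Ring A] [Algebra K A] (s : ℤˣ) (a : K) (x : PowerSeries A) :
    PowerSeries A :=
  PowerSeries.mk fun p => (a ^ ((s : ℤ) * p)) • PowerSeries.coeff p x

/-- The matrix of `L^±(z) = ∑ E^i_j ⊗ l^±_{ij}(z)`. -/
noncomputable def L (R : Coeffs m n (PowerSeries K)) (s : ℤˣ) :
    Matrix (Idx m n) (Idx m n) (PowerSeries (U R)) :=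
  op₁ (lSer R s)

/-- The matrix of `D L^±(zζ)^t D⁻¹`. -/
noncomputable def Lconj (R : Coeffs m n (PowerSeries K)) (s : ℤˣ) :
    Matrix (Idx m n) (Idx m n) (PowerSeries (U R)) :=
  Matrix.diagonal (fun i => algebraMap K (PowerSeries (U R)) (dEntry i))
    * op₁ (superT fun i j => shift s (zeta m n) (lSer R s i j))
    * Matrix.diagonal (fun i => algebraMap K (PowerSeries (U R)) (dEntry i)⁻¹)

/-- The defining identity of `c^±(z)`:
`D L^±(zζ)^t D⁻¹ L^±(z) = L^±(z) D L^±(zζ)^t D⁻¹ = c^±(z)`. -/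
def IsCSeries (R : Coeffs m n (PowerSeries K)) (s : ℤˣ) (c : PowerSeries (U R)) : Prop :=
  Lconj R s * L R s = Matrix.diagonal (fun _ => c) ∧
    L R s * Lconj R s = Matrix.diagonal (fun _ => c)

/-- The leading principal submatrix of `L^±(z)` on the indices before `i`. -/
noncomputable def leading (R : Coeffs m n (PowerSeries K)) (s : ℤˣ) (i : Idx m n) :
    Matrix {a : Idx m n // a < i} {a : Idx m n // a < i} (PowerSeries (U R)) :=
  (L R s).submatrix Subtype.val Subtype.val

/-- The Gaussian generator `h_i^±(z)`: the quasideterminant, with the `(i, i)` entry boxed, of the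
leading principal submatrix of `L^±(z)` on the indices up to `i`. -/
noncomputable def h (R : Coeffs m n (PowerSeries K)) (s : ℤˣ) (i : Idx m n) : PowerSeries (U R) :=
  L R s i i - ∑ a : {a : Idx m n // a < i}, ∑ b : {a : Idx m n // a < i},
    L R s i a * Ring.inverse (leading R s i) a b * L R s b i

/-- The quotient `h_i^±(a z) / h_i^±(b z)`. -/
noncomputable def hRatio (R : Coeffs m n (PowerSeries K)) (s : ℤˣ) (i : Idx m n) (a b : K) :
    PowerSeries (U R) :=
  shift s a (h R s i) * Ring.inverse (shift s b (h R s i))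

/-- The index `k + 1` for `k ≤ m + n`. -/
def idx (k : ℕ) (hk : k ≤ m + n) : Idx m n := ⟨k, by omega⟩

/-- The product
`∏_{i=1}^n h_i^±(zζq^{2i-2}) / h_i^±(zζq^{2i}) ·
  ∏_{i=1}^m h_{n+i}^±(zq^{2m-2i+1}) / h_{n+i}^±(zq^{2m-2i-1}) ·
  h_{m+n+1}^±(z) h_{m+n+1}^±(q⁻¹z)`,
the factors being taken in this order. Here `i` starts at `0`. -/
noncomputable def cProduct (R : Coeffs m n (PowerSeries K)) (s : ℤˣ) : PowerSeries (U R) :=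
  ((List.finRange n).map fun i : Fin n =>
      hRatio R s (idx i.val (by omega))
        (zeta m n * q ^ (2 * ((i.val : ℤ) + 1) - 2)) (zeta m n * q ^ (2 * ((i.val : ℤ) + 1)))).prod
    * ((List.finRange m).map fun i : Fin m =>
      hRatio R s (idx (n + i.val) (by omega))
        (q ^ (2 * (m : ℤ) - 2 * ((i.val : ℤ) + 1) + 1))
        (q ^ (2 * (m : ℤ) - 2 * ((i.val : ℤ) + 1) - 1))).prod
    * (h R s (idx (m + n) le_rfl) * shift s q⁻¹ (h R s (idx (m + n) le_rfl)))

end Gauss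

end OspRTT

/-! Write `T(u)` for the matrix of `L^±(u)` and `z` for the parameter of the R-matrix, initially
`ζ`. In the relations between series of equal sign a scalar factor of the R-matrix cancels, so both
algebras give the same relation. With denominators cleared it says that for every nonzero scalar `x`
the matrices `T(xu)` and `T(u)` satisfy the RTT relation for an R-matrix polynomial in `x`
(`isRTTFamily_L`).

Rank reduction. Let `o` be the first index of a symmetric range of indices, and `p = q^{2(ε_o,
ε_o)}`. At `x = p` the row `(o, i)` of the R-matrix, for `i` strictly inside the range, is
proportional to `⟨o, i| + η (-1)^{[o][i]} ⟨i, o|`. The corresponding rows of the product of `T(pu)`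
and `T(u)` are `T_oo(pu)` times the Schur complement of `T_oo` at `u` (`fuse_eq_mul_schur`). On
these rows `R_13(px) R_23(x)` acts as a scalar times the R-matrix of the range without `o` and `\bar
o`, with `z` replaced by `z / p` (`fusedRow_eq`, `fusedCol_eq`). Hence the Schur complement
satisfies a relation of the same type and commutes with `T_oo` (`IsRTTFamily.schur_isRTTFamily`,
`IsRTTFamily.commute_schur`). Such identities arise first away from the zeros of a polynomial in
`x`; their coefficients are Laurent polynomials in `x`, so they hold for all nonzero `x`. Iteration
yields the Gauss decomposition: the successive pivots are the series `h_i`, and they commute.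

Contraction. At `x = z` only a rank one operator is left of the R-matrix, and the relation says that
`T(zu)^t` and `T(u)`, contracted in either order, give one and the same scalar series
(`exists_contr`). Let `ζ_k` be the parameter and `C_k` this scalar after `k` eliminations. Since
`ζ_k = p ζ_{k+1}`, the matrices `T(ζ_k u)` and `T(ζ_{k+1} u)` stand in the position of fusion, which
gives `C_k(u) h(ζ_{k+1} u) = h(ζ_k u) C_{k+1}(u)` for the pivot `h` of that step
(`contr_recursion`). At the end one index remains, the parameter is `q⁻¹`, and the scalar is the
last pivot at `u` times the last pivot at `q⁻¹ u`. Multiplying the ratios gives the formula. -/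

namespace OspRTT

open Finset

/-! ### Parity signs, nested index ranges, rows and columns of the R-matrix. -/

section Signs

variable {m n : ℕ}

/-- The sign `(-1)^{[i][k]}` as a scalar. -/
noncomputable def pairSign (i k : Idx m n) : K := (-1) ^ (par i * par k)

lemma par_rev (i : Idx m n) : par i.rev = par i := by
  have := i.isLt
  simp only [par, Fin.val_rev]
  split_ifs <;> omega

lemma par_eq_zero_or_one (i : Idx m n) : par i = 0 ∨ par i = 1 := by
  unfold par; split_ifs <;> simp

lemma pairSign_comm (i k : Idx m n) : pairSign i k = pairSign k i := by
  simp [pairSign, mul_comm]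

lemma pairSign_mul_self (i k : Idx m n) : pairSign i k * pairSign i k = 1 := by
  rw [pairSign, ← mul_pow]; simp

@[simp] lemma pairSign_rev_left (i k : Idx m n) : pairSign i.rev k = pairSign i k := by
  simp [pairSign, par_rev]

@[simp] lemma pairSign_rev_right (i k : Idx m n) : pairSign i k.rev = pairSign i k := by
  simp [pairSign, par_rev]

lemma pairSign_eq_or (i k : Idx m n) : pairSign i k = 1 ∨ pairSign i k = -1 := by
  unfold pairSign; exact neg_one_pow_eq_or K _

/-- The indices `i` with `k ≤ i ≤ \bar k`. -/
def inner (m n k : ℕ) : Finset (Idx m n) :=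
  univ.filter fun i => k ≤ i.val ∧ k ≤ i.rev.val

lemma mem_inner {k : ℕ} {i : Idx m n} : i ∈ inner m n k ↔ k ≤ i.val ∧ k ≤ i.rev.val := by
  simp [inner]

lemma rev_mem_inner {k : ℕ} {i : Idx m n} : i.rev ∈ inner m n k ↔ i ∈ inner m n k := by
  simp only [mem_inner, Fin.rev_rev]; tauto

/-- Splits off the outermost pair `o`, `\bar o`; every reduction of the rank passes through this
decomposition. -/
lemma sum_inner {M : Type*} [AddCommMonoid M] (o : Idx m n) (ho : o.val < m + n)
    (F : Idx m n → M) :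
    ∑ a ∈ inner m n o.val, F a = F o + F o.rev + ∑ a ∈ inner m n (o.val + 1), F a := by
  have h : inner m n o.val = insert o (insert o.rev (inner m n (o.val + 1))) := by
    ext i
    have := i.isLt
    simp only [mem_inner, mem_insert, Fin.ext_iff, Fin.val_rev]
    omega
  rw [h, sum_insert, sum_insert]
  · exact (add_assoc _ _ _).symm
  · simp only [mem_inner, Fin.rev_rev]; omega
  · simp only [mem_inner, mem_insert, Fin.ext_iff, Fin.val_rev]; omega

section order
variable {o : Idx m n} {i : Idx m n}

lemma lt_of_mem_inner (hi : i ∈ inner m n (o.val + 1)) : o < i := by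
  rw [mem_inner] at hi; exact Fin.lt_def.2 (by omega)

lemma lt_rev_of_mem_inner (hi : i ∈ inner m n (o.val + 1)) : i < o.rev := by
  rw [mem_inner] at hi; have := i.isLt; have := o.isLt
  simp only [Fin.val_rev] at hi; exact Fin.lt_def.2 (by rw [Fin.val_rev]; omega)

lemma lt_rev_self (ho : o.val < m + n) : o < o.rev :=
  Fin.lt_def.2 (by rw [Fin.val_rev]; omega)

lemma self_mem_inner (ho : o.val ≤ m + n) : o ∈ inner m n o.val := by
  rw [mem_inner, Fin.val_rev]; omega

lemma inner_succ_subset (k : ℕ) : inner m n (k + 1) ⊆ inner m n k := by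
  intro i; simp only [mem_inner]; omega

end order

/-! ### The `R`-matrix with denominators cleared -/

/-- `q^{(ε_i, ε_i)}`. -/
noncomputable def qEps (i : Idx m n) : K := q ^ epsSq i

/-- The diagonal entries of the operator `B`. -/
noncomputable def diagB (i k : Idx m n) : K :=
  if k = i then qEps i else if k = i.rev then (qEps i)⁻¹ else 1

/-- `ξ_i q^{(ρ, ε_i)}`: the column vector of the rank one operator `Q`. -/
noncomputable def colQ (i : Idx m n) : K := (xi i : K) * qh ^ twoRho i

/-- `(-1)^{[i]} ξ_i q^{-(ρ, ε_i)}`: the row vector of the rank one operator `Q`. -/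
noncomputable def rowQ (i : Idx m n) : K := (sgn (par i) : K) * (xi i : K) * qh ^ (-twoRho i)

/-- The coefficient of `v_i ⊗ v_k` in the `R`-matrix applied to itself. -/
noncomputable def diagCoeff (z x : K) (i k : Idx m n) : K := (1 - x) * (x - z) * diagB i k

/-- The `(i, k), (k, i)` entry of the `R`-matrix, apart from the contribution of `Q`. -/
noncomputable def swapCoeff (z x : K) (i k : Idx m n) : K :=
  pairSign i k * (q - q⁻¹) * (x - z) * if k < i then 1 else x

/-- The `(i, \bar i), (j, \bar j)` entry coming from `Q` and from the second part of `B`. -/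
noncomputable def contrCoeff (z x : K) (i j : Idx m n) : K :=
  (q - q⁻¹) * (1 - x) * (colQ i * rowQ j) * if j < i then z else x

/-- The `(i, k), (j, l)` entry of `(q - q⁻¹ x)(x - z) \tilde R(x)`, with a free parameter `z` in
place of `ζ`. -/
noncomputable def rEntry (z x : K) (i k j l : Idx m n) : K :=
  (if j = i ∧ l = k then diagCoeff z x i k else 0) +
    (if j = k ∧ l = i then swapCoeff z x i k else 0) +
    (if k = i.rev ∧ l = j.rev then contrCoeff z x i j else 0)

/-- The R-matrix is even. In multiplicative form, the sign for moving an element of the parity of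
`t` past both tensor factors is constant on the support of a row or column, so it can be pulled out
of sums. -/
lemma rEntry_even {z x : K} {i k j l : Idx m n} (h : rEntry z x i k j l ≠ 0) (t : Idx m n) :
    pairSign t i * pairSign t k = pairSign t j * pairSign t l := by
  unfold rEntry at h
  by_cases h1 : j = i ∧ l = k
  · rw [h1.1, h1.2]
  by_cases h2 : j = k ∧ l = i
  · rw [h2.1, h2.2, mul_comm]
  by_cases h3 : k = i.rev ∧ l = j.rev
  · rw [h3.1, h3.2, pairSign_rev_right, pairSign_rev_right, pairSign_mul_self, pairSign_mul_self]
  · simp [h1, h2, h3] at h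

variable {M : Type*} [AddCommGroup M] [Module K M]

/-- The row `(i, c)` of the `R`-matrix on the indices `k, …, \bar k`, applied to a family `F`. -/
noncomputable def rowSum (z x : K) (k : ℕ) (i c : Idx m n) (F : Idx m n → Idx m n → M) : M :=
  ∑ a ∈ inner m n k, ∑ b ∈ inner m n k, rEntry z x i c a b • F a b

/-- A family `F` applied to the column `(j, l)` of the `R`-matrix on the indices `k, …, \bar k`. -/
noncomputable def colSum (z x : K) (k : ℕ) (j l : Idx m n) (F : Idx m n → Idx m n → M) : M :=
  ∑ a ∈ inner m n k, ∑ b ∈ inner m n k, rEntry z x a b j l • F a b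

/-- A row has a diagonal entry, a transposed entry, and, only when `c = \bar i`, a contraction. All
later computations with the R-matrix use this form and its analogue for columns. -/
lemma rowSum_eq (z x : K) (k : ℕ) {i c : Idx m n} (hi : i ∈ inner m n k)
    (hc : c ∈ inner m n k) (F : Idx m n → Idx m n → M) :
    rowSum z x k i c F =
      diagCoeff z x i c • F i c + swapCoeff z x i c • F c i +
        if c = i.rev then ∑ a ∈ inner m n k, contrCoeff z x i a • F a a.rev else 0 := by
  simp only [rowSum, rEntry, add_smul, sum_add_distrib, ite_and, ite_smul, zero_smul]
  congr 1
  · congr 1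
    · simp [hi, hc]
    · simp [hi, hc]
  · split_ifs with h
    · refine sum_congr rfl fun a ha => ?_
      simp [rev_mem_inner, ha]
    · simp

lemma colSum_eq (z x : K) (k : ℕ) {j l : Idx m n} (hj : j ∈ inner m n k)
    (hl : l ∈ inner m n k) (F : Idx m n → Idx m n → M) :
    colSum z x k j l F =
      diagCoeff z x j l • F j l + swapCoeff z x l j • F l j +
        if l = j.rev then ∑ a ∈ inner m n k, contrCoeff z x a j • F a a.rev else 0 := by
  simp only [colSum, rEntry, add_smul, sum_add_distrib, ite_and, ite_smul, zero_smul]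
  congr 1
  · congr 1
    · simp [hj, hl]
    · rw [sum_comm]; simp [hj, hl]
  · split_ifs with h
    · refine sum_congr rfl fun a ha => ?_
      simp [rev_mem_inner, ha]
    · simp

end Signs

end OspRTT

namespace OspRTT

open Finset

/-! ### Fusion of two R-matrices: rows inside the smaller range. -/

section Fusion

variable {m n : ℕ}

lemma qh_ne_zero : (qh : K) ≠ 0 := RatFunc.X_ne_zero

lemma q_ne_zero : (q : K) ≠ 0 := pow_ne_zero _ qh_ne_zero

lemma qEps_ne_zero (o : Idx m n) : qEps o ≠ 0 := zpow_ne_zero _ q_ne_zero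

lemma rev_ne_self {o : Idx m n} (ho : o.val < m + n) : o.rev ≠ o := (lt_rev_self ho).ne'

lemma qEps_eq {o : Idx m n} (ho : o.val < m + n) :
    qEps o = if par o = 0 then q else q⁻¹ := by
  unfold qEps epsSq
  rw [if_neg (rev_ne_self ho)]
  rcases par_eq_zero_or_one o with h | h <;> simp [h, sgn]

/-- With `t = q^{(ε_o, ε_o)}`, which is `q` or `q⁻¹` according to the parity, the sign makes the
formula uniform. Even and odd `o` are then treated by one computation in `t`. -/
lemma q_sub_inv {o : Idx m n} (ho : o.val < m + n) :
    q - q⁻¹ = pairSign o o * (qEps o - (qEps o)⁻¹) := by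
  rw [qEps_eq ho, pairSign]
  rcases par_eq_zero_or_one o with h | h <;> simp [h]

lemma intCast_sgn (k : ℕ) : ((sgn k : ℤ) : K) = (-1) ^ k := by simp [sgn]

lemma xi_mul_self (i : Idx m n) : (xi i : K) * (xi i : K) = 1 := by
  have h : xi i * xi i = 1 := by
    unfold xi sgn; split_ifs
    · rfl
    · rw [← mul_pow]; simp
    · rw [neg_mul_neg, ← mul_pow]; simp
  exact_mod_cast congrArg (Int.cast : ℤ → K) h

/-- The powers of `q^{1/2}` cancel and `ξ_i² = 1`, so only the parity sign survives. -/
lemma rowQ_mul_colQ (i : Idx m n) : rowQ i * colQ i = pairSign i i := by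
  have h1 : qh ^ (-twoRho i) * qh ^ twoRho i = 1 := by
    rw [← zpow_add₀ qh_ne_zero]; simp
  have h2 : ((sgn (par i) : ℤ) : K) = pairSign i i := by
    rw [intCast_sgn, pairSign]
    rcases par_eq_zero_or_one i with h | h <;> simp [h]
  unfold rowQ colQ
  linear_combination ((sgn (par i) : ℤ) : K) * (xi i : K) * (xi i : K) * h1
    + ((sgn (par i) : ℤ) : K) * xi_mul_self i + h2

/-- The coefficient `η` for which `v_o ⊗ v_i + η (-1)^{[o][i]} v_i ⊗ v_o` spans the image of the
`R`-matrix at `q^{2(ε_o, ε_o)}`. -/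
noncomputable def fuseCoeff (o : Idx m n) : K := -(pairSign o o * qEps o)

section diag
variable {o i : Idx m n}

lemma diagB_self_left (hi : i ∈ inner m n (o.val + 1)) : diagB o i = 1 := by
  rw [diagB, if_neg (lt_of_mem_inner hi).ne', if_neg (lt_rev_of_mem_inner hi).ne]

lemma diagB_self_right (hi : i ∈ inner m n (o.val + 1)) : diagB i o = 1 := by
  rw [diagB, if_neg (lt_of_mem_inner hi).ne, if_neg]
  intro h
  exact (lt_rev_of_mem_inner hi).ne (by rw [h, Fin.rev_rev])

lemma diagB_self (o : Idx m n) : diagB o o = qEps o := if_pos rfl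

lemma diagB_rev (ho : o.val < m + n) : diagB o o.rev = (qEps o)⁻¹ := by
  rw [diagB, if_neg (rev_ne_self ho), if_pos rfl]

end diag

/-- The scalar by which the fused `R`-matrix differs from the `R`-matrix of lower rank. -/
noncomputable def fuseFactor (z x : K) (o : Idx m n) : K :=
  qEps o ^ 2 * (x - z) * (1 - qEps o ^ 2 * x)

section coefficients
variable {o i c a : Idx m n} (z x : K)

lemma diagCoeff_mul_diagCoeff (hc : c ∈ inner m n (o.val + 1)) :
    diagCoeff z (qEps o ^ 2 * x) o c * diagCoeff z x i c =
      fuseFactor z x o * diagCoeff ((qEps o ^ 2)⁻¹ * z) x i c := by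
  have ht := qEps_ne_zero o
  simp only [diagCoeff, fuseFactor, diagB_self_left hc]
  field_simp

lemma diagCoeff_mul_diagCoeff' (hc : c ∈ inner m n (o.val + 1)) :
    diagCoeff z (qEps o ^ 2 * x) i c * diagCoeff z x o c =
      fuseFactor z x o * diagCoeff ((qEps o ^ 2)⁻¹ * z) x i c := by
  have ht := qEps_ne_zero o
  simp only [diagCoeff, fuseFactor, diagB_self_left hc]
  field_simp

lemma diagCoeff_mul_swapCoeff (hc : c ∈ inner m n (o.val + 1)) :
    diagCoeff z (qEps o ^ 2 * x) o c * swapCoeff z x i a =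
      fuseFactor z x o * swapCoeff ((qEps o ^ 2)⁻¹ * z) x i a := by
  have ht := qEps_ne_zero o
  simp only [diagCoeff, swapCoeff, fuseFactor, diagB_self_left hc]
  field_simp

/-- The two ways of producing the term with `o` in the second space, one from each of the rows `⟨o,
i|` and `⟨i, o|`, add up to the transposed entry of lower rank. The value of `η` is what makes them
match. -/
lemma swapCoeff_mul_swapCoeff (ho : o.val < m + n) (hi : i ∈ inner m n (o.val + 1))
    (hc : c ∈ inner m n (o.val + 1)) :
    swapCoeff z (qEps o ^ 2 * x) o c * (pairSign i o * pairSign i c) * swapCoeff z x i o +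
      fuseCoeff o * pairSign o i * (swapCoeff z (qEps o ^ 2 * x) i c *
        (pairSign o i * pairSign o c) * diagCoeff z x o i) =
      fuseFactor z x o * swapCoeff ((qEps o ^ 2)⁻¹ * z) x i c * (fuseCoeff o * pairSign o c) := by
  have ht := qEps_ne_zero o
  have hoi := lt_of_mem_inner hi
  have hoc := lt_of_mem_inner hc
  simp only [diagCoeff, swapCoeff, fuseFactor, fuseCoeff, q_sub_inv ho, diagB_self_left hi,
    if_pos hoi, if_neg hoc.not_gt, pairSign_comm i o]
  have hy : (c < i) = True ∨ (c < i) = False := by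
    by_cases h : c < i <;> simp [h]
  rcases hy with hy | hy <;> rcases pairSign_eq_or o o with h1 | h1 <;>
    rcases pairSign_eq_or o i with h2 | h2 <;> rcases pairSign_eq_or i c with h3 | h3 <;>
    simp only [hy, h1, h2, h3, if_true, if_false] <;> field_simp <;> ring

/-- The contraction over the large range also reaches `v_o ⊗ v_{\bar o}` in the last two spaces,
which has no counterpart in the smaller range. The choice of `η` makes these terms cancel. -/
lemma contrCoeff_fuse_edge (ho : o.val < m + n) (hi : i ∈ inner m n (o.val + 1))
    (hc : c ∈ inner m n (o.val + 1)) :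
    diagCoeff z (qEps o ^ 2 * x) o c * contrCoeff z x i o +
      fuseCoeff o * pairSign o o * contrCoeff z (qEps o ^ 2 * x) i o *
        (diagCoeff z x o o.rev + contrCoeff z x o o) = 0 := by
  have ht := qEps_ne_zero o
  simp only [diagCoeff, contrCoeff, fuseCoeff, q_sub_inv ho, diagB_self_left hc,
    diagB_rev ho, if_pos (lt_of_mem_inner hi), lt_irrefl, if_false,
    mul_comm (colQ o), rowQ_mul_colQ]
  rcases pairSign_eq_or o o with h | h <;> simp only [h] <;> field_simp <;> ring

/-- Contracting through the pair `(o, \bar o)` and then through `(a, \bar a)` contributes the factor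
`rowQ o * colQ o`. With `η` it becomes `1 - t²`, `t = q^{(ε_o, ε_o)}`, and this corrects `t² x - z`
to a multiple of `x - z`. -/
lemma contrCoeff_fuse (ho : o.val < m + n) (hi : i ∈ inner m n (o.val + 1))
    (hc : c ∈ inner m n (o.val + 1)) (ha : a ∈ inner m n (o.val + 1)) :
    diagCoeff z (qEps o ^ 2 * x) o c * contrCoeff z x i a +
      fuseCoeff o * pairSign o o * contrCoeff z (qEps o ^ 2 * x) i o * contrCoeff z x o a =
      fuseFactor z x o * contrCoeff ((qEps o ^ 2)⁻¹ * z) x i a := by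
  have ht := qEps_ne_zero o
  simp only [diagCoeff, contrCoeff, fuseFactor, diagB_self_left hc,
    if_pos (lt_of_mem_inner hi), if_neg (lt_of_mem_inner ha).not_gt]
  have h1 := rowQ_mul_colQ o
  have h2 : (q - q⁻¹) * qEps o = pairSign o o * (qEps o ^ 2 - 1) := by
    rw [q_sub_inv ho]; field_simp
  have h3 := pairSign_mul_self o o
  generalize q - q⁻¹ = κ at *
  have key : fuseCoeff o * pairSign o o * κ * (rowQ o * colQ o) = -(κ * qEps o) * pairSign o o := by
    rw [h1, fuseCoeff]; linear_combination (-(κ * qEps o * pairSign o o)) * h3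
  rw [h2] at key
  have key' : fuseCoeff o * pairSign o o * κ * (rowQ o * colQ o) = 1 - qEps o ^ 2 := by
    rw [key]; linear_combination (1 - qEps o ^ 2) * h3
  split_ifs
  · field_simp
    linear_combination (κ * (1 - x) * colQ i * rowQ a * (1 - qEps o ^ 2 * x) * z * x) * key'
  · field_simp
    linear_combination (κ * (1 - x) * colQ i * rowQ a * (1 - qEps o ^ 2 * x) * z * x) * key'

lemma contrCoeff_mul_diagCoeff (hc : c ∈ inner m n (o.val + 1)) :
    contrCoeff z (qEps o ^ 2 * x) i a * diagCoeff z x o c =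
      fuseFactor z x o * contrCoeff ((qEps o ^ 2)⁻¹ * z) x i a := by
  have ht := qEps_ne_zero o
  simp only [diagCoeff, contrCoeff, fuseFactor, diagB_self_left hc]
  split_ifs <;> field_simp

end coefficients

variable {M : Type*} [AddCommGroup M] [Module K M]

/-- The row of the product of two `R`-matrices, with arguments `q^{2(ε_o, ε_o)} x` and `x`, acting
in the spaces `1, 3` and `2, 3`, that belongs to the covector
`(⟨o, i| + η (-1)^{[o][i]} ⟨i, o|) ⊗ ⟨c|`, applied to a family `F`. -/
noncomputable def fusedRow (z x : K) (o i c : Idx m n) (F : Idx m n → Idx m n → Idx m n → M) : M :=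
  rowSum z (qEps o ^ 2 * x) o.val o c
      (fun a b => (pairSign i o * pairSign i a) • rowSum z x o.val i b (F a)) +
    (fuseCoeff o * pairSign o i) • rowSum z (qEps o ^ 2 * x) o.val i c
      (fun a b => (pairSign o i * pairSign o a) • rowSum z x o.val o b (F a))

section combine
variable {F M : Type*} [CommRing F] [AddCommGroup M] [Module F M]

lemma add_smul_combine {d s c g s' D η : F} {A S₁ S₂ S₃ S : M} (hA : d * s * c + η * (g * s' * D) = 0)
    (hS : (d * s) • S₁ + (η * (g * s')) • S₂ + η • S₃ = S) :
    d • s • (c • A + S₁) + η • (g • s' • (D • A + S₂) + S₃) = S := by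
  linear_combination (norm := module) hA • A + hS

lemma smul_term_combine {d c g c' g' D η η' : F} {r : F} {A B : M}
    (hA : d * c + g * c' = r) (hB : η * (g' * D) = r * η') :
    d • c • A + g • c' • A + η • g' • D • B = r • (A + η' • B) := by
  linear_combination (norm := module) hA • A + hB • B

lemma row_combine {d s d₁ w₁ w₂ s₂ w₃ η d₄ s₄ d₅ w₆ s₆ d₆ r d₇ η₇ w₈ η₈ : F} {A B C D Q₁ Q₂ Q : M}
    (hA : d * s * d₁ = r * d₇) (hB : d * s * w₁ = r * w₈)
    (hC : w₂ * s₂ * w₃ + η * (w₆ * s₆ * d₆) = r * w₈ * η₈)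
    (hD : η * (d₄ * s₄ * d₅) = r * d₇ * η₇) (hQ : d • s • Q₁ + η • Q₂ = r • Q) :
    d • s • (d₁ • A + w₁ • B + Q₁) + w₂ • s₂ • w₃ • C +
      η • (d₄ • s₄ • d₅ • D + w₆ • s₆ • d₆ • C + Q₂) =
      r • (d₇ • (A + η₇ • D) + w₈ • (B + η₈ • C) + Q) := by
  linear_combination (norm := module) hA • A + hB • B + hC • C + hD • D + hQ

end combine

/-- The fused row reproduces the R-matrix on the smaller range with parameter `t⁻² z`. The
hypothesis `hF` drops the components with `o` in the last space; in the application they are set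
aside in `rowRest` and eliminated afterwards. -/
theorem fusedRow_eq (z x : K) {o i c : Idx m n} (ho : o.val < m + n)
    (hi : i ∈ inner m n (o.val + 1)) (hc : c ∈ inner m n (o.val + 1))
    (F : Idx m n → Idx m n → Idx m n → M) (hF : ∀ a b, F a b o = 0) :
    fusedRow z x o i c F = fuseFactor z x o •
      rowSum ((qEps o ^ 2)⁻¹ * z) x (o.val + 1) i c
        (fun a b => F o a b + (fuseCoeff o * pairSign o a) • F a o b) := by
  have hs := inner_succ_subset (m := m) (n := n) o.val
  have hoI := self_mem_inner ho.le
  have hoI' := rev_mem_inner.2 hoI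
  have hc' := lt_rev_of_mem_inner hc
  have hi' := lt_rev_of_mem_inner hi
  have h1 : o ≠ i.rev := fun h => hi'.ne (by rw [h, Fin.rev_rev])
  have hii := pairSign_mul_self o i
  unfold fusedRow
  rw [rowSum_eq _ _ _ hoI (hs hc), if_neg hc'.ne, rowSum_eq _ _ _ (hs hi) (hs hc),
    rowSum_eq _ _ _ (hs hi) (hs hc), rowSum_eq _ _ _ (hs hi) hoI, rowSum_eq _ _ _ hoI (hs hc),
    rowSum_eq _ _ _ hoI (hs hi), rowSum_eq _ _ _ hi hc, if_neg hc'.ne, if_neg hi'.ne, if_neg h1]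
  simp only [hF, smul_zero, add_zero, zero_add]
  -- The contraction terms of both sides, present only for `c = \bar i`; the other terms are
  -- compared one by one at the end.
  have hQ : (diagCoeff z (qEps o ^ 2 * x) o c • (pairSign i o * pairSign i o) •
        (if c = i.rev then ∑ a ∈ inner m n o.val, contrCoeff z x i a • F o a a.rev else 0)) +
      (fuseCoeff o * pairSign o i) • (if c = i.rev then ∑ a ∈ inner m n o.val,
        contrCoeff z (qEps o ^ 2 * x) i a • (pairSign o i * pairSign o a) •
          rowSum z x o.val o a.rev (F a) else 0) =
      fuseFactor z x o • (if c = i.rev then ∑ a ∈ inner m n (o.val + 1),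
        contrCoeff ((qEps o ^ 2)⁻¹ * z) x i a •
          (F o a a.rev + (fuseCoeff o * pairSign o a) • F a o a.rev) else 0) := by
    split_ifs with hci
    · have hinner : ∀ a ∈ inner m n (o.val + 1),
          rowSum z x o.val o a.rev (F a) = diagCoeff z x o a.rev • F a o a.rev := by
        intro a ha
        rw [rowSum_eq _ _ _ hoI (rev_mem_inner.2 (hs ha)), if_neg, hF, smul_zero, add_zero,
          add_zero]
        exact fun h => (lt_of_mem_inner ha).ne' (Fin.rev_injective h)
      have hrev : rowSum z x o.val o o.rev (F o) =
          (diagCoeff z x o o.rev + contrCoeff z x o o) • F o o o.rev +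
            ∑ a ∈ inner m n (o.val + 1), contrCoeff z x o a • F o a a.rev := by
        rw [rowSum_eq _ _ _ hoI hoI', if_pos rfl, sum_inner o ho, Fin.rev_rev, hF, smul_zero,
          smul_zero, add_zero, add_zero, add_smul]
        exact (add_assoc _ _ _).symm
      have hself : rowSum z x o.val o o (F o.rev) = 0 := by
        rw [rowSum_eq _ _ _ hoI hoI, if_neg (rev_ne_self ho).symm, hF, smul_zero, smul_zero,
          add_zero, add_zero]
      have hsum : ∑ a ∈ inner m n (o.val + 1), contrCoeff z (qEps o ^ 2 * x) i a •
            (pairSign o i * pairSign o a) • rowSum z x o.val o a.rev (F a) =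
          ∑ a ∈ inner m n (o.val + 1), contrCoeff z (qEps o ^ 2 * x) i a •
            (pairSign o i * pairSign o a) • diagCoeff z x o a.rev • F a o a.rev :=
        sum_congr rfl fun a ha => by rw [hinner a ha]
      rw [sum_inner o ho, sum_inner o ho, Fin.rev_rev, hF, hself, hrev, hsum, smul_zero, add_zero,
        smul_zero, smul_zero, add_zero]
      apply add_smul_combine
      · rw [pairSign_comm i o, hii]
        linear_combination contrCoeff_fuse_edge z x ho hi hc +
          (fuseCoeff o * contrCoeff z (qEps o ^ 2 * x) i o * pairSign o o *
            (diagCoeff z x o o.rev + contrCoeff z x o o)) * hii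
      · simp only [smul_sum, ← sum_add_distrib]
        refine sum_congr rfl fun a ha => ?_
        have haa := pairSign_mul_self o a
        rw [smul_smul (contrCoeff z (qEps o ^ 2 * x) i a),
          smul_smul (fuseFactor z x o)]
        apply smul_term_combine
        · rw [← contrCoeff_fuse z x ho hi hc ha, pairSign_comm i o, hii]
          linear_combination (fuseCoeff o * contrCoeff z (qEps o ^ 2 * x) i o * pairSign o o *
            contrCoeff z x o a) * hii
        · rw [← contrCoeff_mul_diagCoeff z x (rev_mem_inner.2 ha)]
          linear_combination (fuseCoeff o * contrCoeff z (qEps o ^ 2 * x) i a * pairSign o a *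
            diagCoeff z x o a.rev) * hii
    · simp
  apply row_combine _ _ _ _ hQ
  · rw [← diagCoeff_mul_diagCoeff z x hc, pairSign_comm i o, hii, mul_one]
  · rw [← diagCoeff_mul_swapCoeff z x hc, pairSign_comm i o, hii, mul_one]
  · exact swapCoeff_mul_swapCoeff z x ho hi hc
  · rw [← diagCoeff_mul_diagCoeff' z x hc, hii]; ring

end Fusion
end OspRTT

namespace OspRTT

open Finset

/-! ### Fusion of two R-matrices: the top row and the columns. -/

section Fusion

variable {m n : ℕ}

/-- The scalar by which the fused `R`-matrix acts in the highest weight space. -/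
noncomputable def fuseTop (z x : K) (o : Idx m n) : K :=
  (1 - qEps o ^ 2 * x) * (qEps o ^ 2 * x - z) * ((x - z) * (qEps o - x * (qEps o)⁻¹))

section coefficients
variable {o i : Idx m n} (z x : K)

lemma diagCoeff_add_swapCoeff (ho : o.val < m + n) :
    diagCoeff z x o o + swapCoeff z x o o = (x - z) * (qEps o - x * (qEps o)⁻¹) := by
  simp only [diagCoeff, swapCoeff, q_sub_inv ho, diagB_self, lt_irrefl, if_false]
  linear_combination ((x - z) * x * (qEps o - (qEps o)⁻¹)) * pairSign_mul_self o o

lemma diagCoeff_mul_top (ho : o.val < m + n) (hi : i ∈ inner m n (o.val + 1)) :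
    diagCoeff z (qEps o ^ 2 * x) i o * (diagCoeff z x o o + swapCoeff z x o o) =
      fuseTop z x o := by
  rw [diagCoeff_add_swapCoeff z x ho, diagCoeff, fuseTop, diagB_self_right hi, mul_one]

lemma top_mul_diagCoeff (ho : o.val < m + n) (hi : i ∈ inner m n (o.val + 1)) :
    (diagCoeff z (qEps o ^ 2 * x) o o + swapCoeff z (qEps o ^ 2 * x) o o) * diagCoeff z x i o +
      fuseCoeff o * pairSign o o * (swapCoeff z (qEps o ^ 2 * x) i o * swapCoeff z x o i) =
      fuseTop z x o := by
  have ht := qEps_ne_zero o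
  have hoi := lt_of_mem_inner hi
  rw [diagCoeff_add_swapCoeff _ _ ho]
  simp only [diagCoeff, swapCoeff, fuseTop, fuseCoeff, q_sub_inv ho, diagB_self_right hi,
    if_pos hoi, if_neg hoi.not_gt, pairSign_comm i o]
  rcases pairSign_eq_or o o with h1 | h1 <;> rcases pairSign_eq_or o i with h2 | h2 <;>
    simp only [h1, h2] <;> field_simp <;> ring

lemma top_mul_swapCoeff (ho : o.val < m + n) (hi : i ∈ inner m n (o.val + 1)) :
    (diagCoeff z (qEps o ^ 2 * x) o o + swapCoeff z (qEps o ^ 2 * x) o o) * swapCoeff z x i o +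
      fuseCoeff o * pairSign o o * (swapCoeff z (qEps o ^ 2 * x) i o * diagCoeff z x o i) = 0 := by
  have ht := qEps_ne_zero o
  have hoi := lt_of_mem_inner hi
  rw [diagCoeff_add_swapCoeff _ _ ho]
  simp only [diagCoeff, swapCoeff, fuseCoeff, q_sub_inv ho, diagB_self_left hi,
    if_pos hoi, pairSign_comm i o]
  rcases pairSign_eq_or o o with h1 | h1 <;> rcases pairSign_eq_or o i with h2 | h2 <;>
    simp only [h1, h2] <;> field_simp <;> ring

end coefficients

section combine
variable {F M : Type*} [CommRing F] [AddCommGroup M] [Module F M]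

lemma top_row_combine {d₁ w₁ s₁ d₂ w₂ η d₃ s₃ d₄ w₄ w₅ s₅ d₆ w₆ r η' : F} {A B C : M}
    (hA : (d₁ + w₁) * s₁ * d₂ + η * (w₅ * s₅ * w₆) = r)
    (hB : (d₁ + w₁) * s₁ * w₂ + η * (w₅ * s₅ * d₆) = 0)
    (hC : η * (d₃ * s₃ * (d₄ + w₄)) = r * η') :
    d₁ • s₁ • (d₂ • A + w₂ • B) + w₁ • s₁ • (d₂ • A + w₂ • B) +
      η • (d₃ • s₃ • (d₄ • C + w₄ • C) + w₅ • s₅ • (d₆ • B + w₆ • A)) = r • (A + η' • C) := by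
  linear_combination (norm := module) hA • A + hB • B + hC • C

end combine

variable {M : Type*} [AddCommGroup M] [Module K M]

/-- With `o` also in the last space, weight considerations leave only the components with indices
`o, o, i` in some order. The component `o, i` in the last two spaces cancels by the choice of `η`,
so the operator acts as a scalar. -/
theorem fusedRow_top (z x : K) {o i : Idx m n} (ho : o.val < m + n)
    (hi : i ∈ inner m n (o.val + 1)) (F : Idx m n → Idx m n → Idx m n → M) :
    fusedRow z x o i o F =
      fuseTop z x o • (F o i o + (fuseCoeff o * pairSign o i) • F i o o) := by
  have hs := inner_succ_subset (m := m) (n := n) o.val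
  have hoI := self_mem_inner ho.le
  have hi' := lt_rev_of_mem_inner hi
  have h1 : o ≠ i.rev := fun h => hi'.ne (by rw [h, Fin.rev_rev])
  have hii := pairSign_mul_self o i
  unfold fusedRow
  rw [rowSum_eq _ _ _ hoI hoI, if_neg (rev_ne_self ho).symm, rowSum_eq _ _ _ (hs hi) hoI,
    rowSum_eq _ _ _ (hs hi) hoI, rowSum_eq _ _ _ hoI hoI,
    rowSum_eq _ _ _ hoI (hs hi), if_neg hi'.ne, if_neg h1, if_neg h1,
    if_neg (rev_ne_self ho).symm]
  simp only [add_zero]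
  apply top_row_combine
  · rw [← top_mul_diagCoeff z x ho hi, pairSign_comm i o, hii]
    linear_combination (fuseCoeff o * pairSign o o * (swapCoeff z (qEps o ^ 2 * x) i o *
      swapCoeff z x o i)) * hii
  · rw [← top_mul_swapCoeff z x ho hi, pairSign_comm i o, hii]
    linear_combination (fuseCoeff o * pairSign o o * (swapCoeff z (qEps o ^ 2 * x) i o *
      diagCoeff z x o i)) * hii
  · rw [← diagCoeff_mul_top z x ho hi, hii]; ring

/-- A family `G` applied to the column `(o, j, l)` of the product of two `R`-matrices, with
arguments `q^{2(ε_o, ε_o)} x` and `x`, acting in the spaces `1, 3` and `2, 3`. -/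
noncomputable def fusedCol (z x : K) (o j l : Idx m n) (G : Idx m n → Idx m n → Idx m n → M) : M :=
  colSum z x o.val j l fun a b => colSum z (qEps o ^ 2 * x) o.val o b fun a' b' =>
    (pairSign a o * pairSign a a') • G a' a b'

/-- Dual to `fusedRow_eq`. The conditions `hG₀` and `hG₁` express that `G` factors through the fused
space; for fused matrices they are supplied by `fuse_self` and `fuse_swap`. -/
theorem fusedCol_eq (z x : K) {o j l : Idx m n} (ho : o.val < m + n)
    (hj : j ∈ inner m n (o.val + 1)) (hl : l ∈ inner m n (o.val + 1))
    (G : Idx m n → Idx m n → Idx m n → M) (hG : ∀ a b, G a b o = 0) (hG₀ : ∀ b, G o o b = 0)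
    (hG₁ : ∀ a ∈ inner m n (o.val + 1), ∀ b,
      G a o b = (fuseCoeff o * pairSign o a) • G o a b) :
    fusedCol z x o j l G = fuseFactor z x o •
      colSum ((qEps o ^ 2)⁻¹ * z) x (o.val + 1) j l (G o) := by
  have hs := inner_succ_subset (m := m) (n := n) o.val
  have hoI := self_mem_inner ho.le
  have hoI' := rev_mem_inner.2 hoI
  have hinner : ∀ a, ∀ b ∈ inner m n (o.val + 1),
      (colSum z (qEps o ^ 2 * x) o.val o b fun a' b' =>
        (pairSign a o * pairSign a a') • G a' a b') =
      diagCoeff z (qEps o ^ 2 * x) o b • G o a b := by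
    intro a b hb
    rw [colSum_eq _ _ _ hoI (hs hb), if_neg (lt_rev_of_mem_inner hb).ne, hG, smul_zero, smul_zero,
      add_zero, add_zero, pairSign_mul_self, one_smul]
  have hrev : (colSum z (qEps o ^ 2 * x) o.val o o.rev fun a' b' =>
        (pairSign o o * pairSign o a') • G a' o b') =
      ∑ a ∈ inner m n (o.val + 1),
        (fuseCoeff o * pairSign o o * contrCoeff z (qEps o ^ 2 * x) a o) • G o a a.rev := by
    rw [colSum_eq _ _ _ hoI hoI', if_pos rfl, sum_inner o ho, Fin.rev_rev]
    simp only [hG, hG₀, smul_zero, add_zero, zero_add]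
    refine sum_congr rfl fun a ha => ?_
    rw [hG₁ a ha, smul_smul, smul_smul]
    congr 1
    linear_combination (fuseCoeff o * pairSign o o * contrCoeff z (qEps o ^ 2 * x) a o) *
      pairSign_mul_self o a
  have hself : (colSum z (qEps o ^ 2 * x) o.val o o fun a' b' =>
        (pairSign o.rev o * pairSign o.rev a') • G a' o.rev b') = 0 := by
    rw [colSum_eq _ _ _ hoI hoI, if_neg (rev_ne_self ho).symm]
    simp only [hG, smul_zero, add_zero]
  unfold fusedCol
  rw [colSum_eq _ _ _ (hs hj) (hs hl), hinner j l hl, hinner l j hj, colSum_eq _ _ _ hj hl,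
    smul_add, smul_add, smul_smul, smul_smul, smul_smul, smul_smul,
    ← diagCoeff_mul_diagCoeff z x hl, ← diagCoeff_mul_swapCoeff z x hj,
    mul_comm (diagCoeff z x j l), mul_comm (swapCoeff z x l j)]
  congr 1
  split_ifs with hlj
  · rw [sum_inner o ho, Fin.rev_rev, hrev, hself, smul_zero, add_zero, smul_sum, smul_sum,
      ← sum_add_distrib]
    refine sum_congr rfl fun a ha => ?_
    rw [hinner a _ (rev_mem_inner.2 ha), smul_smul, smul_smul, smul_smul, ← add_smul,
      ← contrCoeff_fuse z x ho ha (rev_mem_inner.2 ha) hj]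
    congr 1
    ring
  · rw [smul_zero]

theorem fusedCol_top (z x : K) {o j : Idx m n} (ho : o.val < m + n)
    (hj : j ∈ inner m n (o.val + 1))
    (G : Idx m n → Idx m n → Idx m n → M) (hG₀ : ∀ b, G o o b = 0)
    (hG₁ : ∀ a ∈ inner m n (o.val + 1), ∀ b,
      G a o b = (fuseCoeff o * pairSign o a) • G o a b) :
    fusedCol z x o j o G = fuseTop z x o • G o j o := by
  have hs := inner_succ_subset (m := m) (n := n) o.val
  have hoI := self_mem_inner ho.le
  have h1 : o ≠ j.rev := fun h => (lt_rev_of_mem_inner hj).ne (by rw [h, Fin.rev_rev])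
  unfold fusedCol
  rw [colSum_eq _ _ _ (hs hj) hoI, colSum_eq _ _ _ hoI hoI, colSum_eq _ _ _ hoI (hs hj),
    if_neg h1, if_neg (rev_ne_self ho).symm, if_neg (lt_rev_of_mem_inner hj).ne, hG₀,
    hG₁ j hj, ← top_mul_diagCoeff z x ho hj]
  have hjj := pairSign_mul_self o j
  simp only [smul_smul, smul_zero, add_zero, zero_add, ← add_smul]
  congr 1
  rw [pairSign_comm j o]
  linear_combination ((diagCoeff z (qEps o ^ 2 * x) o o + swapCoeff z (qEps o ^ 2 * x) o o) *
    diagCoeff z x j o + swapCoeff z x o j * swapCoeff z (qEps o ^ 2 * x) j o * pairSign o o *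
      fuseCoeff o) * hjj

end Fusion
end OspRTT

namespace OspRTT

open Finset

/-! ### The RTT relation and its consequence for three matrices. -/

section ThreeSlot

variable {m n : ℕ} {S : Type*} [Ring S] [Algebra K S]

/-- The `RTT` relation between two matrices on the indices `k, …, \bar k`, for the `R`-matrix with
argument `x`. -/
def IsRTT (z x : K) (k : ℕ) (X Y : Idx m n → Idx m n → S) : Prop :=
  ∀ i ∈ inner m n k, ∀ c ∈ inner m n k, ∀ j ∈ inner m n k, ∀ l ∈ inner m n k,
    rowSum z x k i c (fun a b => (pairSign a b * pairSign j b) • (X a j * Y b l)) =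
      colSum z x k j l (fun a b => (pairSign i b * pairSign a b) • (Y c b * X i a))

section linear
variable {M : Type*} [AddCommGroup M] [Module K M]

lemma rowSum_smul_of_even (z x : K) (k : ℕ) (i c : Idx m n) (s : Idx m n → Idx m n → K) (t : K)
    (hs : ∀ a b, rEntry z x i c a b ≠ 0 → s a b = t) (F : Idx m n → Idx m n → M) :
    rowSum z x k i c (fun a b => s a b • F a b) = t • rowSum z x k i c F := by
  simp only [rowSum, smul_sum]
  refine sum_congr rfl fun a _ => sum_congr rfl fun b _ => ?_
  by_cases h : rEntry z x i c a b = 0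
  · simp [h]
  · rw [hs a b h, smul_comm]

lemma colSum_congr_of_even (z x : K) (k : ℕ) (j l : Idx m n) (F G : Idx m n → Idx m n → M)
    (hs : ∀ a b, rEntry z x a b j l ≠ 0 → F a b = G a b) :
    colSum z x k j l F = colSum z x k j l G := by
  refine sum_congr rfl fun a _ => sum_congr rfl fun b _ => ?_
  by_cases h : rEntry z x a b j l = 0
  · simp [h]
  · rw [hs a b h]

lemma rowSum_congr (z x : K) (k : ℕ) (i c : Idx m n) {F G : Idx m n → Idx m n → M}
    (h : ∀ a ∈ inner m n k, ∀ b ∈ inner m n k, F a b = G a b) :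
    rowSum z x k i c F = rowSum z x k i c G :=
  sum_congr rfl fun a ha => sum_congr rfl fun b hb => by rw [h a ha b hb]

lemma colSum_congr (z x : K) (k : ℕ) (j l : Idx m n) {F G : Idx m n → Idx m n → M}
    (h : ∀ a ∈ inner m n k, ∀ b ∈ inner m n k, F a b = G a b) :
    colSum z x k j l F = colSum z x k j l G :=
  sum_congr rfl fun a ha => sum_congr rfl fun b hb => by rw [h a ha b hb]

lemma rowSum_map {N : Type*} [AddCommGroup N] [Module K N] (f : M →ₗ[K] N) (z x : K) (k : ℕ)
    (i c : Idx m n) (F : Idx m n → Idx m n → M) :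
    f (rowSum z x k i c F) = rowSum z x k i c fun a b => f (F a b) := by
  simp [rowSum]

lemma colSum_map {N : Type*} [AddCommGroup N] [Module K N] (f : M →ₗ[K] N) (z x : K) (k : ℕ)
    (j l : Idx m n) (F : Idx m n → Idx m n → M) :
    f (colSum z x k j l F) = colSum z x k j l fun a b => f (F a b) := by
  simp [colSum]

lemma colSum_smul (t z x : K) (k : ℕ) (j l : Idx m n) (F : Idx m n → Idx m n → M) :
    t • colSum z x k j l F = colSum z x k j l fun a b => t • F a b :=
  colSum_map (t • LinearMap.id) z x k j l F

lemma rowSum_colSum_comm (z x z' x' : K) (k : ℕ) (i c j l : Idx m n)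
    (F : Idx m n → Idx m n → Idx m n → Idx m n → M) :
    rowSum z x k i c (fun a b => colSum z' x' k j l (F a b)) =
      colSum z' x' k j l (fun a' b' => rowSum z x k i c fun a b => F a b a' b') := by
  simp only [rowSum, colSum, smul_sum]
  rw [sum_congr rfl fun a _ => sum_comm, sum_comm]
  refine sum_congr rfl fun a' _ => ?_
  rw [sum_congr rfl fun a _ => sum_comm, sum_comm]
  refine sum_congr rfl fun b' _ => sum_congr rfl fun a _ => sum_congr rfl fun b _ => ?_
  rw [smul_comm]

end linear

/-- Moving one matrix through two others by means of two `RTT` relations. -/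
theorem three_slot {z x x' : K} {k : ℕ} {X' X Y : Idx m n → Idx m n → S}
    (h13 : IsRTT z x' k X' Y) (h23 : IsRTT z x k X Y) {u y c y₁ y₂ l : Idx m n}
    (hu : u ∈ inner m n k) (hy : y ∈ inner m n k) (hc : c ∈ inner m n k)
    (hy₁ : y₁ ∈ inner m n k) (hy₂ : y₂ ∈ inner m n k) (hl : l ∈ inner m n k) :
    rowSum z x' k u c (fun a b => (pairSign y u * pairSign y a) • rowSum z x k y b fun b' c' =>
        (pairSign a b' * pairSign y₁ b' * (pairSign a c' * pairSign y₁ c') *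
          (pairSign b' c' * pairSign y₂ c')) • (X' a y₁ * X b' y₂ * Y c' l)) =
      colSum z x k y₂ l (fun a b => colSum z x' k y₁ b fun a' b' =>
        (pairSign a y₁ * pairSign a a') • (pairSign u y * pairSign a' y *
          (pairSign u b' * pairSign a' b') * (pairSign y b' * pairSign a b')) •
            (Y c b' * X' u a' * X y a)) := by
  -- The relation in slots 2 and 3, multiplied on the left by an entry of `X'`. The sign for passing
  -- that entry is constant along the row of the R-matrix by evenness.
  have step (a b : Idx m n) (hb : b ∈ inner m n k) :
      (rowSum z x k y b fun b' c' =>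
        (pairSign a b' * pairSign y₁ b' * (pairSign a c' * pairSign y₁ c') *
          (pairSign b' c' * pairSign y₂ c')) • (X' a y₁ * X b' y₂ * Y c' l)) =
      (pairSign a y * pairSign a b * (pairSign y₁ y * pairSign y₁ b)) •
        colSum z x k y₂ l (fun a' b' =>
          (pairSign y b' * pairSign a' b') • (X' a y₁ * Y b b' * X y a')) := by
    have h1 := congrArg (LinearMap.mulLeft K (X' a y₁)) (h23 y hy b hb y₂ hy₂ l hl)
    rw [rowSum_map, colSum_map] at h1
    simp only [map_smul, LinearMap.mulLeft_apply, ← mul_assoc] at h1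
    rw [← h1, ← rowSum_smul_of_even (s := fun b' c' =>
      pairSign a b' * pairSign a c' * (pairSign y₁ b' * pairSign y₁ c'))]
    · refine rowSum_congr _ _ _ _ _ fun b' _ c' _ => ?_
      rw [smul_smul]
      congr 1
      ring
    · intro b' c' h
      rw [rEntry_even h, rEntry_even h]
  have push : rowSum z x' k u c (fun a b => (pairSign y u * pairSign y a) •
        rowSum z x k y b fun b' c' =>
          (pairSign a b' * pairSign y₁ b' * (pairSign a c' * pairSign y₁ c') *
            (pairSign b' c' * pairSign y₂ c')) • (X' a y₁ * X b' y₂ * Y c' l)) =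
      rowSum z x' k u c (fun a b => colSum z x k y₂ l fun a' b' =>
        (pairSign y b' * pairSign a' b' * (pairSign y u * pairSign y₁ y)) •
          ((pairSign a b * pairSign y₁ b) • (X' a y₁ * Y b b')) * X y a') := by
    refine rowSum_congr _ _ _ _ _ fun a _ b hb => ?_
    rw [step a b hb, smul_smul, colSum_smul]
    refine colSum_congr _ _ _ _ _ fun a' _ b' _ => ?_
    rw [smul_smul, smul_smul, smul_mul_assoc]
    congr 1
    rw [pairSign_comm y a]
    linear_combination (pairSign y u * pairSign a b * pairSign y₁ y * pairSign y₁ b *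
      pairSign y b' * pairSign a' b') * pairSign_mul_self a y
  rw [push, rowSum_colSum_comm]
  refine colSum_congr _ _ _ _ _ fun a _ b hb => ?_
  -- The relation in slots 1 and 3, multiplied on the right by an entry of `X`.
  have h2 := congrArg (((pairSign y b * pairSign a b * (pairSign y u * pairSign y₁ y)) •
    LinearMap.mulRight K (X y a))) (h13 u hu c hc y₁ hy₁ b hb)
  rw [rowSum_map, colSum_map] at h2
  simp only [LinearMap.smul_apply, LinearMap.mulRight_apply] at h2
  simp only [smul_mul_assoc] at h2 ⊢
  rw [h2]
  refine colSum_congr_of_even _ _ _ _ _ _ _ fun a' b' h => ?_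
  have e1 := rEntry_even h y
  have e2 := rEntry_even h a
  rw [smul_smul, smul_smul]
  congr 1
  rw [pairSign_comm a' y, pairSign_comm u y, pairSign_comm y₁ y]
  have e3 := pairSign_mul_self a y₁
  linear_combination (-(pairSign y u * pairSign u b' * pairSign a' b' * pairSign a y₁ *
      pairSign a a' * pairSign a b')) * e1 -
    (pairSign y y₁ * pairSign y b * pairSign y u * pairSign u b' * pairSign a' b' *
      pairSign a y₁) * e2 - (pairSign y y₁ * pairSign y b * pairSign y u * pairSign u b' *
        pairSign a' b' * pairSign a b) * e3

end ThreeSlot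
end OspRTT

namespace OspRTT

open Finset

/-! ### Fused matrices, and RTT for Schur complements at a fixed argument. -/

section Fuse

variable {m n : ℕ}

section linear
variable {M : Type*} [AddCommGroup M] [Module K M]

lemma rowSum_add (z x : K) (k : ℕ) (i c : Idx m n) (F G : Idx m n → Idx m n → M) :
    rowSum z x k i c (fun a b => F a b + G a b) = rowSum z x k i c F + rowSum z x k i c G := by
  simp [rowSum, smul_add, sum_add_distrib]

lemma colSum_add (z x : K) (k : ℕ) (j l : Idx m n) (F G : Idx m n → Idx m n → M) :
    colSum z x k j l (fun a b => F a b + G a b) = colSum z x k j l F + colSum z x k j l G := by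
  simp [colSum, smul_add, sum_add_distrib]

lemma fusedRow_add (z x : K) (o i c : Idx m n) (F G : Idx m n → Idx m n → Idx m n → M) :
    fusedRow z x o i c (fun a b d => F a b d + G a b d) =
      fusedRow z x o i c F + fusedRow z x o i c G := by
  simp only [fusedRow, rowSum_add, smul_add]
  abel

lemma fusedRow_map {N : Type*} [AddCommGroup N] [Module K N] (f : M →ₗ[K] N) (z x : K)
    (o i c : Idx m n) (F : Idx m n → Idx m n → Idx m n → M) :
    f (fusedRow z x o i c F) = fusedRow z x o i c fun a b d => f (F a b d) := by
  simp only [fusedRow, map_add, map_smul, rowSum_map]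

lemma fusedCol_add (z x : K) (o j l : Idx m n) (F G : Idx m n → Idx m n → Idx m n → M) :
    fusedCol z x o j l (fun a b d => F a b d + G a b d) =
      fusedCol z x o j l F + fusedCol z x o j l G := by
  simp only [fusedCol, colSum_add, smul_add]

lemma fusedCol_map {N : Type*} [AddCommGroup N] [Module K N] (f : M →ₗ[K] N) (z x : K)
    (o j l : Idx m n) (F : Idx m n → Idx m n → Idx m n → M) :
    f (fusedCol z x o j l F) = fusedCol z x o j l fun a b d => f (F a b d) := by
  simp only [fusedCol, map_smul, colSum_map]

end linear

variable {S : Type*} [Ring S] [Algebra K S]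

/-- The entries of the fusion of two matrices, in the rows spanned by
`⟨o, i| + η (-1)^{[o][i]} ⟨i, o|`. -/
noncomputable def fuse (o : Idx m n) (X' X : Idx m n → Idx m n → S) (i a b : Idx m n) : S :=
  (pairSign o i * pairSign a i) • (X' o a * X i b) +
    (fuseCoeff o * pairSign o a) • (X' i a * X o b)

section single
variable {z : K} {o i : Idx m n} {X' X : Idx m n → Idx m n → S}

/-- At `x = q^{2(ε_o, ε_o)}` the row `(o, i)` of the R-matrix is a multiple of the fused covector;
this determines `η`. -/
lemma swapCoeff_at_fusion (ho : o.val < m + n) (hi : i ∈ inner m n (o.val + 1)) :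
    swapCoeff z (qEps o ^ 2) o i =
      diagCoeff z (qEps o ^ 2) o i * (fuseCoeff o * pairSign o i) := by
  have ht := qEps_ne_zero o
  simp only [diagCoeff, swapCoeff, fuseCoeff, q_sub_inv ho, diagB_self_left hi,
    if_neg (lt_of_mem_inner hi).not_gt]
  field_simp
  ring

lemma diagCoeff_at_fusion (ho : o.val < m + n) (hi : i ∈ inner m n (o.val + 1)) :
    diagCoeff z (qEps o ^ 2) i o =
      fuseCoeff o * pairSign o i * swapCoeff z (qEps o ^ 2) i o := by
  have ht := qEps_ne_zero o
  simp only [diagCoeff, swapCoeff, fuseCoeff, q_sub_inv ho, diagB_self_right hi,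
    if_pos (lt_of_mem_inner hi), pairSign_comm i o]
  rcases pairSign_eq_or o o with h1 | h1 <;> rcases pairSign_eq_or o i with h2 | h2 <;>
    simp only [h1, h2] <;> field_simp <;> ring

/-- The left side is a row of the R-matrix applied to the product of `X'` and `X`. The RTT relation
rewrites it by columns of the same degenerate R-matrix, so the fused entries inherit the linear
relations among these columns. -/
lemma diagCoeff_smul_fuse (ho : o.val < m + n) (hp : IsRTT z (qEps o ^ 2) o.val X' X)
    (hi : i ∈ inner m n (o.val + 1)) {j l : Idx m n} (hj : j ∈ inner m n o.val)
    (hl : l ∈ inner m n o.val) :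
    diagCoeff z (qEps o ^ 2) o i • fuse o X' X i j l =
      colSum z (qEps o ^ 2) o.val j l
        (fun a b => (pairSign o b * pairSign a b) • (X i b * X' o a)) := by
  rw [← hp o (self_mem_inner ho.le) i (inner_succ_subset _ hi) j hj l hl,
    rowSum_eq _ _ _ (self_mem_inner ho.le) (inner_succ_subset _ hi),
    if_neg (lt_rev_of_mem_inner hi).ne, add_zero, swapCoeff_at_fusion ho hi, fuse,
    mul_smul (diagCoeff _ _ _ _), ← smul_add, smul_smul (fuseCoeff o * _), pairSign_comm i o,
    pairSign_comm j o]
  congr 3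
  linear_combination (-(fuseCoeff o * pairSign o j)) * pairSign_mul_self o i

variable (ho : o.val < m + n) (hp : IsRTT z (qEps o ^ 2) o.val X' X)
  (hz : (1 - qEps o ^ 2) * (qEps o ^ 2 - z) ≠ 0) (hi : i ∈ inner m n (o.val + 1))
include ho hp hz hi

/-- The column `(o, o)` of the R-matrix vanishes at the fusion point. -/
lemma fuse_self : fuse o X' X i o o = 0 := by
  have hoI := self_mem_inner ho.le
  have h := diagCoeff_smul_fuse ho hp hi hoI hoI
  rw [colSum_eq _ _ _ hoI hoI, if_neg (rev_ne_self ho).symm, ← add_smul,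
    diagCoeff_add_swapCoeff z _ ho] at h
  have h0 : qEps o - qEps o ^ 2 * (qEps o)⁻¹ = 0 := by
    have ht := qEps_ne_zero o
    field_simp
    ring
  rw [h0, mul_zero, zero_smul, add_zero, diagCoeff, diagB_self_left hi, mul_one] at h
  exact (smul_eq_zero.1 h).resolve_left hz

/-- At the fusion point the columns `(a, o)` and `(o, a)` are proportional. -/
lemma fuse_swap {a : Idx m n} (ha : a ∈ inner m n (o.val + 1)) :
    fuse o X' X i a o = (fuseCoeff o * pairSign o a) • fuse o X' X i o a := by
  have hs := inner_succ_subset (m := m) (n := n) o.val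
  have hoI := self_mem_inner ho.le
  have h1 := diagCoeff_smul_fuse ho hp hi (hs ha) hoI
  have h2 := diagCoeff_smul_fuse ho hp hi hoI (hs ha)
  have h3 : o ≠ a.rev := fun h => (lt_rev_of_mem_inner ha).ne (by rw [h, Fin.rev_rev])
  rw [colSum_eq _ _ _ (hs ha) hoI, if_neg h3, add_zero, swapCoeff_at_fusion ho ha,
    diagCoeff_at_fusion ho ha] at h1
  rw [colSum_eq _ _ _ hoI (hs ha), if_neg (lt_rev_of_mem_inner ha).ne, add_zero] at h2
  have h4 : diagCoeff z (qEps o ^ 2) o i ≠ 0 := by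
    rwa [diagCoeff, diagB_self_left hi, mul_one]
  refine smul_right_injective _ h4 ?_
  simp only
  rw [h1, smul_comm (diagCoeff z (qEps o ^ 2) o i), h2, smul_add, smul_smul _ (diagCoeff _ _ _ _),
    smul_smul _ (swapCoeff _ _ _ _), add_comm, mul_comm (diagCoeff _ _ _ _)]

end single

/-- The Schur complement of the entry `(o, o)`. -/
noncomputable def schur (T : Idx m n → Idx m n → S) (o : Idx m n) :
    Idx m n → Idx m n → S :=
  fun a b => T a b - T a o * Ring.inverse (T o o) * T o b

omit [Algebra K S] in
lemma schur_apply (T : Idx m n → Idx m n → S) (o a b : Idx m n) :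
    schur T o a b = T a b - T a o * Ring.inverse (T o o) * T o b := rfl

section step
variable {z x : K} {o : Idx m n} {X' X Y : Idx m n → Idx m n → S}

/-- The vanishing of the entry `(o, o)` expresses `X' i o` through `X' o o`, `X i o` and `X o o`.
Substituting it, the two terms of the fusion combine into a Schur complement. -/
lemma fuse_eq_mul_schur {i j : Idx m n} (h0 : fuse o X' X i o o = 0) (hu : IsUnit (X o o)) :
    fuse o X' X i o j = X' o o * schur X o i j := by
  have h1 : X' o o * X i o = -((fuseCoeff o * pairSign o o) • (X' i o * X o o)) := by
    rw [fuse, pairSign_mul_self, one_smul] at h0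
    exact eq_neg_of_add_eq_zero_left h0
  rw [fuse, pairSign_mul_self, one_smul, schur_apply, mul_sub, ← mul_assoc, ← mul_assoc, h1,
    neg_mul, neg_mul, sub_neg_eq_add, smul_mul_assoc, smul_mul_assoc,
    Ring.mul_inverse_cancel_right _ _ hu]

variable (ho : o.val < m + n) (h13 : IsRTT z (qEps o ^ 2 * x) o.val X' Y)
  (h23 : IsRTT z x o.val X Y)
include ho h13 h23

/-- The three matrix relation for the rows `(o, i)` and `(i, o)`, added with the weight `η
(-1)^{[o][i]}`. -/
lemma fusedRow_eq_fusedCol {i c j l : Idx m n} (hi : i ∈ inner m n o.val)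
    (hc : c ∈ inner m n o.val) (hj : j ∈ inner m n o.val) (hl : l ∈ inner m n o.val) :
    fusedRow z x o i c (fun a b d => (pairSign a b * pairSign o b *
        (pairSign a d * pairSign o d) * (pairSign b d * pairSign j d)) •
          (X' a o * X b j * Y d l)) =
      fusedCol z x o j l (fun a' a b' => (pairSign i b' * pairSign o b' *
        (pairSign a' b' * pairSign a b')) • (Y c b' * fuse o X' X i a' a)) := by
  have hoI := self_mem_inner ho.le
  rw [fusedRow, three_slot h13 h23 hoI hi hc hoI hj hl, three_slot h13 h23 hi hoI hc hoI hj hl,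
    fusedCol, colSum_smul, ← colSum_add]
  refine colSum_congr _ _ _ _ _ fun a _ b _ => ?_
  rw [colSum_smul, ← colSum_add]
  refine colSum_congr _ _ _ _ _ fun a' _ b' _ => ?_
  rw [fuse, mul_add, mul_smul_comm, mul_smul_comm]
  simp only [smul_smul, smul_add]
  congr 1
  · congr 1
    · ring
    · exact mul_assoc _ _ _
  · congr 1
    · rw [pairSign_comm i o, pairSign_comm a' o]
      linear_combination (fuseCoeff o * pairSign a o * pairSign a a' * pairSign o a' *
        pairSign i b' * pairSign a' b' * pairSign o b' * pairSign a b') * pairSign_mul_self o i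
    · exact mul_assoc _ _ _

end step

section elimination
variable {z x : K} {o : Idx m n} {X' X Y : Idx m n → Idx m n → S}

/-- The part of the fused rows that ends in `o` in the last space. -/
noncomputable def rowRest (z x : K) (o : Idx m n) (X' X : Idx m n → Idx m n → S)
    (i c j : Idx m n) : S :=
  fusedRow z x o i c fun a b d => if d = o then (pairSign a b * pairSign o b *
    (pairSign a d * pairSign o d) * (pairSign b d * pairSign j d)) • (X' a o * X b j) else 0

/-- The part of the fused columns that ends in `o` in the last space. -/
noncomputable def colRest (z x : K) (o : Idx m n) (X' X : Idx m n → Idx m n → S)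
    (i j l : Idx m n) : S :=
  fusedCol z x o j l fun a' a b' => if b' = o then (pairSign i b' * pairSign o b' *
    (pairSign a' b' * pairSign a b')) • fuse o X' X i a' a else 0

lemma fuse_row_sign (a d j l : Idx m n) :
    (pairSign o a * pairSign o a * (pairSign o d * pairSign o d) *
        (pairSign a d * pairSign j d)) • (X' o o * X a j * Y d l) +
      (fuseCoeff o * pairSign o a) • (pairSign a o * pairSign o o *
        (pairSign a d * pairSign o d) * (pairSign o d * pairSign j d)) •
          (X' a o * X o j * Y d l) =
      (pairSign a d * pairSign j d) • (fuse o X' X a o j * Y d l) := by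
  rw [fuse, add_mul, smul_mul_assoc, smul_mul_assoc, smul_add, smul_smul, smul_smul, smul_smul,
    pairSign_comm a o]
  congr 2
  · linear_combination (pairSign o a * pairSign o a * pairSign a d * pairSign j d) *
      pairSign_mul_self o d
  · linear_combination (fuseCoeff o * pairSign o o * pairSign a d * pairSign j d) *
      ((pairSign o a * pairSign o a) * pairSign_mul_self o d + pairSign_mul_self o a)

/-- Terms ending in `o` in the last space are right multiples of `Y o l`. What remains satisfies the
vanishing condition of `fusedRow_eq`. -/
lemma fusedRow_split (ho : o.val < m + n) {i c : Idx m n} (hi : i ∈ inner m n (o.val + 1))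
    (hc : c ∈ inner m n (o.val + 1)) (j l : Idx m n) :
    fusedRow z x o i c (fun a b d => (pairSign a b * pairSign o b *
        (pairSign a d * pairSign o d) * (pairSign b d * pairSign j d)) •
          (X' a o * X b j * Y d l)) =
      fuseFactor z x o • rowSum ((qEps o ^ 2)⁻¹ * z) x (o.val + 1) i c
        (fun a b => (pairSign a b * pairSign j b) • (fuse o X' X a o j * Y b l)) +
      rowRest z x o X' X i c j * Y o l := by
  have hR := fusedRow_map (LinearMap.mulRight K (Y o l)) z x o i c
    (fun a b d => if d = o then (pairSign a b * pairSign o b *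
    (pairSign a d * pairSign o d) * (pairSign b d * pairSign j d)) • (X' a o * X b j) else 0)
  rw [LinearMap.mulRight_apply] at hR
  have hF := fusedRow_eq z x ho hi hc (fun a b d => if d = o then 0 else
    (pairSign a b * pairSign o b * (pairSign a d * pairSign o d) *
      (pairSign b d * pairSign j d)) • (X' a o * X b j * Y d l)) (by simp)
  rw [rowRest, hR]
  rw [rowSum_congr (G := fun a b => (pairSign a b * pairSign j b) •
    (fuse o X' X a o j * Y b l))] at hF
  · rw [← hF, ← fusedRow_add]
    congr 1
    ext a b d
    by_cases h : d = o
    · simp [h]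
    · simp [h]
  · intro a _ b hb
    rw [if_neg (lt_of_mem_inner hb).ne', if_neg (lt_of_mem_inner hb).ne', fuse_row_sign]

lemma fusedRow_top_sign (ho : o.val < m + n) {i : Idx m n} (hi : i ∈ inner m n (o.val + 1))
    (j l : Idx m n) :
    fusedRow z x o i o (fun a b d => (pairSign a b * pairSign o b *
        (pairSign a d * pairSign o d) * (pairSign b d * pairSign j d)) •
          (X' a o * X b j * Y d l)) =
      (fuseTop z x o * (pairSign i o * pairSign j o)) • (fuse o X' X i o j * Y o l) := by
  rw [fusedRow_top _ _ ho hi, fuse_row_sign, smul_smul]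

lemma fusedCol_split (ho : o.val < m + n) {i j l : Idx m n} (hj : j ∈ inner m n (o.val + 1))
    (hl : l ∈ inner m n (o.val + 1)) (h0 : fuse o X' X i o o = 0)
    (h1 : ∀ a ∈ inner m n (o.val + 1),
      fuse o X' X i a o = (fuseCoeff o * pairSign o a) • fuse o X' X i o a) (c : Idx m n) :
    fusedCol z x o j l (fun a' a b' => (pairSign i b' * pairSign o b' *
        (pairSign a' b' * pairSign a b')) • (Y c b' * fuse o X' X i a' a)) =
      fuseFactor z x o • colSum ((qEps o ^ 2)⁻¹ * z) x (o.val + 1) j l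
        (fun a b => (pairSign i b * pairSign a b) • (Y c b * fuse o X' X i o a)) +
      Y c o * colRest z x o X' X i j l := by
  have hR := fusedCol_map (LinearMap.mulLeft K (Y c o)) z x o j l
    (fun a' a b' => if b' = o then (pairSign i b' * pairSign o b' *
    (pairSign a' b' * pairSign a b')) • fuse o X' X i a' a else 0)
  rw [LinearMap.mulLeft_apply] at hR
  have hF := fusedCol_eq z x ho hj hl (fun a' a b' => if b' = o then 0 else
    (pairSign i b' * pairSign o b' *
        (pairSign a' b' * pairSign a b')) • (Y c b' * fuse o X' X i a' a)) (by simp)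
    (by simp [h0]) (by
      intro a ha b
      rw [h1 a ha]
      split_ifs
      · simp
      · rw [mul_smul_comm, smul_smul, smul_smul]
        congr 1; ring)
  rw [colRest, hR]
  rw [colSum_congr (G := fun a b => (pairSign i b * pairSign a b) •
    (Y c b * fuse o X' X i o a))] at hF
  · rw [← hF, ← fusedCol_add]
    congr 1
    ext a b d
    by_cases h : d = o
    · simp [h]
    · simp [h]
  · intro a _ b hb
    rw [if_neg (lt_of_mem_inner hb).ne']
    congr 1
    linear_combination (pairSign i b * pairSign a b) * pairSign_mul_self o b

lemma fusedCol_top_sign (ho : o.val < m + n) {i j : Idx m n} (hj : j ∈ inner m n (o.val + 1))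
    (h0 : fuse o X' X i o o = 0)
    (h1 : ∀ a ∈ inner m n (o.val + 1),
      fuse o X' X i a o = (fuseCoeff o * pairSign o a) • fuse o X' X i o a) (c : Idx m n) :
    fusedCol z x o j o (fun a' a b' => (pairSign i b' * pairSign o b' *
        (pairSign a' b' * pairSign a b')) • (Y c b' * fuse o X' X i a' a)) =
      (fuseTop z x o * (pairSign i o * pairSign j o)) • (Y c o * fuse o X' X i o j) := by
  rw [fusedCol_top _ _ ho hj, smul_smul]
  · congr 1
    linear_combination (fuseTop z x o * pairSign i o * pairSign j o) * pairSign_mul_self o o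
  · simp [h0]
  · intro a ha b
    rw [h1 a ha, mul_smul_comm, smul_smul, smul_smul]
    congr 1; ring

/-- Block elimination over a noncommutative ring. The four equations are the fused relation with the
outer indices of `Y` equal to `o` or not, and `y` is the inverse of `Y o o`. The unknown remainders
`Ω` and `Ω'` cancel because `hD` makes `M` commute with `Y o o`, up to the scalar `s`. -/
lemma eliminate {A : Type*} [Ring A] [Algebra K A] {s : K} {R₀ R C C₀ Ω Ω' yo yk yl M y : A}
    (hA : R₀ + Ω * yo = s • (yk * M)) (hB : R + Ω * yl = C + yk * Ω')
    (hC : s • (M * yl) = C₀ + yo * Ω') (hD : s • (M * yo) = s • (yo * M))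
    (h1 : yo * y = 1) (h2 : y * yo = 1) :
    R - R₀ * y * yl = C - yk * y * C₀ := by
  have hM : s • (y * M) = s • (M * y) := by
    calc s • (y * M) = y * (s • (M * yo)) * y := by
          rw [mul_smul_comm, smul_mul_assoc, mul_assoc, mul_assoc, h1, mul_one]
      _ = s • (M * y) := by
          rw [hD, mul_smul_comm, smul_mul_assoc, ← mul_assoc, h2, one_mul]
  have e1 : R₀ * y * yl = s • (yk * M * y * yl) - Ω * yl := by
    rw [eq_sub_of_add_eq hA, sub_mul, sub_mul, mul_assoc Ω, h1, mul_one, smul_mul_assoc,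
      smul_mul_assoc]
  have e2 : yk * y * C₀ = s • (yk * M * y * yl) - yk * Ω' := by
    rw [← sub_eq_of_eq_add hC, mul_sub, ← mul_assoc, mul_assoc yk y yo, h2, mul_one]
    congr 1
    calc yk * y * s • (M * yl) = yk * (s • (y * M)) * yl := by
          simp only [mul_smul_comm, smul_mul_assoc, mul_assoc]
      _ = s • (yk * M * y * yl) := by
          rw [hM]; simp only [mul_smul_comm, smul_mul_assoc, mul_assoc]
  rw [e1, e2, eq_sub_of_add_eq hB]
  abel

variable (ho : o.val < m + n) (hp : IsRTT z (qEps o ^ 2) o.val X' X)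
  (h13 : IsRTT z (qEps o ^ 2 * x) o.val X' Y) (h23 : IsRTT z x o.val X Y)
  (hz : (1 - qEps o ^ 2) * (qEps o ^ 2 - z) ≠ 0)
include ho hp h13 h23 hz

/-- The fused relation with `o` at both ends of the last space: both sides carry the same scalar and
sign, which cancel. -/
theorem fuse_commute (hs : fuseTop z x o ≠ 0) {i j : Idx m n} (hi : i ∈ inner m n (o.val + 1))
    (hj : j ∈ inner m n (o.val + 1)) : Commute (fuse o X' X i o j) (Y o o) := by
  have hoI := self_mem_inner ho.le
  have hsub := inner_succ_subset (m := m) (n := n) o.val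
  have h := fusedRow_eq_fusedCol ho h13 h23 (hsub hi) hoI (hsub hj) hoI
  rw [fusedRow_top_sign ho hi, fusedCol_top_sign ho hj (fuse_self ho hp hz hi)
    fun a ha => fuse_swap ho hp hz hi ha] at h
  refine smul_right_injective S ?_ h
  refine mul_ne_zero hs (mul_ne_zero ?_ ?_)
  · exact left_ne_zero_of_mul_eq_one (pairSign_mul_self i o)
  · exact left_ne_zero_of_mul_eq_one (pairSign_mul_self j o)

/-- The `RTT` relation of lower rank for a fused matrix and a Schur complement. -/
theorem fuse_isRTT (hr : fuseFactor z x o ≠ 0) (hu : IsUnit (Y o o)) :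
    IsRTT ((qEps o ^ 2)⁻¹ * z) x (o.val + 1) (fun i j => fuse o X' X i o j) (schur Y o) := by
  intro i hi c hc j hj l hl
  have hoI := self_mem_inner ho.le
  have hsub := inner_succ_subset (m := m) (n := n) o.val
  have hf0 : ∀ {i}, i ∈ inner m n (o.val + 1) → fuse o X' X i o o = 0 := fuse_self ho hp hz
  have hf1 : ∀ {i}, i ∈ inner m n (o.val + 1) → ∀ a ∈ inner m n (o.val + 1),
      fuse o X' X i a o = (fuseCoeff o * pairSign o a) • fuse o X' X i o a :=
    fun hi a ha => fuse_swap ho hp hz hi ha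
  have hA := fusedRow_eq_fusedCol ho h13 h23 (hsub hi) (hsub hc) (hsub hj) hoI
  have hB := fusedRow_eq_fusedCol ho h13 h23 (hsub hi) (hsub hc) (hsub hj) (hsub hl)
  have hC := fusedRow_eq_fusedCol ho h13 h23 (hsub hi) hoI (hsub hj) (hsub hl)
  have hD := fusedRow_eq_fusedCol ho h13 h23 (hsub hi) hoI (hsub hj) hoI
  rw [fusedRow_split ho hi hc, fusedCol_top_sign ho hj (hf0 hi) (hf1 hi)] at hA
  rw [fusedRow_split ho hi hc, fusedCol_split ho hj hl (hf0 hi) (hf1 hi)] at hB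
  rw [fusedRow_top_sign ho hi, fusedCol_split ho hj hl (hf0 hi) (hf1 hi)] at hC
  rw [fusedRow_top_sign ho hi, fusedCol_top_sign ho hj (hf0 hi) (hf1 hi)] at hD
  have key := eliminate hA hB hC hD (Ring.mul_inverse_cancel _ hu)
    (Ring.inverse_mul_cancel _ hu)
  refine smul_right_injective S hr ?_
  simp only
  convert key using 1
  · rw [smul_mul_assoc, smul_mul_assoc, ← smul_sub]
    congr 1
    have h1 := rowSum_map (LinearMap.mulRight K (Ring.inverse (Y o o) * Y o l))
      ((qEps o ^ 2)⁻¹ * z) x (o.val + 1) i c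
      (fun a b => (pairSign a b * pairSign j b) • (fuse o X' X a o j * Y b o))
    rw [LinearMap.mulRight_apply, ← mul_assoc] at h1
    rw [h1, eq_sub_iff_add_eq, ← rowSum_add]
    refine rowSum_congr _ _ _ _ _ fun a _ b _ => ?_
    rw [LinearMap.mulRight_apply, smul_mul_assoc, ← smul_add, schur_apply]
    congr 1
    noncomm_ring
  · rw [mul_smul_comm, ← smul_sub]
    congr 1
    have h1 := colSum_map (LinearMap.mulLeft K (Y c o * Ring.inverse (Y o o)))
      ((qEps o ^ 2)⁻¹ * z) x (o.val + 1) j l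
      (fun a b => (pairSign i b * pairSign a b) • (Y o b * fuse o X' X i o a))
    rw [LinearMap.mulLeft_apply] at h1
    rw [h1, eq_sub_iff_add_eq, ← colSum_add]
    refine colSum_congr _ _ _ _ _ fun a _ b _ => ?_
    rw [LinearMap.mulLeft_apply, mul_smul_comm, ← smul_add, schur_apply]
    congr 1
    noncomm_ring

end elimination
end Fuse
end OspRTT

namespace OspRTT

open Finset Polynomial

/-! ### Extension of identities from generic to all nonzero arguments; the substitution `z ↦ a z`.
-/

section Density

/-- Polynomial functions. -/
def IsPolyFun (c : K → K) : Prop := ∃ P : K[X], ∀ x, c x = P.eval x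

namespace IsPolyFun

lemma const (a : K) : IsPolyFun fun _ => a := ⟨C a, by simp⟩

lemma id : IsPolyFun fun x => x := ⟨X, by simp⟩

variable {c d : K → K}

lemma add (hc : IsPolyFun c) (hd : IsPolyFun d) : IsPolyFun fun x => c x + d x := by
  obtain ⟨P, hP⟩ := hc
  obtain ⟨Q, hQ⟩ := hd
  exact ⟨P + Q, by simp [hP, hQ]⟩

lemma mul (hc : IsPolyFun c) (hd : IsPolyFun d) : IsPolyFun fun x => c x * d x := by
  obtain ⟨P, hP⟩ := hc
  obtain ⟨Q, hQ⟩ := hd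
  exact ⟨P * Q, by simp [hP, hQ]⟩

lemma sub (hc : IsPolyFun c) (hd : IsPolyFun d) : IsPolyFun fun x => c x - d x := by
  obtain ⟨P, hP⟩ := hc
  obtain ⟨Q, hQ⟩ := hd
  exact ⟨P - Q, by simp [hP, hQ]⟩

lemma ite {p : Prop} [Decidable p] (hc : IsPolyFun c) (hd : IsPolyFun d) :
    IsPolyFun fun x => if p then c x else d x := by
  split_ifs <;> assumption

end IsPolyFun

/-- Laurent polynomial functions on the nonzero scalars. -/
def IsLaurentFun (g : K → K) : Prop :=
  ∃ (N : ℕ) (P : K[X]), ∀ x, x ≠ 0 → x ^ N * g x = P.eval x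

namespace IsLaurentFun
variable {g h : K → K}

lemma add (hg : IsLaurentFun g) (hh : IsLaurentFun h) : IsLaurentFun fun x => g x + h x := by
  obtain ⟨N, P, hP⟩ := hg
  obtain ⟨M, Q, hQ⟩ := hh
  refine ⟨N + M, X ^ M * P + X ^ N * Q, fun x hx => ?_⟩
  simp only [eval_add, eval_mul, eval_pow, eval_X, ← hP x hx, ← hQ x hx]
  ring

lemma zero : IsLaurentFun fun _ => 0 := ⟨0, 0, by simp⟩

lemma sum {ι : Type*} (s : Finset ι) {g : ι → K → K} (hg : ∀ i ∈ s, IsLaurentFun (g i)) :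
    IsLaurentFun fun x => ∑ i ∈ s, g i x := by
  classical
  induction s using Finset.induction_on with
  | empty => simpa using zero
  | insert a s ha ih =>
    simp only [sum_insert ha]
    exact (hg a (mem_insert_self _ _)).add (ih fun i hi => hg i (mem_insert_of_mem hi))

lemma polyFun_mul {c : K → K} (hc : IsPolyFun c) (hg : IsLaurentFun g) :
    IsLaurentFun fun x => c x * g x := by
  obtain ⟨N, P, hP⟩ := hg
  obtain ⟨Q, hQ⟩ := hc
  refine ⟨N, Q * P, fun x hx => ?_⟩
  simp only [eval_mul, ← hP x hx, ← hQ x]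
  ring

lemma zpow_mul (e : ℤ) (a : K) : IsLaurentFun fun x => x ^ e * a := by
  -- For the sign `-1` the exponent is negative; multiplying by `x ^ |e|` clears it.
  refine ⟨e.natAbs, X ^ (e.natAbs + e).toNat * C a, fun x hx => ?_⟩
  rw [eval_mul, eval_pow, eval_X, eval_C, ← mul_assoc, ← zpow_natCast, ← zpow_natCast,
    ← zpow_add₀ hx, Int.toNat_of_nonneg (by omega)]

/-- After clearing negative powers, the product of two polynomials vanishes on the infinite field.
The condition at `0` only ensures that `c` is not the zero polynomial. -/
lemma eq_zero_of_mul {c : K → K} (hg : IsLaurentFun g) (hc : IsPolyFun c) (hc0 : c 0 ≠ 0)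
    (h : ∀ x, x ≠ 0 → c x ≠ 0 → g x = 0) {x : K} (hx : x ≠ 0) : g x = 0 := by
  obtain ⟨N, P, hP⟩ := hg
  obtain ⟨Q, hQ⟩ := hc
  -- The factor `X` takes care of the point `0`, where nothing is assumed.
  have h1 : X * Q * P = 0 := by
    refine Polynomial.funext fun y => ?_
    simp only [eval_mul, eval_X, ← hQ, eval_zero]
    by_cases hy : y = 0
    · simp [hy]
    by_cases hcy : c y = 0
    · simp [hcy]
    · rw [← hP y hy, h y hy hcy]; simp
  have hQ0 : Q ≠ 0 := by
    rintro rfl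
    exact hc0 (by simp [hQ])
  have hP0 : P = 0 := (mul_eq_zero.1 h1).resolve_left (mul_ne_zero X_ne_zero hQ0)
  have := hP x hx
  rw [hP0, eval_zero] at this
  exact (mul_eq_zero.1 this).resolve_left (pow_ne_zero _ hx)

end IsLaurentFun

variable {A : Type} [Ring A] [Algebra K A]

/-- Families of power series all of whose coefficients are Laurent polynomials. -/
def IsLaurentFamily (F : K → PowerSeries A) : Prop :=
  ∀ (d : ℕ) (φ : Module.Dual K A), IsLaurentFun fun x => φ (PowerSeries.coeff d (F x))

lemma coeff_smul' (c : K) (F : PowerSeries A) (d : ℕ) :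
    PowerSeries.coeff d (c • F) = c • PowerSeries.coeff d F := rfl

namespace IsLaurentFamily
variable {F G : K → PowerSeries A}

lemma add (hF : IsLaurentFamily F) (hG : IsLaurentFamily G) :
    IsLaurentFamily fun x => F x + G x := fun d φ => by
  simpa using (hF d φ).add (hG d φ)

lemma smul {c : K → K} (hc : IsPolyFun c) (hF : IsLaurentFamily F) :
    IsLaurentFamily fun x => c x • F x := fun d φ => by
  simpa [coeff_smul'] using (hF d φ).polyFun_mul hc

lemma sub (hF : IsLaurentFamily F) (hG : IsLaurentFamily G) :
    IsLaurentFamily fun x => F x - G x := by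
  simpa [sub_eq_add_neg] using hF.add (hG.smul (IsPolyFun.const (-1)))

lemma sum {ι : Type*} (s : Finset ι) {F : ι → K → PowerSeries A}
    (hF : ∀ i ∈ s, IsLaurentFamily (F i)) : IsLaurentFamily fun x => ∑ i ∈ s, F i x :=
  fun d φ => by
    simpa using IsLaurentFun.sum s fun i hi => hF i hi d φ

lemma shift_mul (s : ℤˣ) (T U : PowerSeries A) : IsLaurentFamily fun x => shift s x T * U :=
  fun d φ => by
    simp only [PowerSeries.coeff_mul, shift, PowerSeries.coeff_mk, map_sum, smul_mul_assoc,
      map_smul, smul_eq_mul]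
    exact IsLaurentFun.sum _ fun i _ => IsLaurentFun.zpow_mul _ _

lemma mul_shift (s : ℤˣ) (T U : PowerSeries A) : IsLaurentFamily fun x => U * shift s x T :=
  fun d φ => by
    simp only [PowerSeries.coeff_mul, shift, PowerSeries.coeff_mk, map_sum, mul_smul_comm,
      map_smul, smul_eq_mul]
    exact IsLaurentFun.sum _ fun i _ => IsLaurentFun.zpow_mul _ _

lemma eq_zero_of_polyFun {c : K → K} (hF : IsLaurentFamily F) (hc : IsPolyFun c) (hc0 : c 0 ≠ 0)
    (h : ∀ x, x ≠ 0 → c x ≠ 0 → F x = 0) {x : K} (hx : x ≠ 0) : F x = 0 := by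
  ext d
  rw [map_zero]
  refine (Module.forall_dual_apply_eq_zero_iff K _).1 fun φ => ?_
  exact (hF d φ).eq_zero_of_mul hc hc0 (fun y hy hcy => by rw [h y hy hcy]; simp) hx

lemma eq_of_polyFun {c : K → K} (hF : IsLaurentFamily F) (hG : IsLaurentFamily G)
    (hc : IsPolyFun c) (hc0 : c 0 ≠ 0)
    (h : ∀ x, x ≠ 0 → c x ≠ 0 → F x = G x) {x : K} (hx : x ≠ 0) : F x = G x :=
  sub_eq_zero.1 <| (hF.sub hG).eq_zero_of_polyFun hc hc0
    (fun y hy hcy => sub_eq_zero.2 (h y hy hcy)) hx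

end IsLaurentFamily

/-! ### The substitution `z ↦ a z` as an algebra homomorphism -/

/-- The substitution `z ↦ a z`. -/
noncomputable def shiftHom (s : ℤˣ) (a : K) : PowerSeries A →ₐ[K] PowerSeries A where
  toFun := shift s a
  map_zero' := by ext; simp [shift]
  map_add' x y := by ext; simp [shift]
  map_one' := by
    ext p
    simp only [shift, PowerSeries.coeff_mk, PowerSeries.coeff_one]
    split_ifs with h <;> simp [h]
  map_mul' x y := by
    ext d
    simp only [shift, PowerSeries.coeff_mk, PowerSeries.coeff_mul, smul_sum]
    refine sum_congr rfl fun p hp => ?_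
    rw [smul_mul_smul_comm, ← mem_antidiagonal.1 hp]
    congr 1
    push_cast
    rcases Int.units_eq_one_or s with rfl | rfl
    · simp only [Units.val_one, one_mul]
      exact_mod_cast pow_add a _ _
    · simp only [Units.val_neg, Units.val_one, neg_mul, one_mul, zpow_neg, ← mul_inv]
      congr 1
      exact_mod_cast pow_add a _ _
  commutes' r := by
    ext p
    simp only [shift, PowerSeries.coeff_mk, PowerSeries.algebraMap_apply, PowerSeries.coeff_C]
    split_ifs with h <;> simp [h]

@[simp] lemma shiftHom_apply (s : ℤˣ) (a : K) (x : PowerSeries A) :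
    shiftHom s a x = shift s a x := rfl

lemma shift_shift (s : ℤˣ) (a b : K) (x : PowerSeries A) :
    shift s a (shift s b x) = shift s (a * b) x := by
  ext p
  simp only [shift, PowerSeries.coeff_mk, smul_smul, mul_zpow]

@[simp] lemma shift_one (s : ℤˣ) (x : PowerSeries A) : shift s 1 x = x := by
  ext p; simp [shift]

lemma shift_mul (s : ℤˣ) (a : K) (x y : PowerSeries A) :
    shift s a (x * y) = shift s a x * shift s a y := map_mul (shiftHom s a) x y

lemma isUnit_shift (s : ℤˣ) (a : K) {x : PowerSeries A} (hx : IsUnit x) :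
    IsUnit (shift s a x) := hx.map (shiftHom s a)

lemma shift_inverse (s : ℤˣ) (a : K) {x : PowerSeries A} (hx : IsUnit x) :
    shift s a (Ring.inverse x) = Ring.inverse (shift s a x) := by
  obtain ⟨u, rfl⟩ := hx
  rw [Ring.inverse_unit]
  exact (Ring.inverse_unit (Units.map (AlgHom.toRingHom (shiftHom s a)).toMonoidHom u)).symm

end Density
end OspRTT

namespace OspRTT

open Finset

/-! ### The RTT relation for all arguments passes to Schur complements. -/

section Family

variable {m n : ℕ}

lemma IsRTT.map {S S' : Type*} [Ring S] [Algebra K S] [Ring S'] [Algebra K S'] (f : S →ₐ[K] S')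
    {z x : K} {k : ℕ} {X Y : Idx m n → Idx m n → S} (h : IsRTT z x k X Y) :
    IsRTT z x k (fun i j => f (X i j)) (fun i j => f (Y i j)) := by
  intro i hi c hc j hj l hl
  have := congrArg f.toLinearMap (h i hi c hc j hj l hl)
  rw [rowSum_map, colSum_map] at this
  simpa only [map_smul, AlgHom.toLinearMap_apply, map_mul] using this

lemma isPolyFun_rEntry (z : K) (i k j l : Idx m n) : IsPolyFun fun x => rEntry z x i k j l := by
  unfold rEntry diagCoeff swapCoeff contrCoeff
  have h0 := IsPolyFun.const 0
  have h1 := IsPolyFun.const 1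
  have hz := IsPolyFun.const z
  have hx := IsPolyFun.id
  refine ((IsPolyFun.ite ?_ h0).add (IsPolyFun.ite ?_ h0)).add (IsPolyFun.ite ?_ h0)
  · exact ((h1.sub hx).mul (hx.sub hz)).mul (IsPolyFun.const _)
  · exact ((IsPolyFun.const _).mul (hx.sub hz)).mul (IsPolyFun.ite h1 hx)
  · exact (((IsPolyFun.const _).mul (h1.sub hx)).mul (IsPolyFun.const _)).mul
      (IsPolyFun.ite hz hx)

variable {A : Type} [Ring A] [Algebra K A]

/-- The `RTT` relation on the indices `k, …, \bar k` for all arguments of the `R`-matrix. -/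
def IsRTTFamily (s : ℤˣ) (z : K) (k : ℕ) (T : Idx m n → Idx m n → PowerSeries A) : Prop :=
  ∀ x, x ≠ 0 → IsRTT z x k (fun i j => shift s x (T i j)) T

lemma isLaurentFamily_rowSum (s : ℤˣ) (z : K) (k : ℕ) (T : Idx m n → Idx m n → PowerSeries A)
    (i c j l : Idx m n) : IsLaurentFamily fun x => rowSum z x k i c
      (fun a b => (pairSign a b * pairSign j b) • (shift s x (T a j) * T b l)) :=
  IsLaurentFamily.sum _ fun a _ => IsLaurentFamily.sum _ fun b _ =>
    ((IsLaurentFamily.shift_mul s (T a j) (T b l)).smul (IsPolyFun.const _)).smul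
      (isPolyFun_rEntry z i c a b)

lemma isLaurentFamily_colSum (s : ℤˣ) (z : K) (k : ℕ) (T : Idx m n → Idx m n → PowerSeries A)
    (i c j l : Idx m n) : IsLaurentFamily fun x => colSum z x k j l
      (fun a b => (pairSign i b * pairSign a b) • (T c b * shift s x (T i a))) :=
  IsLaurentFamily.sum _ fun a _ => IsLaurentFamily.sum _ fun b _ =>
    ((IsLaurentFamily.mul_shift s (T i a) (T c b)).smul (IsPolyFun.const _)).smul
      (isPolyFun_rEntry z a b j l)

lemma isRTTFamily_of_polyFun {s : ℤˣ} {z : K} {k : ℕ} {T : Idx m n → Idx m n → PowerSeries A}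
    {c : K → K} (hc : IsPolyFun c) (hc0 : c 0 ≠ 0)
    (h : ∀ x, x ≠ 0 → c x ≠ 0 → IsRTT z x k (fun i j => shift s x (T i j)) T) :
    IsRTTFamily s z k T := fun _ hx i hi d hd j hj l hl =>
  (isLaurentFamily_rowSum s z k T i d j l).eq_of_polyFun
    (isLaurentFamily_colSum s z k T i d j l) hc hc0
    (fun y hy hcy => h y hy hcy i hi d hd j hj l hl) hx

variable {s : ℤˣ} {z : K} {o : Idx m n} {T : Idx m n → Idx m n → PowerSeries A}

/-- The entry `(o, o), (o, o)` of the relation. Since `o ≠ \bar o` there is no contraction, and both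
sides carry the same factor, the sum of the diagonal and the transposed coefficient. -/
theorem IsRTTFamily.commute_corner (hT : IsRTTFamily s z o.val T) (hz : z ≠ 0)
    (ho : o.val < m + n) {x : K} (hx : x ≠ 0) : Commute (shift s x (T o o)) (T o o) := by
  have hoI := self_mem_inner ho.le
  refine (IsLaurentFamily.shift_mul s (T o o) (T o o)).eq_of_polyFun
    (IsLaurentFamily.mul_shift s (T o o) (T o o))
    (c := fun y => (y - z) * (qEps o - y * (qEps o)⁻¹))
    (((IsPolyFun.id).sub (IsPolyFun.const _)).mul ((IsPolyFun.const _).sub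
      (IsPolyFun.id.mul (IsPolyFun.const _)))) (by simp [hz, qEps_ne_zero]) (fun y hy hcy => ?_) hx
  have h := hT y hy o hoI o hoI o hoI o hoI
  rw [rowSum_eq _ _ _ hoI hoI, colSum_eq _ _ _ hoI hoI, if_neg (rev_ne_self ho).symm,
    if_neg (rev_ne_self ho).symm, add_zero, add_zero, ← add_smul, ← add_smul,
    diagCoeff_add_swapCoeff _ _ ho, pairSign_mul_self, one_smul, one_smul] at h
  exact smul_right_injective _ hcy h

/-- When only the middle index is left, the R-matrix is a scalar polynomial in `x`. Its value at `0`
is `-z`, hence it is not zero. -/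
theorem IsRTTFamily.commute_middle (hT : IsRTTFamily s z o.val T) (hz : z ≠ 0)
    (ho : o.val = m + n) {x : K} (hx : x ≠ 0) : Commute (shift s x (T o o)) (T o o) := by
  have hoI := self_mem_inner ho.le
  have hrev : o.rev = o := by
    ext; rw [Fin.val_rev]; omega
  have hinner : inner m n o.val = {o} := by
    ext i
    have := i.isLt
    simp only [mem_inner, mem_singleton, Fin.ext_iff, Fin.val_rev]
    omega
  refine (IsLaurentFamily.shift_mul s (T o o) (T o o)).eq_of_polyFun
    (IsLaurentFamily.mul_shift s (T o o) (T o o))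
    (c := fun y => rEntry z y o o o o) (isPolyFun_rEntry _ _ _ _ _) ?_ (fun y hy hcy => ?_) hx
  · simp only [rEntry, diagCoeff, swapCoeff, contrCoeff, diagB_self, qEps, epsSq, hrev]
    simp [hz]
  · have h := hT y hy o hoI o hoI o hoI o hoI
    rw [rowSum, colSum, hinner, sum_singleton, sum_singleton, sum_singleton, sum_singleton,
      pairSign_mul_self, one_smul, one_smul] at h
    exact smul_right_injective _ hcy h

lemma shift_schur (x : K) (hu : IsUnit (T o o)) (i j : Idx m n) :
    shift s x (schur T o i j) = schur (fun a b => shift s x (T a b)) o i j := by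
  rw [schur_apply, schur_apply, ← shift_inverse s x hu, ← shift_mul, ← shift_mul,
    ← shiftHom_apply, map_sub]
  rfl

section step
variable (hT : IsRTTFamily s z o.val T) (hz : z ≠ 0) (ho : o.val < m + n)
  (hpz : (1 - qEps o ^ 2) * (qEps o ^ 2 - z) ≠ 0) (hu : IsUnit (T o o))
include hT hz ho hpz hu

omit hz in
-- The relation at argument `q^{2(ε_o, ε_o)}`, after the substitution by `x`, puts the two shifted
-- matrices in the position of fusion.
lemma fuse_shift {x : K} {i j : Idx m n} (hi : i ∈ inner m n (o.val + 1)) :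
    fuse o (fun i j => shift s (qEps o ^ 2 * x) (T i j)) (fun i j => shift s x (T i j)) i o j =
      shift s (qEps o ^ 2 * x) (T o o) * shift s x (schur T o i j) := by
  have hp : IsRTT z (qEps o ^ 2) o.val (fun i j => shift s (qEps o ^ 2 * x) (T i j))
      (fun i j => shift s x (T i j)) := by
    have := (hT (qEps o ^ 2) (pow_ne_zero _ (qEps_ne_zero o))).map (shiftHom s x)
    simpa only [shiftHom_apply, shift_shift, mul_comm x] using this
  rw [fuse_eq_mul_schur (fuse_self ho hp hpz hi) (isUnit_shift s x hu), shift_schur x hu]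

/-- The fused entry is a pivot times an entry of the Schur complement. It commutes with `T o o`, and
so does the pivot, which is invertible and can be cancelled. -/
theorem IsRTTFamily.commute_schur {x : K} (hx : x ≠ 0) {i j : Idx m n}
    (hi : i ∈ inner m n (o.val + 1)) (hj : j ∈ inner m n (o.val + 1)) :
    Commute (shift s x (schur T o i j)) (T o o) := by
  have ht := qEps_ne_zero o
  refine (IsLaurentFamily.shift_mul s _ _).eq_of_polyFun (IsLaurentFamily.mul_shift s _ _)
    (c := fun y => fuseTop z y o) ?_ ?_ (fun y hy hcy => ?_) hx
  · have hx := IsPolyFun.id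
    have hz := IsPolyFun.const z
    have h1 := IsPolyFun.const 1
    have hp := IsPolyFun.const (qEps o ^ 2)
    exact ((h1.sub (hp.mul hx)).mul ((hp.mul hx).sub hz)).mul
      ((hx.sub hz).mul ((IsPolyFun.const _).sub (hx.mul (IsPolyFun.const _))))
  · simp [fuseTop, hz, ht]
  · have hpy : qEps o ^ 2 * y ≠ 0 := mul_ne_zero (pow_ne_zero _ ht) hy
    have hp : IsRTT z (qEps o ^ 2) o.val (fun i j => shift s (qEps o ^ 2 * y) (T i j))
        (fun i j => shift s y (T i j)) := by
      have := (hT (qEps o ^ 2) (pow_ne_zero _ ht)).map (shiftHom s y)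
      simpa only [shiftHom_apply, shift_shift, mul_comm y] using this
    have h := fuse_commute ho hp (hT _ hpy) (hT y hy) hpz hcy hi hj
    rw [fuse_shift hT ho hpz hu hi] at h
    have hc := hT.commute_corner hz ho hpy
    have hu' := isUnit_shift s (qEps o ^ 2 * y) hu
    apply hu'.mul_left_cancel
    rw [← mul_assoc, h.eq, ← mul_assoc, ← mul_assoc, hc.eq]

/-- The relation of lower rank holds for the fused matrix, which is the shifted pivot times the
Schur complement. The pivot commutes with the Schur complement, so it moves to the left on both
sides and cancels. -/
theorem IsRTTFamily.schur_isRTTFamily :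
    IsRTTFamily s ((qEps o ^ 2)⁻¹ * z) (o.val + 1) (schur T o) := by
  have ht := qEps_ne_zero o
  refine isRTTFamily_of_polyFun (c := fun y => fuseFactor z y o) ?_ ?_ fun y hy hcy => ?_
  · have hx := IsPolyFun.id
    have hz := IsPolyFun.const z
    have h1 := IsPolyFun.const 1
    have hp := IsPolyFun.const (qEps o ^ 2)
    exact (hp.mul (hx.sub hz)).mul (h1.sub (hp.mul hx))
  · simp [fuseFactor, hz, ht]
  · have hpy : qEps o ^ 2 * y ≠ 0 := mul_ne_zero (pow_ne_zero _ ht) hy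
    have hp : IsRTT z (qEps o ^ 2) o.val (fun i j => shift s (qEps o ^ 2 * y) (T i j))
        (fun i j => shift s y (T i j)) := by
      have := (hT (qEps o ^ 2) (pow_ne_zero _ ht)).map (shiftHom s y)
      simpa only [shiftHom_apply, shift_shift, mul_comm y] using this
    intro i hi c hc j hj l hl
    have h := fuse_isRTT ho hp (hT _ hpy) (hT y hy) hpz hcy hu i hi c hc j hj l hl
    -- Commutation is known when the entry of the Schur complement is shifted; substituting by the
    -- inverse scalar moves the shift to the pivot.
    have hcomm : ∀ b ∈ inner m n (o.val + 1),
        Commute (schur T o c b) (shift s (qEps o ^ 2 * y) (T o o)) := by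
      intro b hb
      have h1 := (hT.commute_schur hz ho hpz hu (inv_ne_zero hpy) hc hb).map
        (shiftHom s (qEps o ^ 2 * y))
      rwa [shiftHom_apply, shiftHom_apply, shift_shift, mul_inv_cancel₀ hpy, shift_one] at h1
    apply (isUnit_shift s (qEps o ^ 2 * y) hu).mul_left_cancel
    have e1 := rowSum_map (LinearMap.mulLeft K (shift s (qEps o ^ 2 * y) (T o o)))
      ((qEps o ^ 2)⁻¹ * z) y (o.val + 1) i c
      (fun a b => (pairSign a b * pairSign j b) • (shift s y (schur T o a j) * schur T o b l))
    have e2 := colSum_map (LinearMap.mulLeft K (shift s (qEps o ^ 2 * y) (T o o)))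
      ((qEps o ^ 2)⁻¹ * z) y (o.val + 1) j l
      (fun a b => (pairSign i b * pairSign a b) • (schur T o c b * shift s y (schur T o i a)))
    rw [LinearMap.mulLeft_apply] at e1 e2
    rw [e1, e2]
    beta_reduce at h
    convert h using 1
    · refine rowSum_congr _ _ _ _ _ fun a ha b _ => ?_
      rw [fuse_shift hT ho hpz hu ha, LinearMap.mulLeft_apply, mul_smul_comm, mul_assoc]
    · refine colSum_congr _ _ _ _ _ fun a _ b hb => ?_
      rw [fuse_shift hT ho hpz hu hi, LinearMap.mulLeft_apply, mul_smul_comm, ← mul_assoc,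
        ← mul_assoc, (hcomm b hb).eq]

end step
end Family
end OspRTT

namespace OspRTT

open Finset

/-! ### Invertibility of matrices over power series. -/

section Invertibility

/-- A matrix with invertible diagonal whose other nonzero entries increase a rank function. -/
lemma isUnit_of_triangular {ι A : Type*} [Fintype ι] [DecidableEq ι] [Ring A] (r : ι → ℕ)
    (M : Matrix ι ι A) (hd : ∀ i, IsUnit (M i i)) (h : ∀ i j, i ≠ j → r j ≤ r i → M i j = 0) :
    IsUnit M := by
  choose u hu using hd
  set N : Matrix ι ι A := Matrix.of fun i j => if i = j then 0 else ↑(u i)⁻¹ * M i j with hN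
  -- The diagonal is divided out; the remaining `N` strictly raises the rank function, hence is
  -- nilpotent.
  have hfac : M = Matrix.diagonal (fun i => (u i : A)) * (1 + N) := by
    ext i j
    rw [Matrix.diagonal_mul, Matrix.add_apply, Matrix.one_apply, hN, Matrix.of_apply]
    split_ifs with hij
    · rw [← hij, hu, add_zero, mul_one]
    · rw [zero_add, Units.mul_inv_cancel_left]
  have hD : IsUnit (Matrix.diagonal fun i => (u i : A)) :=
    ⟨⟨Matrix.diagonal fun i => (u i : A), Matrix.diagonal fun i => ((u i)⁻¹ : Aˣ),
      by simp [Matrix.diagonal_mul_diagonal], by simp [Matrix.diagonal_mul_diagonal]⟩, rfl⟩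
  have hpow : ∀ p i j, (N ^ p) i j ≠ 0 → r i + p ≤ r j := by
    intro p
    induction p with
    | zero =>
      intro i j hij
      rw [pow_zero, Matrix.one_apply] at hij
      have : i = j := by by_contra hne; simp [hne] at hij
      simp [this]
    | succ p ih =>
      intro i j hij
      rw [pow_succ, Matrix.mul_apply] at hij
      obtain ⟨a, -, ha⟩ := exists_ne_zero_of_sum_ne_zero hij
      have h1 := ih i a (left_ne_zero_of_mul ha)
      have h2 : N a j ≠ 0 := right_ne_zero_of_mul ha
      rw [hN, Matrix.of_apply] at h2
      have h3 : a ≠ j := by rintro rfl; simp at h2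
      rw [if_neg h3] at h2
      have h4 : ¬ r j ≤ r a := fun hle => h2 (by rw [h a j h3 hle, mul_zero])
      omega
  have hnil : IsNilpotent N := by
    refine ⟨univ.sup r + 1, ?_⟩
    ext i j
    by_contra hij
    have h1 := hpow _ i j hij
    have h2 : r j ≤ univ.sup r := le_sup (mem_univ j)
    omega
  rw [hfac]
  exact hD.mul hnil.isUnit_one_add

/-- Power series of matrices as matrices of power series. -/
noncomputable def seriesToMatrix (ι A : Type*) [Fintype ι] [DecidableEq ι] [Ring A] :
    PowerSeries (Matrix ι ι A) →+* Matrix ι ι (PowerSeries A) where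
  toFun φ := Matrix.of fun i j => PowerSeries.mk fun p => PowerSeries.coeff p φ i j
  map_zero' := by ext; simp
  map_add' x y := by ext; simp
  map_one' := by
    ext i j p
    rw [Matrix.of_apply, PowerSeries.coeff_mk, PowerSeries.coeff_one, Matrix.one_apply]
    rcases eq_or_ne i j with rfl | h2
    · rw [if_pos rfl, PowerSeries.coeff_one]
      split_ifs
      · rw [Matrix.one_apply, if_pos rfl]
      · rfl
    · rw [if_neg h2, map_zero]
      split_ifs
      · rw [Matrix.one_apply, if_neg h2]
      · rfl
  map_mul' x y := by
    ext i j p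
    simp only [Matrix.of_apply, PowerSeries.coeff_mk, PowerSeries.coeff_mul, Matrix.mul_apply,
      map_sum, Matrix.sum_apply]
    exact sum_comm

/-- A matrix of power series is a power series with matrix coefficients, invertible as soon as its
constant term is. -/
lemma isUnit_matrix_of_constantCoeff {ι A : Type*} [Fintype ι] [DecidableEq ι] [Ring A]
    (M : Matrix ι ι (PowerSeries A))
    (h : IsUnit (Matrix.of fun i j => PowerSeries.constantCoeff (M i j))) : IsUnit M := by
  have h1 : IsUnit (PowerSeries.mk fun p => Matrix.of fun i j => PowerSeries.coeff p (M i j)) := by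
    rw [PowerSeries.isUnit_iff_constantCoeff, ← PowerSeries.coeff_zero_eq_constantCoeff_apply,
      PowerSeries.coeff_mk]
    simpa using h
  have h2 := h1.map (seriesToMatrix ι A)
  convert h2
  ext i j p
  simp [seriesToMatrix]

end Invertibility

/-! ### Gaussian elimination and quasideterminants. -/

section Gauss

variable {m n : ℕ}

/-- The successive Schur complements with respect to the leading principal submatrices. -/
noncomputable def gauss {S : Type*} [Ring S] (T : Idx m n → Idx m n → S) :
    ℕ → Idx m n → Idx m n → S
  | 0 => T
  | k + 1 => if h : k < 2 * n + 2 * m + 1 then schur (gauss T k) ⟨k, h⟩ else gauss T k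

lemma gauss_succ {S : Type*} [Ring S] (T : Idx m n → Idx m n → S) (o : Idx m n) :
    gauss T (o.val + 1) = schur (gauss T o.val) o := by
  rw [gauss, dif_pos o.isLt]

section triangular
variable {A : Type} [Ring A]

/-- Triangularity of the constant terms, with invertible diagonal from the index `k` on. -/
def IsTriangularFrom (k : ℕ) (T : Idx m n → Idx m n → PowerSeries A) : Prop :=
  (∀ i : Idx m n, k ≤ i.val → IsUnit (PowerSeries.constantCoeff (T i i))) ∧
    ((∀ i j, i < j → PowerSeries.constantCoeff (T i j) = 0) ∨
      ∀ i j, j < i → PowerSeries.constantCoeff (T i j) = 0)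

lemma IsTriangularFrom.isUnit {k : ℕ} {T : Idx m n → Idx m n → PowerSeries A}
    (h : IsTriangularFrom k T) {i : Idx m n} (hi : k ≤ i.val) : IsUnit (T i i) :=
  PowerSeries.isUnit_iff_constantCoeff.2 (h.1 i hi)

lemma IsTriangularFrom.schur {o : Idx m n} {T : Idx m n → Idx m n → PowerSeries A}
    (h : IsTriangularFrom o.val T) : IsTriangularFrom (o.val + 1) (schur T o) := by
  -- The correction in the Schur complement has zero constant term when one of its outer factors
  -- has, so triangularity and the diagonal constant terms persist.
  have hz : ∀ i j, PowerSeries.constantCoeff (T i o) = 0 ∨ PowerSeries.constantCoeff (T o j) = 0 →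
      PowerSeries.constantCoeff (OspRTT.schur T o i j) = PowerSeries.constantCoeff (T i j) := by
    rintro i j (h | h) <;> simp [schur_apply, h]
  obtain ⟨h1, h2⟩ := h
  refine ⟨fun i hi => ?_, ?_⟩
  · have hoi : o < i := Fin.lt_def.2 (by omega)
    rw [hz i i]
    · exact h1 i (by omega)
    · exact h2.elim (fun h => Or.inr (h o i hoi)) fun h => Or.inl (h i o hoi)
  · refine h2.imp (fun h i j hij => ?_) fun h i j hij => ?_
    · rw [hz i j, h i j hij]
      rcases lt_or_ge o j with hoj | hoj
      · exact Or.inr (h o j hoj)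
      · exact Or.inl (h i o (lt_of_lt_of_le hij hoj))
    · rw [hz i j, h i j hij]
      rcases lt_or_ge o i with hoj | hoj
      · exact Or.inl (h i o hoj)
      · exact Or.inr (h o j (lt_of_lt_of_le hij hoj))

lemma IsTriangularFrom.gauss {T : Idx m n → Idx m n → PowerSeries A} (h : IsTriangularFrom 0 T)
    (k : ℕ) (hk : k ≤ 2 * n + 2 * m + 1) : IsTriangularFrom k (gauss T k) := by
  induction k with
  | zero => exact h
  | succ k ih =>
    have := (gauss_succ T (⟨k, hk⟩ : Idx m n))
    rw [this]
    exact IsTriangularFrom.schur (o := ⟨k, hk⟩) (ih (by omega))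

lemma IsTriangularFrom.isUnit_gauss {T : Idx m n → Idx m n → PowerSeries A}
    (h : IsTriangularFrom 0 T) (i : Idx m n) : IsUnit (OspRTT.gauss T i.val i i) :=
  (h.gauss i.val i.isLt.le).isUnit le_rfl

lemma IsTriangularFrom.isUnit_leading {T : Idx m n → Idx m n → PowerSeries A}
    (h : IsTriangularFrom 0 T) (i : Idx m n) :
    IsUnit (Matrix.of fun a b : {a : Idx m n // a < i} => T a b) := by
  refine isUnit_matrix_of_constantCoeff _ ?_
  obtain ⟨h1, h2 | h2⟩ := h
  -- Nonzero constant terms off the diagonal have column index below the row index, so the rank has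
  -- to be the reversed index.
  · refine isUnit_of_triangular (fun a => 2 * n + 2 * m + 1 - a.val.val) _
      (fun a => h1 _ (Nat.zero_le _)) fun a b hab hr => h2 _ _ ?_
    have := a.val.isLt
    have := b.val.isLt
    have hne : a.val.val ≠ b.val.val := fun h => hab (Subtype.ext (Fin.ext h))
    exact Fin.lt_def.2 (by omega)
  · refine isUnit_of_triangular (fun a => a.val.val) _
      (fun a => h1 _ (Nat.zero_le _)) fun a b hab hr => h2 _ _ ?_
    have hne : a.val.val ≠ b.val.val := fun h => hab (Subtype.ext (Fin.ext h))
    exact Fin.lt_def.2 (by omega)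

end triangular

section quasideterminant
variable {S : Type*} [Ring S]

lemma gauss_eq_zero (T : Idx m n → Idx m n → S) (hu : ∀ i : Idx m n, IsUnit (gauss T i.val i i))
    (k : ℕ) (hk : k ≤ 2 * n + 2 * m + 1) {i : Idx m n} (hi : i.val < k) (j : Idx m n) :
    gauss T k i j = 0 := by
  induction k generalizing j with
  | zero => omega
  | succ k ih =>
    have h := gauss_succ T (⟨k, hk⟩ : Idx m n)
    simp only at h
    rw [h, schur_apply]
    rcases Nat.lt_succ_iff_lt_or_eq.1 hi with hlt | heq
    · rw [ih (by omega) hlt j, ih (by omega) hlt ⟨k, hk⟩, zero_mul, zero_mul, sub_zero]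
    · have hik : i = ⟨k, hk⟩ := Fin.ext heq
      subst hik
      have hk' := Ring.mul_inverse_cancel _ (hu ⟨k, hk⟩)
      simp only at hk'
      rw [hk', one_mul, sub_self]

/-- Elimination subtracts right combinations of the first `k` columns. Only their existence matters,
since invertibility of the leading block later determines the coefficients used. -/
lemma exists_gauss_eq (T : Idx m n → Idx m n → S) (k : ℕ) (hk : k ≤ 2 * n + 2 * m + 1) :
    ∃ X : Idx m n → Idx m n → S, ∀ i j,
      gauss T k i j = T i j - ∑ a ∈ univ.filter (fun a : Idx m n => a.val < k), T i a * X a j := by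
  induction k with
  | zero => exact ⟨0, fun i j => by simp [gauss]⟩
  | succ k ih =>
    obtain ⟨X, hX⟩ := ih (by omega)
    set o : Idx m n := ⟨k, hk⟩ with ho
    have h := gauss_succ T o
    have hfil : univ.filter (fun a : Idx m n => a.val < k + 1) =
        insert o (univ.filter fun a : Idx m n => a.val < k) := by
      ext a
      simp only [mem_filter, mem_univ, true_and, mem_insert, Fin.ext_iff, ho]
      omega
    set y := fun j => Ring.inverse (gauss T k o o) * gauss T k o j with hy
    -- The new pivot column enters with coefficient `y j`; it already contains the earlier columns
    -- with coefficients `X a o`, whence the correction.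
    refine ⟨fun a j => if a = o then y j else X a j - X a o * y j, fun i j => ?_⟩
    have hsum : ∑ a ∈ univ.filter (fun a : Idx m n => a.val < k),
          T i a * (if a = o then y j else X a j - X a o * y j) =
        ∑ a ∈ univ.filter (fun a : Idx m n => a.val < k), T i a * X a j -
          (∑ a ∈ univ.filter (fun a : Idx m n => a.val < k), T i a * X a o) * y j := by
      rw [sum_mul, ← sum_sub_distrib]
      refine sum_congr rfl fun a ha => ?_
      have hne : a ≠ o := by
        rintro rfl
        simp [ho] at ha
      rw [if_neg hne, mul_sub, mul_assoc]
    change gauss T (o.val + 1) i j = _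
    rw [hfil, sum_insert (by simp [ho])]
    beta_reduce
    rw [if_pos rfl, hsum]
    rw [h, schur_apply, mul_assoc]
    change gauss T k i j - gauss T k i o * y j = _
    rw [hX i j, hX i o]
    noncomm_ring

/-- The rows above `i` of the reduced matrix vanish, so the elimination coefficients of column `i`
solve the linear system of the leading block. Inverting that block gives the quasideterminant. -/
lemma quasideterminant_eq_gauss (T : Idx m n → Idx m n → S)
    (hu : ∀ i : Idx m n, IsUnit (gauss T i.val i i)) (i : Idx m n)
    (hl : IsUnit (Matrix.of fun a b : {a : Idx m n // a < i} => T a b)) :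
    T i i - ∑ a : {a : Idx m n // a < i}, ∑ b : {a : Idx m n // a < i},
      T i a * Ring.inverse (Matrix.of fun a b : {a : Idx m n // a < i} => T a b) a b * T b i =
      gauss T i.val i i := by
  obtain ⟨X, hX⟩ := exists_gauss_eq T i.val i.isLt.le
  have hsub : ∀ f : Idx m n → S, ∑ a ∈ univ.filter (fun a : Idx m n => a.val < i.val), f a =
      ∑ a : {a : Idx m n // a < i}, f a := fun f =>
    sum_subtype _ (fun a => by rw [mem_filter, Fin.lt_def]; exact ⟨fun h => h.2, fun h => ⟨mem_univ a, h⟩⟩) f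
  set M := Matrix.of fun a b : {a : Idx m n // a < i} => T a b with hM
  have hcol : M.mulVec (fun a => X a i) = fun a : {a : Idx m n // a < i} => T a i := by
    ext a
    have h1 := hX a i
    rw [gauss_eq_zero T hu i.val i.isLt.le (Fin.lt_def.1 a.2), hsub] at h1
    exact (sub_eq_zero.1 h1.symm).symm
  have hsol : (fun a : {a : Idx m n // a < i} => X a i) =
      (Ring.inverse M).mulVec fun a : {a : Idx m n // a < i} => T a i := by
    rw [← hcol, Matrix.mulVec_mulVec, Ring.inverse_mul_cancel _ hl, Matrix.one_mulVec]
  rw [hX i i, hsub]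
  congr 1
  refine sum_congr rfl fun a _ => ?_
  have hXa : X a i = (Ring.inverse M).mulVec (fun a : {a : Idx m n // a < i} => T a i) a :=
    congrFun hsol a
  simp only [hXa, Matrix.mulVec, dotProduct, mul_sum]
  rw [hM]
  exact sum_congr rfl fun b _ => by rw [mul_assoc]

end quasideterminant
end Gauss
end OspRTT

namespace OspRTT

open Finset Polynomial

/-! ### From relations between coefficients to relations at scalar arguments. -/

section Evaluation

/-- An identity between convolutions of power series with finite sequences in a vector space gives
an identity between values, when the power series become polynomials after multiplication by a
common factor. -/
lemma eval_of_convolution {ι V : Type*} [Fintype ι] [AddCommGroup V] [Module K V]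
    {ρ ρ' : ι → PowerSeries K} {r r' : ι → K[X]} {g u : PowerSeries K} (hu : u ≠ 0)
    (hr : ∀ i, g * ρ i = u * (r i : PowerSeries K))
    (hr' : ∀ i, g * ρ' i = u * (r' i : PowerSeries K)) {d : ℕ} {F G : ℕ → ι → V}
    (hF : ∀ e i, d < e → F e i = 0) (hG : ∀ e i, d < e → G e i = 0)
    (h : ∀ N, ∑ p ∈ antidiagonal N, ∑ i, PowerSeries.coeff p.1 (ρ i) • F p.2 i =
      ∑ p ∈ antidiagonal N, ∑ i, PowerSeries.coeff p.1 (ρ' i) • G p.2 i) (x : K) :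
    ∑ i, (r i).eval x • ∑ e ∈ range (d + 1), x ^ e • F e i =
      ∑ i, (r' i).eval x • ∑ e ∈ range (d + 1), x ^ e • G e i := by
  rw [← sub_eq_zero]
  -- Linear functionals turn the finite sequences `F` and `G` into polynomials with scalar
  -- coefficients.
  refine (Module.forall_dual_apply_eq_zero_iff K _).1 fun φ => ?_
  rw [map_sub, sub_eq_zero]
  let p (F : ℕ → ι → V) (i : ι) : K[X] := ∑ e ∈ range (d + 1), monomial e (φ (F e i))
  have hp (F : ℕ → ι → V) (hF : ∀ e i, d < e → F e i = 0) (e : ℕ) (i : ι) :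
      PowerSeries.coeff e (p F i : PowerSeries K) = φ (F e i) := by
    rw [Polynomial.coeff_coe]
    simp only [p, finsetSum_coeff, coeff_monomial, sum_ite_eq', mem_range]
    split_ifs with he
    · rfl
    · rw [hF e i (by omega), map_zero]
  have hconv : ∑ i, ρ i * (p F i : PowerSeries K) = ∑ i, ρ' i * (p G i : PowerSeries K) := by
    ext N
    have h1 := congrArg φ (h N)
    simp only [map_sum, map_smul, smul_eq_mul] at h1
    simp only [map_sum, PowerSeries.coeff_mul, hp F hF, hp G hG]
    rw [sum_comm, h1, sum_comm]
  -- Multiplying the identity of power series by `g` makes the coefficients polynomials times `u`;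
  -- since `u ≠ 0` it cancels, and evaluation becomes meaningful.
  have hpoly : ∑ i, r i * p F i = ∑ i, r' i * p G i := by
    apply Polynomial.coe_injective
    apply mul_left_cancel₀ hu
    have h2 := congrArg (g * ·) hconv
    simp only [mul_sum, ← mul_assoc, hr, hr'] at h2
    have e (r : ι → K[X]) (F : ℕ → ι → V) :
        u * ((∑ i, r i * p F i : K[X]) : PowerSeries K) =
          ∑ i, u * (r i : PowerSeries K) * (p F i : PowerSeries K) := by
      rw [← Polynomial.coeToPowerSeries.ringHom_apply, map_sum, mul_sum]
      simp [mul_assoc]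
    rw [e, e, h2]
  have h3 := congrArg (eval x) hpoly
  simp only [eval_finsetSum, eval_mul, p, eval_monomial] at h3
  simpa [mul_comm] using h3

end Evaluation

/-! ### The entries of the R-matrix as polynomials. -/

section RMatrix
variable {m n : ℕ}

/-- The sign by which the matrix entries of `∑ x E^i_j ⊗ E^k_l` differ from the coefficients. -/
noncomputable def opSign (i k j l : Idx m n) : K :=
  (-1) ^ ((par k + par l) * par j + (par i + par j + par k + par l) * (par j + par l))

/-- The polynomial with values `rEntry z x i k j l`. -/
noncomputable def rPoly (z : K) (i k j l : Idx m n) : K[X] :=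
  (if j = i ∧ l = k then (1 - X) * (X - C z) * C (diagB i k) else 0) +
    (if j = k ∧ l = i then C (pairSign i k) * C (q - q⁻¹) * (X - C z) *
      (if k < i then 1 else X) else 0) +
    (if k = i.rev ∧ l = j.rev then C (q - q⁻¹) * (1 - X) * C (colQ i * rowQ j) *
      (if j < i then C z else X) else 0)

lemma rPoly_eval (z x : K) (i k j l : Idx m n) : (rPoly z i k j l).eval x = rEntry z x i k j l := by
  have h (p : Prop) [Decidable p] (a b : K[X]) :
      (if p then a else b).eval x = if p then a.eval x else b.eval x := by split_ifs <;> rfl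
  simp only [rPoly, rEntry, diagCoeff, swapCoeff, contrCoeff, eval_add, h, eval_mul, eval_sub,
    eval_one, eval_X, eval_C, eval_zero]

lemma opSign_mul_P (i j k l : Idx m n) :
    opSign i k j l * P i j k l = if j = k ∧ l = i then pairSign i k else 0 := by
  unfold P
  by_cases h : j = k ∧ l = i
  · obtain ⟨rfl, rfl⟩ := h
    rw [if_pos ⟨rfl, rfl⟩, if_pos ⟨rfl, rfl⟩, opSign, pairSign, intCast_sgn]
    rcases par_eq_zero_or_one l with h | h <;> rcases par_eq_zero_or_one j with h' | h' <;>
      norm_num [h, h']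
  · rw [if_neg (fun h' => h ⟨h'.1.symm, h'.2⟩), if_neg h, mul_zero]

lemma qRho_eq (i j : Idx m n) : qRho i j = qh ^ twoRho i * qh ^ (-twoRho j) := by
  rw [← zpow_add₀ qh_ne_zero, qRho, sub_eq_add_neg]

lemma opSign_mul_Q (i j k l : Idx m n) :
    opSign i k j l * Q i j k l = if k = i.rev ∧ l = j.rev then colQ i * rowQ j else 0 := by
  unfold Q
  by_cases h : k = i.rev ∧ l = j.rev
  · obtain ⟨rfl, rfl⟩ := h
    rw [if_pos ⟨rfl, rfl⟩, if_pos ⟨rfl, rfl⟩, opSign, colQ, rowQ, intCast_sgn, intCast_sgn, qRho_eq,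
      par_rev, par_rev]
    rcases par_eq_zero_or_one i with h | h <;> rcases par_eq_zero_or_one j with h' | h' <;>
      simp only [h, h'] <;> ring
  · rw [if_neg h, if_neg h, mul_zero]

/-- The identities behind this are `1 + (q^{1/2} - q^{-1/2}) q^{1/2} = q` and `1 - (q^{1/2} -
q^{-1/2}) q^{-1/2} = q⁻¹`. -/
lemma diagB_eq (i k : Idx m n) :
    diagB i k = 1 + if i ≠ i.rev then (qh - qh⁻¹) * (sgn (par i) : K) * sigmaDiag i k k else 0 := by
  have hq := qh_ne_zero
  unfold diagB sigmaDiag qEps epsSq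
  simp only [and_self, intCast_sgn]
  by_cases hi : i = i.rev
  · rw [if_neg (not_not.2 hi), add_zero]
    rw [if_pos hi.symm]
    split_ifs <;> simp
  · rw [if_pos hi, if_neg (Ne.symm hi)]
    by_cases h1 : k = i
    · have h2 : k ≠ i.rev := fun h => hi (h1 ▸ h)
      simp only [if_pos h1, if_neg h2]
      rcases par_eq_zero_or_one i with h | h <;> simp [h, q, sgn] <;> field_simp <;> ring
    · simp only [if_neg h1]
      split_ifs
      · rcases par_eq_zero_or_one i with h | h <;> simp [h, q, sgn] <;> field_simp <;> ring
      · simp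

/-- The two parts of the off-diagonal sum in `B` are the parts of `P` and of `-Q` with `j < i`,
times `q - q⁻¹`. This is why they merge with the `P` and `Q` terms of the R-matrix. -/
lemma opSign_mul_B (i j k l : Idx m n) :
    opSign i k j l * B i j k l = (if j = i ∧ l = k then diagB i k else 0) +
      (if j = k ∧ l = i then pairSign i k * (q - q⁻¹) * (if k < i then 1 else 0) else 0) -
      (if k = i.rev ∧ l = j.rev then (q - q⁻¹) * (colQ i * rowQ j) * (if j < i then 1 else 0)
        else 0) := by
  have h1 : opSign i k j l * ((if i = j ∧ k = l then 1 else 0) +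
      (if i = j ∧ i ≠ i.rev then (qh - qh⁻¹) * (sgn (par i) : K) * sigmaDiag i k l else 0)) =
      if j = i ∧ l = k then diagB i k else 0 := by
    by_cases h : j = i ∧ l = k
    · obtain ⟨rfl, rfl⟩ := h
      have hs : opSign j l j l = 1 :=
        Even.neg_one_pow ⟨par l * par j + (par j + par l) * (par j + par l), by ring⟩
      simp only [and_self, true_and, if_true, hs, one_mul, diagB_eq]
    · rw [if_neg h, if_neg (fun h' => h ⟨h'.1.symm, h'.2.symm⟩), zero_add]
      by_cases hij : i = j
      · have hkl : k ≠ l := fun h' => h ⟨hij.symm, h'.symm⟩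
        have : sigmaDiag i k l = 0 := by
          unfold sigmaDiag
          rw [if_neg (fun h' => hkl (h'.1.trans h'.2.symm)),
            if_neg (fun h' => hkl (h'.1.trans h'.2.symm)), sub_zero]
        rw [this]; simp
      · rw [if_neg (fun h' => hij h'.1), mul_zero]
  have h2 : opSign i k j l * (if j < i then (q - q⁻¹) * (sgn (par j) : K) * sigmaOff j i k l
      else 0) =
      (if j = k ∧ l = i then pairSign i k * (q - q⁻¹) * (if k < i then 1 else 0) else 0) -
      (if k = i.rev ∧ l = j.rev then (q - q⁻¹) * (colQ i * rowQ j) * (if j < i then 1 else 0)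
        else 0) := by
    by_cases hji : j < i
    · have hP := opSign_mul_P i j k l
      have hQ := opSign_mul_Q i j k l
      have hx := xi_mul_self i
      have e1 : (if k = j ∧ l = i then (1 : K) else 0) * sgn (par j) = P i j k l := by
        unfold P; split_ifs <;> simp
      have e2 : (if k = i.rev ∧ l = j.rev then
          (sgn (par j * (par j + par i)) : K) * (xi j : K) * (xi i : K) * qRho i j else 0) *
            sgn (par j) = Q i j k l := by
        unfold Q; split_ifs
        · simp only [intCast_sgn]
          rcases par_eq_zero_or_one i with h | h <;> rcases par_eq_zero_or_one j with h' | h' <;>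
            simp only [h, h'] <;> ring
        · simp
      have e3 : (if j = k ∧ l = i then pairSign i k * (q - q⁻¹) * (if k < i then 1 else 0) else 0) =
          (q - q⁻¹) * if j = k ∧ l = i then pairSign i k else 0 := by
        split_ifs with h h'
        · ring
        · exact absurd (h.1 ▸ hji) h'
        · simp
      have e4 : (if k = i.rev ∧ l = j.rev then (q - q⁻¹) * (colQ i * rowQ j) *
          (if j < i then 1 else 0) else 0) =
          (q - q⁻¹) * if k = i.rev ∧ l = j.rev then colQ i * rowQ j else 0 := by
        rw [if_pos hji]; split_ifs <;> ring
      rw [if_pos hji, e3, e4, ← hP, ← hQ, ← e1, ← e2, sigmaOff]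
      ring
    · have e3 : (if j = k ∧ l = i then pairSign i k * (q - q⁻¹) * (if k < i then 1 else 0)
          else 0) = 0 := by
        split_ifs with h h'
        · exact absurd (h.1.symm ▸ h') hji
        · rw [mul_zero]
        · rfl
      simp only [e3, if_neg hji, mul_zero, ite_self, sub_zero]
  rw [add_sub_assoc, ← h1, ← h2, ← mul_add, B]

/-- The exponent has no constant term, so the series has constant term `1`. -/
lemma f_ne_zero : f m n ≠ 0 := by
  intro h
  have h0 : PowerSeries.constantCoeff (PowerSeries.mk fun k : ℕ =>
      if k = 0 then (0 : K) else logDerivF m n k / (k : K)) = 0 := by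
    rw [← PowerSeries.coeff_zero_eq_constantCoeff_apply, PowerSeries.coeff_mk, if_pos rfl]
  have hs := PowerSeries.HasSubst.of_constantCoeff_zero h0
  have h1 := PowerSeries.constantCoeff_subst_eq_zero h0 (PowerSeries.exp K - 1) (by simp)
  have h2 : f m n = PowerSeries.subst (PowerSeries.mk fun k : ℕ =>
      if k = 0 then (0 : K) else logDerivF m n k / (k : K)) (PowerSeries.exp K - 1) + 1 := by
    rw [f, ← PowerSeries.coe_substAlgHom hs, map_sub, map_one, sub_add_cancel]
  have h3 := congrArg PowerSeries.constantCoeff h2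
  rw [map_add, h] at h3
  have h4 : PowerSeries.constantCoeff (PowerSeries.subst (PowerSeries.mk fun k : ℕ =>
      if k = 0 then (0 : K) else logDerivF m n k / (k : K)) (PowerSeries.exp K - 1)) = 0 := h1
  rw [h4] at h3
  simp at h3

lemma zeta_ne_zero : zeta m n ≠ 0 := zpow_ne_zero _ q_ne_zero

/-- The polynomial form of the two `R`-matrices, up to a common factor. -/
lemma exists_rPoly {R : Coeffs m n (PowerSeries K)} (hR : R = Rfull m n ∨ R = Rtilde m n) :
    ∃ g u : PowerSeries K, u ≠ 0 ∧ ∀ i j k l,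
      g * (PowerSeries.C (opSign i k j l) * R i j k l) =
        u * (rPoly (zeta m n) i k j l : PowerSeries K) := by
  set D₁ : PowerSeries K := PowerSeries.C q - PowerSeries.C q⁻¹ * PowerSeries.X with hD₁
  set D₂ : PowerSeries K := PowerSeries.X - PowerSeries.C (zeta m n) with hD₂
  have h₁ : D₁ * D₁⁻¹ = 1 := PowerSeries.mul_inv_cancel _ (by simp [hD₁, q_ne_zero])
  have h₂ : D₂ * D₂⁻¹ = 1 := PowerSeries.mul_inv_cancel _ (by simp [hD₂, zeta_ne_zero])
  have key : ∀ i j k l, D₁ * D₂ * (PowerSeries.C (opSign i k j l) * Rtilde m n i j k l) =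
      (rPoly (zeta m n) i k j l : PowerSeries K) := by
    intro i j k l
    have e : D₁ * D₂ * (PowerSeries.C (opSign i k j l) * Rtilde m n i j k l) =
        PowerSeries.C (q - q⁻¹) * PowerSeries.X * D₂ * PowerSeries.C (opSign i k j l * P i j k l)
        - PowerSeries.C (q - q⁻¹) * PowerSeries.X * (PowerSeries.X - 1) *
          PowerSeries.C (opSign i k j l * Q i j k l)
        - (PowerSeries.X - 1) * D₂ * PowerSeries.C (opSign i k j l * B i j k l) := by
      rw [Rtilde, ← hD₁, ← hD₂, map_mul, map_mul, map_mul]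
      linear_combination (PowerSeries.C (opSign i k j l) * (PowerSeries.C (q - q⁻¹) *
        PowerSeries.X * PowerSeries.C (P i j k l) * D₂
        - (PowerSeries.X - 1) * PowerSeries.C (B i j k l) * D₂ - PowerSeries.C (q - q⁻¹) *
        PowerSeries.X * (PowerSeries.X - 1) * PowerSeries.C (Q i j k l) * D₂ * D₂⁻¹)) * h₁ -
        PowerSeries.C (opSign i k j l) * PowerSeries.C (q - q⁻¹) *
        PowerSeries.X * (PowerSeries.X - 1) * PowerSeries.C (Q i j k l) * h₂
    have hite (p : Prop) [Decidable p] (a b : K[X]) :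
      ((if p then a else b : K[X]) : PowerSeries K) =
        if p then (a : PowerSeries K) else (b : PowerSeries K) := by split_ifs <;> rfl
    have hite' (p : Prop) [Decidable p] (a b : K) :
      PowerSeries.C (if p then a else b) =
        if p then PowerSeries.C a else PowerSeries.C b := by split_ifs <;> rfl
    rw [e, opSign_mul_P, opSign_mul_Q, opSign_mul_B, rPoly]
    simp only [Polynomial.coe_add, Polynomial.coe_mul, Polynomial.coe_sub, Polynomial.coe_C,
      Polynomial.coe_X, Polynomial.coe_one, hite, hite', map_add, map_sub, map_mul,
      Polynomial.coe_zero, map_zero, map_one, hD₂]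
    have hy (a b : Idx m n) : (a < b) = True ∨ (a < b) = False := by
      by_cases h : a < b <;> simp [h]
    have hy' (p : Prop) : p = True ∨ p = False := by
      by_cases h : p <;> simp [h]
    rcases hy k i with h3 | h3 <;> rcases hy j i with h4 | h4 <;>
    rcases hy' (j = i ∧ l = k) with h5 | h5 <;> rcases hy' (j = k ∧ l = i) with h6 | h6 <;>
    rcases hy' (k = i.rev ∧ l = j.rev) with h7 | h7 <;>
    simp only [h3, h4, h5, h6, h7, if_true, if_false] <;> ring
  rcases hR with rfl | rfl
  · refine ⟨D₁ * D₂, f m n * (PowerSeries.X - PowerSeries.C (q ^ 2)) * D₂, ?_, fun i j k l => ?_⟩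
    · refine mul_ne_zero (mul_ne_zero f_ne_zero fun h => ?_) fun h => ?_
      · have := congrArg PowerSeries.constantCoeff h
        simp [q_ne_zero] at this
      · have := congrArg PowerSeries.constantCoeff h
        simp [hD₂, zeta_ne_zero] at this
    · rw [← key, Rfull, ← hD₂]; ring
  · exact ⟨D₁ * D₂, 1, one_ne_zero, fun i j k l => by rw [key, one_mul]⟩

end RMatrix
end OspRTT

namespace OspRTT

open Finset Polynomial

/-! ### Matrix entries of the RTT relations in terms of coefficients. -/

section Modes

variable {m n : ℕ} {A : Type} [Ring A] [Algebra K A]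

lemma sgn_smul {M : Type*} [AddCommGroup M] [Module K M] (k : ℕ) (x : M) :
    sgn k • x = ((-1 : K) ^ k) • x := by
  rw [← intCast_sgn, Int.cast_smul_eq_zsmul]

/-- The coefficients of the matrix `op₁ l`. -/
noncomputable def modeMat (l : LFam m n A) (s : ℤˣ) (i j : Idx m n) (e : ℤ) : A :=
  ((-1 : K) ^ ((par i + par j) * par j)) • mode l s i j e

lemma L1_apply (l : LFam m n A) (s : ℤˣ) (e : ℤ) (i b j d : Idx m n) :
    L1 l s e (i, b) (j, d) =
      if b = d then (pairSign i b * pairSign j b) • modeMat l s i j e else 0 := by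
  rw [L1, op₂, Matrix.of_apply]
  by_cases h : b = d
  · subst h
    simp only [if_true, sgn_smul, modeMat, smul_smul, pairSign]
    congr 1
    rcases par_eq_zero_or_one i with h | h <;> rcases par_eq_zero_or_one j with h' | h' <;>
      rcases par_eq_zero_or_one b with h'' | h'' <;> simp only [h, h', h''] <;> norm_num
  · simp only [if_neg h, smul_zero]

lemma L2_apply (l : LFam m n A) (s : ℤˣ) (e : ℤ) (c b a d : Idx m n) :
    L2 l s e (c, b) (a, d) = if c = a then modeMat l s b d e else 0 := by
  rw [L2, op₂, Matrix.of_apply]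
  by_cases h : c = a
  · subst h
    simp only [if_true, sgn_smul, modeMat]
    congr 1
    rcases par_eq_zero_or_one b with h | h <;> rcases par_eq_zero_or_one c with h' | h' <;>
      rcases par_eq_zero_or_one d with h'' | h'' <;> simp only [h, h', h''] <;> norm_num
  · simp only [if_neg h, smul_zero]

lemma L1_mul_L2_apply (l : LFam m n A) (s t : ℤˣ) (e f : ℤ) (a b j d : Idx m n) :
    (L1 l s e * L2 l t f) (a, b) (j, d) =
      (pairSign a b * pairSign j b) • (modeMat l s a j e * modeMat l t b d f) := by
  rw [Matrix.mul_apply, Fintype.sum_prod_type]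
  simp [L1_apply, L2_apply]

lemma L2_mul_L1_apply (l : LFam m n A) (s t : ℤˣ) (e f : ℤ) (i c a b : Idx m n) :
    (L2 l t f * L1 l s e) (i, c) (a, b) =
      (pairSign i b * pairSign a b) • (modeMat l t c b f * modeMat l s i a e) := by
  rw [Matrix.mul_apply, Fintype.sum_prod_type]
  simp [L1_apply, L2_apply]

lemma Rcoeff_apply (R : Coeffs m n (PowerSeries K)) (k : ℕ) (r c : Idx m n × Idx m n) :
    (Rcoeff R k : Matrix _ _ A) r c = algebraMap K A (PowerSeries.coeff k
      (PowerSeries.C (opSign r.1 r.2 c.1 c.2) * R r.1 c.1 r.2 c.2)) := by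
  rw [Rcoeff, op₂, Matrix.of_apply, sgn_smul, PowerSeries.coeff_C_mul, opSign, map_mul,
    Algebra.smul_def]

lemma rttLeft_apply (R : Coeffs m n (PowerSeries K)) (l : LFam m n A) (s : ℤˣ) (a b : ℤ)
    (i c j d : Idx m n) :
    rttLeft R 1 l s s a b (i, c) (j, d) = ∑ k ∈ range (a.natAbs + b.natAbs + 1),
      ∑ x : Idx m n × Idx m n, PowerSeries.coeff k
        (PowerSeries.C (opSign i c x.1 x.2) * R i x.1 c x.2) •
          (pairSign x.1 x.2 * pairSign j x.2) •
            (modeMat l s x.1 j (a - k) * modeMat l s x.2 d (b + k)) := by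
  rw [rttLeft, Matrix.sum_apply]
  refine sum_congr rfl fun k _ => ?_
  rw [one_pow, one_smul, mul_assoc, Matrix.mul_apply]
  refine sum_congr rfl fun x _ => ?_
  rw [Rcoeff_apply, ← Algebra.smul_def, L1_mul_L2_apply]

lemma rttRight_apply (R : Coeffs m n (PowerSeries K)) (l : LFam m n A) (s : ℤˣ) (a b : ℤ)
    (i c j d : Idx m n) :
    rttRight R 1 l s s a b (i, c) (j, d) = ∑ k ∈ range (a.natAbs + b.natAbs + 1),
      ∑ x : Idx m n × Idx m n, PowerSeries.coeff k
        (PowerSeries.C (opSign x.1 x.2 j d) * R x.1 j x.2 d) •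
          (pairSign i x.2 * pairSign x.1 x.2) •
            (modeMat l s c x.2 (b + k) * modeMat l s i x.1 (a - k)) := by
  rw [rttRight, Matrix.sum_apply]
  refine sum_congr rfl fun k _ => ?_
  rw [one_pow, one_smul, Matrix.mul_apply]
  refine sum_congr rfl fun x _ => ?_
  rw [Rcoeff_apply, ← Algebra.commutes, ← Algebra.smul_def, L2_mul_L1_apply]

variable {B : Type} [Ring B] [Algebra K B]

lemma modeMat_map (φ : A →ₐ[K] B) (l : LFam m n A) (s : ℤˣ) (i j : Idx m n) (e : ℤ) :
    φ (modeMat l s i j e) = modeMat (fun s i j p => φ (l s i j p)) s i j e := by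
  rw [modeMat, modeMat, map_smul, mode, mode, apply_ite φ, map_zero]

end Modes

/-! ### The generating matrices satisfy the RTT relation for all arguments. -/

section Relations

variable {m n : ℕ} (R : Coeffs m n (PowerSeries K))

/-- The generators in the quotient algebra. -/
noncomputable def lGen : LFam m n (U R) := fun s i j p =>
  RingQuot.mkAlgHom K (Rel R) (freeL s i j p)

lemma rtt_relation (s : ℤˣ) (a b : ℤ) (i c j d : Idx m n) :
    rttLeft R 1 (lGen R) s s a b (i, c) (j, d) = rttRight R 1 (lGen R) s s a b (i, c) (j, d) := by
  have h := RingQuot.mkAlgHom_rel K (Rel.rtt (R := R) s a b (i, c) (j, d))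
  rw [rttLeft_apply, rttRight_apply] at h
  simp only [map_sum, map_smul, map_mul, modeMat_map] at h
  rw [rttLeft_apply, rttRight_apply]
  exact h

/-- The exponents of `z` and `w` in the terms of total degree `d`. -/
def expo₁ (s : ℤˣ) (d e : ℕ) : ℤ := if s = 1 then e else e - d
/-- The exponents of `w`, see `expo₁`. -/
def expo₂ (s : ℤˣ) (d e : ℕ) : ℤ := if s = 1 then d - e else -e

variable {R}

/-- Fixing the total degree `d` leaves one free exponent, and the defining relations become
convolutions with the coefficients of the R-matrix. -/
lemma rtt_convolution (s : ℤˣ) (d N : ℕ) (i c j l : Idx m n) :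
    ∑ p ∈ antidiagonal N, ∑ x : Idx m n × Idx m n, PowerSeries.coeff p.1
        (PowerSeries.C (opSign i c x.1 x.2) * R i x.1 c x.2) •
          (pairSign x.1 x.2 * pairSign j x.2) •
            (modeMat (lGen R) s x.1 j (expo₁ s d p.2) * modeMat (lGen R) s x.2 l (expo₂ s d p.2)) =
    ∑ p ∈ antidiagonal N, ∑ x : Idx m n × Idx m n, PowerSeries.coeff p.1
        (PowerSeries.C (opSign x.1 x.2 j l) * R x.1 j x.2 l) •
          (pairSign i x.2 * pairSign x.1 x.2) •
            (modeMat (lGen R) s c x.2 (expo₂ s d p.2) *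
              modeMat (lGen R) s i x.1 (expo₁ s d p.2)) := by
  have hsum (F : ℕ → ℤ → ℤ → U R)
      (h1 : ∀ k a b, (s : ℤ) * a < 0 → F k a b = 0) (h2 : ∀ k a b, (s : ℤ) * b < 0 → F k a b = 0) :
      ∑ p ∈ antidiagonal N, F p.1 (expo₁ s d p.2) (expo₂ s d p.2) =
      ∑ k ∈ range ((expo₁ s d N).natAbs + (expo₂ s d N).natAbs + 1),
        F k (expo₁ s d N - k) (expo₂ s d N + k) := by
    rw [Finset.Nat.sum_antidiagonal_eq_sum_range_succ
      (fun k e => F k (expo₁ s d e) (expo₂ s d e))]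
    -- The truncation in the defining relation is longer than the antidiagonal, but for `k > N` one
    -- exponent has the wrong sign and the term vanishes.
    have hle : range N.succ ⊆ range ((expo₁ s d N).natAbs + (expo₂ s d N).natAbs + 1) := by
      intro k
      simp only [mem_range, expo₁, expo₂]
      split_ifs <;> omega
    rw [← sum_subset hle]
    · refine sum_congr rfl fun k hk => ?_
      have hk := mem_range.1 hk
      congr 1
      · simp only [expo₁]; split_ifs <;> omega
      · simp only [expo₂]; split_ifs <;> omega
    · intro k _ hk
      have hk : N < k := by simpa using hk
      rcases Int.units_eq_one_or s with rfl | rfl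
      · exact h1 _ _ _ (by simp [expo₁, hk])
      · refine h2 _ _ _ ?_
        simp [expo₂, hk]
  have hmode (a b : Idx m n) (e : ℤ) (he : (s : ℤ) * e < 0) : modeMat (lGen R) s a b e = 0 := by
    rw [modeMat, mode, if_neg (by omega), smul_zero]
  have h := rtt_relation R s (expo₁ s d N) (expo₂ s d N) i c j l
  rw [rttLeft_apply, rttRight_apply] at h
  rw [hsum (fun k a b => ∑ x : Idx m n × Idx m n, PowerSeries.coeff k
        (PowerSeries.C (opSign i c x.1 x.2) * R i x.1 c x.2) •
          (pairSign x.1 x.2 * pairSign j x.2) •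
            (modeMat (lGen R) s x.1 j a * modeMat (lGen R) s x.2 l b)),
    hsum (fun k a b => ∑ x : Idx m n × Idx m n, PowerSeries.coeff k
        (PowerSeries.C (opSign x.1 x.2 j l) * R x.1 j x.2 l) •
          (pairSign i x.2 * pairSign x.1 x.2) •
            (modeMat (lGen R) s c x.2 b * modeMat (lGen R) s i x.1 a)), h]
  all_goals
    intro k a b hab
    refine sum_eq_zero fun x _ => ?_
    simp [hmode _ _ _ hab]

lemma coeff_L (s : ℤˣ) (i j : Idx m n) (p : ℕ) :
    PowerSeries.coeff p (L R s i j) = modeMat (lGen R) s i j (s * p) := by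
  have hs : (s : ℤ) * (s * p) = p := by
    rw [← mul_assoc, ← Units.val_mul, Int.units_mul_self, Units.val_one, one_mul]
  rw [L, op₁, Matrix.of_apply, sgn_smul, coeff_smul', modeMat, mode, hs, if_pos (by omega)]
  simp [lSer, lGen]

/-- For the sign `-1` the substitution produces `x ^ (e - d)` where the left side has `x ^ e`; the
factor `x ^ d` accounts for this and is harmless since `x ≠ 0`. -/
lemma smul_coeff_mul (s : ℤˣ) (d : ℕ) {x : K} (hx : x ≠ 0) (i j k l : Idx m n) :
    ∑ e ∈ range (d + 1), x ^ e • (modeMat (lGen R) s i j (expo₁ s d e) *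
        modeMat (lGen R) s k l (expo₂ s d e)) =
      (if s = 1 then 1 else x ^ d) • PowerSeries.coeff d (shift s x (L R s i j) * L R s k l) := by
  rw [PowerSeries.coeff_mul]
  simp only [shift, PowerSeries.coeff_mk, coeff_L]
  rcases Int.units_eq_one_or s with rfl | rfl
  · rw [Finset.Nat.sum_antidiagonal_eq_sum_range_succ_mk, if_pos rfl, one_smul]
    refine sum_congr rfl fun e he => ?_
    have := mem_range.1 he
    simp only [expo₁, expo₂, if_true, Units.val_one, one_mul, zpow_natCast, smul_mul_assoc]
    congr 4
    omega
  · rw [← Finset.Nat.sum_antidiagonal_swap, Finset.Nat.sum_antidiagonal_eq_sum_range_succ_mk,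
      if_neg (by decide), smul_sum]
    refine sum_congr rfl fun e he => ?_
    have he := mem_range.1 he
    have h1 : ((-1 : ℤˣ) = 1) = False := by simp
    simp only [expo₁, expo₂, h1, if_false, Prod.fst_swap, Prod.snd_swap, smul_mul_assoc, smul_smul]
    congr 1
    · rw [← zpow_natCast, ← zpow_natCast, ← zpow_add₀ hx]
      congr 1
      push_cast
      omega
    · congr 2 <;> push_cast <;> omega

lemma smul_coeff_mul' (s : ℤˣ) (d : ℕ) {x : K} (hx : x ≠ 0) (i j k l : Idx m n) :
    ∑ e ∈ range (d + 1), x ^ e • (modeMat (lGen R) s k l (expo₂ s d e) *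
        modeMat (lGen R) s i j (expo₁ s d e)) =
      (if s = 1 then 1 else x ^ d) • PowerSeries.coeff d (L R s k l * shift s x (L R s i j)) := by
  rw [PowerSeries.coeff_mul]
  simp only [shift, PowerSeries.coeff_mk, coeff_L]
  rcases Int.units_eq_one_or s with rfl | rfl
  · rw [← Finset.Nat.sum_antidiagonal_swap, Finset.Nat.sum_antidiagonal_eq_sum_range_succ_mk,
      if_pos rfl, one_smul]
    refine sum_congr rfl fun e he => ?_
    have := mem_range.1 he
    simp only [expo₁, expo₂, if_true, Prod.fst_swap, Prod.snd_swap, Units.val_one, one_mul, zpow_natCast, mul_smul_comm]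
    congr 4
    omega
  · rw [Finset.Nat.sum_antidiagonal_eq_sum_range_succ_mk, if_neg (by decide), smul_sum]
    refine sum_congr rfl fun e he => ?_
    have he := mem_range.1 he
    have h1 : ((-1 : ℤˣ) = 1) = False := by simp
    simp only [expo₁, expo₂, h1, if_false, mul_smul_comm, smul_smul]
    congr 1
    · rw [← zpow_natCast, ← zpow_natCast, ← zpow_add₀ hx]
      congr 1
      push_cast
      omega
    · congr 2 <;> push_cast <;> omega

/-- The matrices `L^±(z)` satisfy the `RTT` relation. -/
theorem isRTTFamily_L (hR : R = Rfull m n ∨ R = Rtilde m n) (s : ℤˣ) :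
    IsRTTFamily s (zeta m n) 0 (fun i j => L R s i j) := by
  obtain ⟨g, u, hu, hr⟩ := exists_rPoly hR
  intro x hx i _ c _ j _ l _
  have huniv : inner m n 0 = univ := by ext; simp [mem_inner]
  have hmode (a b : Idx m n) (e : ℤ) (he : (s : ℤ) * e < 0) : modeMat (lGen R) s a b e = 0 := by
    rw [modeMat, mode, if_neg (by omega), smul_zero]
  have hexpo (d e : ℕ) (h : d < e) : (s : ℤ) * expo₁ s d e < 0 ∨ (s : ℤ) * expo₂ s d e < 0 := by
    rcases Int.units_eq_one_or s with rfl | rfl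
    · right; simp [expo₂, h]
    · left; simp [expo₁, h]
  ext d
  have hc : (if s = 1 then (1 : K) else x ^ d) ≠ 0 := by
    split_ifs
    · exact one_ne_zero
    · exact pow_ne_zero _ hx
  apply smul_right_injective (U R) hc
  let F : ℕ → Idx m n × Idx m n → U R := fun e y => (pairSign y.1 y.2 * pairSign j y.2) •
    (modeMat (lGen R) s y.1 j (expo₁ s d e) * modeMat (lGen R) s y.2 l (expo₂ s d e))
  let G : ℕ → Idx m n × Idx m n → U R := fun e y => (pairSign i y.2 * pairSign y.1 y.2) •
    (modeMat (lGen R) s c y.2 (expo₂ s d e) * modeMat (lGen R) s i y.1 (expo₁ s d e))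
  have hF : ∀ e y, d < e → F e y = 0 := by
    intro e y he
    rcases hexpo d e he with h | h <;> simp [F, hmode _ _ _ h]
  have hG : ∀ e y, d < e → G e y = 0 := by
    intro e y he
    rcases hexpo d e he with h | h <;> simp [G, hmode _ _ _ h]
  have h := eval_of_convolution hu (fun y : Idx m n × Idx m n => hr i y.1 c y.2)
    (fun y : Idx m n × Idx m n => hr y.1 j y.2 l) hF hG
    (fun N => rtt_convolution s d N i c j l) x
  have eF (y : Idx m n × Idx m n) : ∑ e ∈ range (d + 1), x ^ e • F e y =
      (if s = 1 then (1 : K) else x ^ d) • PowerSeries.coeff d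
        ((pairSign y.1 y.2 * pairSign j y.2) • (shift s x (L R s y.1 j) * L R s y.2 l)) := by
    rw [coeff_smul', smul_comm, ← smul_coeff_mul s d hx, smul_sum]
    exact sum_congr rfl fun e _ => smul_comm _ _ _
  have eG (y : Idx m n × Idx m n) : ∑ e ∈ range (d + 1), x ^ e • G e y =
      (if s = 1 then (1 : K) else x ^ d) • PowerSeries.coeff d
        ((pairSign i y.2 * pairSign y.1 y.2) • (L R s c y.2 * shift s x (L R s i y.1))) := by
    rw [coeff_smul', smul_comm, ← smul_coeff_mul' s d hx, smul_sum]
    exact sum_congr rfl fun e _ => smul_comm _ _ _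
  have hsum (r : Idx m n × Idx m n → K) (H : Idx m n × Idx m n → PowerSeries (U R)) (t : K) :
      ∑ y, r y • t • PowerSeries.coeff d (H y) =
        t • PowerSeries.coeff d (∑ a, ∑ b, r (a, b) • H (a, b)) := by
    rw [← Fintype.sum_prod_type (f := fun y => r y • H y), map_sum, smul_sum]
    exact sum_congr rfl fun y _ => by rw [coeff_smul', smul_comm]
  simp only [rPoly_eval, eF, eG] at h
  rw [hsum (fun y => rEntry (zeta m n) x i c y.1 y.2),
    hsum (fun y => rEntry (zeta m n) x y.1 y.2 j l)] at h
  rw [rowSum, colSum, huniv]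
  exact h

section triangular

lemma lGen_zero_mul (s : ℤˣ) (i : Idx m n) : lGen R s i i 0 * lGen R (-s) i i 0 = 1 := by
  have := RingQuot.mkAlgHom_rel K (Rel.diag_mul (R := R) s i)
  rwa [map_mul, map_one] at this

theorem isTriangularFrom_L (s : ℤˣ) : IsTriangularFrom 0 (fun i j => L R s i j) := by
  have h (i j : Idx m n) : PowerSeries.constantCoeff (L R s i j) =
      ((-1 : K) ^ ((par i + par j) * par j)) • lGen R s i j 0 := by
    rw [← PowerSeries.coeff_zero_eq_constantCoeff_apply, coeff_L]
    simp [modeMat, mode]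
  refine ⟨fun i _ => ?_, ?_⟩
  · have e : (-1 : K) ^ ((par i + par i) * par i) = 1 :=
      Even.neg_one_pow ⟨par i * par i, by ring⟩
    have h2 := lGen_zero_mul (R := R) (-s) i
    rw [neg_neg] at h2
    rw [h, e, one_smul]
    exact ⟨⟨_, _, lGen_zero_mul s i, h2⟩, rfl⟩
  · rcases Int.units_eq_one_or s with rfl | rfl
    · refine Or.inl fun i j hij => ?_
      have : lGen R 1 i j 0 = 0 := by
        have := RingQuot.mkAlgHom_rel K (Rel.lower (R := R) i j hij)
        rwa [map_zero] at this
      rw [h, this, smul_zero]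
    · refine Or.inr fun i j hij => ?_
      have : lGen R (-1) i j 0 = 0 := by
        have := RingQuot.mkAlgHom_rel K (Rel.upper (R := R) i j hij)
        rwa [map_zero] at this
      rw [h, this, smul_zero]

end triangular
end Relations
end OspRTT

namespace OspRTT

open Finset Polynomial

/-! ### The parameters of the successive R-matrices. -/

section Parameters

variable {m n : ℕ}

lemma q_zpow_ne_one {e : ℤ} (he : e ≠ 0) : q ^ e ≠ 1 := by
  have hX (N : ℕ) (hN : N ≠ 0) : qh ^ N ≠ 1 := by
    intro h
    have h1 : algebraMap ℂ[X] K (X ^ N) = algebraMap ℂ[X] K 1 := by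
      rw [map_pow, map_one, RatFunc.algebraMap_X]; exact h
    have h2 := congrArg natDegree (RatFunc.algebraMap_injective ℂ h1)
    simp [hN] at h2
  intro h
  rcases Int.natAbs_eq e with h1 | h1 <;> rw [h1, q] at h
  · rw [zpow_natCast, ← pow_mul] at h
    exact hX _ (by omega) h
  · rw [zpow_neg, inv_eq_one, zpow_natCast, ← pow_mul] at h
    exact hX _ (by omega) h

/-- The exponent of `q` in the parameter of the `R`-matrix on the indices `k, …, \bar k`. -/
def zExp (m n k : ℕ) : ℤ := if k ≤ n then 2 * m - 2 * n - 1 + 2 * k else 2 * m - 1 - 2 * (k - n)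

lemma qEps_sq {o : Idx m n} (ho : o.val < m + n) :
    qEps o ^ 2 = q ^ (if n ≤ o.val then (2 : ℤ) else -2) := by
  rw [qEps_eq ho]
  have : par o = 0 ↔ n ≤ o.val := by
    unfold par
    constructor
    · intro h; by_contra h'; rw [if_neg (by omega)] at h; omega
    · intro h; rw [if_pos (by omega)]
  by_cases h : n ≤ o.val
  · rw [if_pos (this.2 h), if_pos h]; rfl
  · rw [if_neg (fun h' => h (this.1 h')), if_neg h, zpow_neg, inv_pow]; rfl

lemma q_zpow_zExp_zero : q ^ zExp m n 0 = zeta m n := by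
  rw [zExp, if_pos (Nat.zero_le _), zeta]; simp

/-- Each of the first `n` eliminations multiplies the parameter by `q²`, each of the next `m` by
`q⁻²`. -/
lemma q_zpow_zExp_succ {o : Idx m n} (ho : o.val < m + n) :
    (qEps o ^ 2)⁻¹ * q ^ zExp m n o.val = q ^ zExp m n (o.val + 1) := by
  rw [qEps_sq ho, ← zpow_neg, ← zpow_add₀ q_ne_zero]
  congr 1
  unfold zExp
  split_ifs <;> push_cast <;> omega

/-- The exponent `zExp` is odd, so the parameter is never `q^{±2}`; and `q` is not a root of unity.
-/
lemma qEps_generic {o : Idx m n} (ho : o.val < m + n) :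
    (1 - qEps o ^ 2) * (qEps o ^ 2 - q ^ zExp m n o.val) ≠ 0 := by
  rw [qEps_sq ho]
  refine mul_ne_zero (sub_ne_zero.2 (Ne.symm (q_zpow_ne_one ?_))) (sub_ne_zero.2 fun h => ?_)
  · split_ifs <;> decide
  · have h1 : q ^ ((if n ≤ o.val then (2 : ℤ) else -2) - zExp m n o.val) = 1 := by
      rw [zpow_sub₀ q_ne_zero, h, div_self (zpow_ne_zero _ q_ne_zero)]
    refine q_zpow_ne_one ?_ h1
    unfold zExp
    split_ifs <;> omega

end Parameters

/-! ### The tower of Schur complements and commutativity of the pivots. -/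

section Tower

lemma commute_inverse_left {M : Type*} [MonoidWithZero M] {a b : M} (ha : IsUnit a)
    (h : Commute a b) : Commute (Ring.inverse a) b := by
  obtain ⟨u, rfl⟩ := ha
  rw [Ring.inverse_unit]
  exact h.units_inv_left

variable {m n : ℕ} {A : Type} [Ring A] [Algebra K A] {s : ℤˣ}
  {T : Idx m n → Idx m n → PowerSeries A}

theorem isRTTFamily_gauss (hT : IsRTTFamily s (zeta m n) 0 T) (ht : IsTriangularFrom 0 T)
    (k : ℕ) (hk : k ≤ m + n) : IsRTTFamily s (q ^ zExp m n k) k (gauss T k) := by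
  induction k with
  | zero => rw [q_zpow_zExp_zero]; exact hT
  | succ k ih =>
    let o : Idx m n := ⟨k, by omega⟩
    have ho : o.val < m + n := hk
    have h := (ih (by omega)).schur_isRTTFamily (o := o) (zpow_ne_zero _ q_ne_zero) ho
      (qEps_generic ho) (ht.isUnit_gauss o)
    rw [q_zpow_zExp_succ ho] at h
    exact gauss_succ T o ▸ h

/-- A pivot commutes with the Schur complement it defines. Entries of later complements are built
from these by products, differences and inverses of pivots, so they commute with it too. -/
lemma commute_gauss (hT : IsRTTFamily s (zeta m n) 0 T) (ht : IsTriangularFrom 0 T)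
    {o : Idx m n} (ho : o.val < m + n) (k : ℕ) (hok : o.val < k) (hk : k ≤ m + n) {x : K}
    (hx : x ≠ 0) : ∀ i ∈ inner m n k, ∀ j ∈ inner m n k,
      Commute (shift s x (gauss T k i j)) (gauss T o.val o o) := by
  induction k with
  | zero => omega
  | succ k ih =>
    intro i hi j hj
    rcases Nat.lt_succ_iff_lt_or_eq.1 hok with hlt | heq
    · let a : Idx m n := ⟨k, by omega⟩
      have ha : a.val ≤ m + n := by change k ≤ m + n; omega
      have haI : a ∈ inner m n k := self_mem_inner ha
      have hua := ht.isUnit_gauss a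
      have hsub := inner_succ_subset (m := m) (n := n) k
      have ih := ih hlt (by omega)
      have e : gauss T (k + 1) = schur (gauss T k) a := gauss_succ T a
      rw [e, shift_schur x hua, schur_apply]
      exact (ih i (hsub hi) j (hsub hj)).sub_left
        (((ih i (hsub hi) a haI).mul_left (commute_inverse_left (isUnit_shift s x hua)
          (ih a haI a haI))).mul_left
          (ih a haI j (hsub hj)))
    · subst heq
      rw [gauss_succ T o]
      exact (isRTTFamily_gauss hT ht o.val ho.le).commute_schur (zpow_ne_zero _ q_ne_zero) ho
        (qEps_generic ho) (ht.isUnit_gauss o) hx hi hj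

theorem commute_shift_gauss (hT : IsRTTFamily s (zeta m n) 0 T) (ht : IsTriangularFrom 0 T)
    {i j : Idx m n} (hi : i.val ≤ m + n) (hj : j.val ≤ m + n) {x : K} (hx : x ≠ 0) :
    Commute (shift s x (gauss T i.val i i)) (gauss T j.val j j) := by
  rcases lt_trichotomy i.val j.val with h | h | h
  · have h1 := (commute_gauss hT ht (o := i) (by omega) j.val h hj (inv_ne_zero hx) j
      (self_mem_inner hj) j (self_mem_inner hj)).map (shiftHom s x)
    rw [shiftHom_apply, shiftHom_apply, shift_shift, mul_inv_cancel₀ hx, shift_one] at h1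
    exact h1.symm
  · obtain rfl : i = j := Fin.ext h
    have h1 := isRTTFamily_gauss hT ht i.val hi
    rcases hi.lt_or_eq with h2 | h2
    · exact h1.commute_corner (zpow_ne_zero _ q_ne_zero) h2 hx
    · exact h1.commute_middle (zpow_ne_zero _ q_ne_zero) h2 hx
  · exact commute_gauss hT ht (by omega) i.val h hi hx i (self_mem_inner hi) i (self_mem_inner hi)

/-- In degree `p + r` the commutator of the shifted series is a polynomial in `x^{±1}` vanishing at
all nonzero points. Its coefficients are the individual commutators, and the one at exponent `p` is
the one required. -/
lemma commute_coeff_of_commute_shift {a b : PowerSeries A}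
    (h : ∀ x, x ≠ 0 → Commute (shift s x a) b) (p r : ℕ) :
    Commute (PowerSeries.coeff p a) (PowerSeries.coeff r b) := by
  refine sub_eq_zero.1 ((Module.forall_dual_apply_eq_zero_iff K _).1 fun φ => ?_)
  let c : ℕ × ℕ → A := fun e => PowerSeries.coeff e.1 a * PowerSeries.coeff e.2 b -
    PowerSeries.coeff e.2 b * PowerSeries.coeff e.1 a
  let Q : K[X] := ∑ e ∈ antidiagonal (p + r), monomial e.1 (φ (c e))
  have hQ : X * Q = 0 := by
    refine Polynomial.funext fun y => ?_
    rw [eval_mul, eval_X, eval_zero]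
    rcases eq_or_ne y 0 with rfl | hy
    · exact zero_mul _
    have hs (e : ℕ) : PowerSeries.coeff e (shift s (y ^ (s : ℤ)) a) =
        y ^ e • PowerSeries.coeff e a := by
      rw [shift, PowerSeries.coeff_mk, ← zpow_mul, ← mul_assoc, ← Units.val_mul,
        Int.units_mul_self, Units.val_one, one_mul, zpow_natCast]
    have h1 := congrArg (PowerSeries.coeff (p + r)) (h (y ^ (s : ℤ)) (zpow_ne_zero _ hy)).eq
    rw [PowerSeries.coeff_mul, PowerSeries.coeff_mul, ← Finset.Nat.sum_antidiagonal_swap (f :=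
      fun e => PowerSeries.coeff e.1 b * PowerSeries.coeff e.2 (shift s (y ^ (s : ℤ)) a)),
      ← sub_eq_zero, ← sum_sub_distrib] at h1
    have h2 : eval y Q = φ 0 := by
      rw [← h1, map_sum, eval_finsetSum]
      refine sum_congr rfl fun e _ => ?_
      rw [eval_monomial, Prod.fst_swap, Prod.snd_swap, hs, smul_mul_assoc, mul_smul_comm,
        ← smul_sub, map_smul, smul_eq_mul, mul_comm]
    rw [h2, map_zero, mul_zero]
  have hQ0 : Q = 0 := (mul_eq_zero.1 hQ).resolve_left X_ne_zero
  have h3 := congrArg (fun P => coeff P p) hQ0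
  simp only [Q, finsetSum_coeff, coeff_monomial, coeff_zero] at h3
  rw [sum_eq_single (p, r)] at h3
  · rwa [if_pos rfl] at h3
  · intro e he hne
    have := mem_antidiagonal.1 he
    rw [if_neg]
    rintro rfl
    exact hne (Prod.ext rfl (by simp; omega))
  · exact fun hn => absurd (mem_antidiagonal.2 rfl : (p, r) ∈ antidiagonal (p + r)) hn

end Tower
end OspRTT

namespace OspRTT

open Finset

/-! ### Contraction with the rank one operator, and its behaviour under elimination. -/

section Contraction

variable {m n : ℕ} {S : Type*} [Ring S] [Algebra K S]

/-- The contraction of two matrices with the row vector of `Q`. -/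
noncomputable def rowContr (k : ℕ) (X T : Idx m n → Idx m n → S) (j l : Idx m n) : S :=
  ∑ a ∈ inner m n k, (rowQ a * (pairSign a a * pairSign j a)) • (X a j * T a.rev l)

/-- The contraction of two matrices with the column vector of `Q`. -/
noncomputable def colContr (k : ℕ) (X T : Idx m n → Idx m n → S) (i c : Idx m n) : S :=
  ∑ a ∈ inner m n k, (colQ a * (pairSign i a * pairSign a a)) • (T c a.rev * X i a)

lemma rowQ_ne_zero (i : Idx m n) : rowQ i ≠ 0 := fun h => by
  have := pairSign_mul_self i i
  rw [← rowQ_mul_colQ, h] at this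
  simp at this

lemma colQ_ne_zero (i : Idx m n) : colQ i ≠ 0 := fun h => by
  have := pairSign_mul_self i i
  rw [← rowQ_mul_colQ, h] at this
  simp at this

/-- At `x = z` the `R`-matrix has rank one. -/
lemma contr_eq {z : K} {k : ℕ} {X T : Idx m n → Idx m n → S} (h : IsRTT z z k X T)
    (hz : z ≠ 0) (hz1 : z ≠ 1) {i c j l : Idx m n} (hi : i ∈ inner m n k) (hc : c ∈ inner m n k)
    (hj : j ∈ inner m n k) (hl : l ∈ inner m n k) :
    (if c = i.rev then colQ i • rowContr k X T j l else 0) =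
      if l = j.rev then rowQ j • colContr k X T i c else 0 := by
  have h1 := h i hi c hc j hj l hl
  -- The diagonal and transposed coefficients contain the factor `x - z`; the contraction
  -- coefficient no longer depends on the order of its indices.
  have hd (a b : Idx m n) : diagCoeff z z a b = 0 := by simp [diagCoeff]
  have hs (a b : Idx m n) : swapCoeff z z a b = 0 := by simp [swapCoeff]
  have hq : (q - q⁻¹) * (1 - z) * z ≠ 0 := by
    refine mul_ne_zero (mul_ne_zero (fun h => ?_) (sub_ne_zero.2 hz1.symm)) hz
    have h2 : q ^ (2 : ℤ) = 1 := by
      have := sub_eq_zero.1 h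
      rw [zpow_ofNat, pow_two]
      nth_rw 2 [this]
      exact mul_inv_cancel₀ q_ne_zero
    exact q_zpow_ne_one (by decide) h2
  have hcc (a b : Idx m n) : contrCoeff z z a b = ((q - q⁻¹) * (1 - z) * z) * (colQ a * rowQ b) := by
    rw [contrCoeff, ite_self]; ring
  rw [rowSum_eq _ _ _ hi hc, colSum_eq _ _ _ hj hl] at h1
  simp only [hd, hs, hcc, zero_smul, zero_add] at h1
  apply smul_right_injective S hq
  beta_reduce
  rw [smul_ite, smul_ite, smul_zero]
  convert h1 using 2
  · rw [rowContr, smul_sum, smul_sum]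
    refine sum_congr rfl fun a _ => ?_
    rw [smul_smul, smul_smul, smul_smul, pairSign_rev_right, pairSign_rev_right]
    congr 1; ring
  · rw [colContr, smul_sum, smul_sum]
    refine sum_congr rfl fun a _ => ?_
    rw [smul_smul, smul_smul, smul_smul, pairSign_rev_right, pairSign_rev_right]
    congr 1; ring

/-- The scalar by which the matrices contract. -/
theorem exists_contr {z : K} {o : Idx m n} (ho : o.val ≤ m + n) {X T : Idx m n → Idx m n → S}
    (h : IsRTT z z o.val X T) (hz : z ≠ 0) (hz1 : z ≠ 1) :
    ∃ C : S, (∀ i ∈ inner m n o.val, ∀ c ∈ inner m n o.val,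
        colContr o.val X T i c = if c = i.rev then colQ i • C else 0) ∧
      ∀ j ∈ inner m n o.val, ∀ l ∈ inner m n o.val,
        rowContr o.val X T j l = if l = j.rev then rowQ j • C else 0 := by
  have hoI := self_mem_inner ho
  have hoI' := rev_mem_inner.2 hoI
  -- Comparison with the pair `(o, \bar o)`, which always lies in the range, fixes the scalar `C`;
  -- the same `C` then serves for rows and columns.
  have key : ∀ i ∈ inner m n o.val, ∀ c ∈ inner m n o.val, colContr o.val X T i c =
      if c = i.rev then colQ i • (rowQ o)⁻¹ • rowContr o.val X T o o.rev else 0 := by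
    intro i hi c hc
    have h1 := contr_eq h hz hz1 hi hc hoI hoI'
    rw [if_pos rfl] at h1
    have h2 := congrArg ((rowQ o)⁻¹ • ·) h1
    beta_reduce at h2
    rw [inv_smul_smul₀ (rowQ_ne_zero o)] at h2
    rw [← h2, smul_ite, smul_zero, smul_comm]
  refine ⟨(rowQ o)⁻¹ • rowContr o.val X T o o.rev, key, fun j hj l hl => ?_⟩
  have h1 := contr_eq h hz hz1 hoI hoI' hj hl
  rw [if_pos rfl, key o hoI _ hoI', if_pos rfl, smul_comm (rowQ j),
    show (0 : S) = colQ o • 0 from (smul_zero _).symm, ← smul_ite] at h1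
  exact smul_right_injective S (colQ_ne_zero o) h1

section step

variable {z : K} {o : Idx m n} {X Y T : Idx m n → Idx m n → S} {C : S}

omit [Algebra K S] in
lemma schur_self_right (hu : IsUnit (T o o)) (i : Idx m n) : schur T o i o = 0 := by
  rw [schur_apply, Ring.inverse_mul_cancel_right _ _ hu, sub_self]

/-- The contraction with second index `o` vanishes because `i ≠ \bar o`, so a left multiple of row
`o` of `T` can be subtracted from row `c` without change. The column `o` of the Schur complement is
zero, which removes the term `a = \bar o`. -/
lemma colContr_schur (ho : o.val < m + n) (hu : IsUnit (T o o))
    (hC : ∀ i ∈ inner m n o.val, ∀ c ∈ inner m n o.val,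
      colContr o.val X T i c = if c = i.rev then colQ i • C else 0)
    {i c : Idx m n} (hi : i ∈ inner m n o.val) (hi' : i ≠ o.rev)
    (hc : c ∈ inner m n (o.val + 1)) :
    (colQ o * (pairSign i o * pairSign o o)) • (schur T o c o.rev * X i o) +
      ∑ a ∈ inner m n (o.val + 1), (colQ a * (pairSign i a * pairSign a a)) •
        (schur T o c a.rev * X i a) = if c = i.rev then colQ i • C else 0 := by
  have hoI := self_mem_inner ho.le
  rw [← hC i hi c (inner_succ_subset _ hc)]
  have h0 : colContr o.val X T i o = 0 := by
    rw [hC i hi o hoI, if_neg]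
    rintro rfl
    exact hi' (Fin.rev_rev _).symm
  have h1 : colContr o.val X T i c = colContr o.val X T i c -
      T c o * Ring.inverse (T o o) * colContr o.val X T i o := by rw [h0, mul_zero, sub_zero]
  have h2 : colContr o.val X T i c = ∑ a ∈ inner m n o.val,
      (colQ a * (pairSign i a * pairSign a a)) • (schur T o c a.rev * X i a) := by
    rw [h1, colContr, colContr, mul_sum, ← sum_sub_distrib]
    refine sum_congr rfl fun a _ => ?_
    rw [mul_smul_comm, ← smul_sub, schur_apply, sub_mul]
    simp only [mul_assoc]
  rw [h2, sum_inner o ho, Fin.rev_rev, schur_self_right hu, zero_mul, smul_zero, add_zero]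

/-- The relation `h0` expresses `Y i o` through entries of `X` and `Y o o`. Inserted in the
proportionality `h`, it identifies a signed Schur complement of `X`, with the outer factors in the
opposite order, with that of `Y` up to pivots. -/
lemma fuse_bracket (h0 : fuse o X Y i o o = 0)
    (h : fuse o X Y i b o = (fuseCoeff o * pairSign o b) • fuse o X Y i o b)
    (hX : IsUnit (X o o)) (hY : IsUnit (Y o o)) :
    (X i b - (pairSign i o * pairSign o o * (pairSign o b * pairSign i b)) •
      (X o b * Ring.inverse (X o o) * X i o)) * Y o o = X o o * schur Y o i b := by
  rw [fuse_eq_mul_schur h0 hY] at h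
  have h1 : Y i o = -((fuseCoeff o * pairSign o o) • (Ring.inverse (X o o) * (X i o * Y o o))) := by
    have := congrArg (Ring.inverse (X o o) * ·) h0
    simp only [fuse, pairSign_mul_self, one_smul, mul_add, mul_zero, mul_smul_comm,
      Ring.inverse_mul_cancel_left _ _ hX] at this
    exact eq_neg_of_add_eq_zero_left this
  rw [fuse, h1] at h
  have hc : fuseCoeff o * pairSign o b ≠ 0 := by
    refine mul_ne_zero (neg_ne_zero.2 (mul_ne_zero ?_ (qEps_ne_zero o))) ?_
    · exact fun h => by simpa [h] using pairSign_mul_self o o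
    · exact fun h => by simpa [h] using pairSign_mul_self o b
  apply smul_right_injective S hc
  beta_reduce
  rw [← h, sub_mul, smul_sub, smul_mul_assoc, smul_smul, mul_neg, mul_smul_comm, smul_neg, smul_smul,
    add_comm, ← sub_eq_add_neg]
  simp only [mul_assoc]
  congr 2
  rw [pairSign_comm i o, pairSign_comm b i]
  linear_combination (fuseCoeff o * pairSign o i * pairSign o o * pairSign i b) *
    pairSign_mul_self o b

/-- The contraction for `i = o` vanishes, as `c ≠ \bar o`, and can be solved for the remaining term
at `a = o`. Substitution turns the contraction for `i` into one over the smaller range, with the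
bracket of `fuse_bracket` in place of `X i a`. -/
theorem contr_step (ho : o.val < m + n)
    (hC : ∀ i ∈ inner m n o.val, ∀ c ∈ inner m n o.val,
      colContr o.val X T i c = if c = i.rev then colQ i • C else 0)
    (hT : IsUnit (T o o)) (hX : IsUnit (X o o)) (hY : IsUnit (Y o o))
    (h0 : ∀ i ∈ inner m n (o.val + 1), fuse o X Y i o o = 0)
    (hs : ∀ i ∈ inner m n (o.val + 1), ∀ b ∈ inner m n (o.val + 1),
      fuse o X Y i b o = (fuseCoeff o * pairSign o b) • fuse o X Y i o b)
    (hcomm : ∀ i ∈ inner m n (o.val + 1), ∀ b ∈ inner m n (o.val + 1),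
      Commute (schur T o i b) (X o o))
    {i c : Idx m n} (hi : i ∈ inner m n (o.val + 1)) (hc : c ∈ inner m n (o.val + 1)) :
    (if c = i.rev then colQ i • (C * Y o o) else 0) =
      X o o * colContr (o.val + 1) (schur Y o) (schur T o) i c := by
  have hoI := self_mem_inner ho.le
  have h1 := colContr_schur ho hT hC (inner_succ_subset _ hi) (lt_rev_of_mem_inner hi).ne hc
  have h2 := colContr_schur ho hT hC hoI (rev_ne_self ho).symm hc
  rw [if_neg (lt_rev_of_mem_inner hc).ne, pairSign_mul_self, mul_one] at h2
  have h3 : colQ o • schur T o c o.rev = -∑ a ∈ inner m n (o.val + 1),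
      (colQ a * (pairSign o a * pairSign a a)) •
        (schur T o c a.rev * X o a * Ring.inverse (X o o)) := by
    have := congrArg (· * Ring.inverse (X o o)) h2
    simp only [add_mul, smul_mul_assoc, sum_mul, zero_mul,
      Ring.mul_inverse_cancel_right _ _ hX] at this
    exact eq_neg_of_add_eq_zero_left this
  have h4 : (colQ o * (pairSign i o * pairSign o o)) • (schur T o c o.rev * X i o) =
      -∑ a ∈ inner m n (o.val + 1),
        ((pairSign i o * pairSign o o) * (colQ a * (pairSign o a * pairSign a a))) •
          (schur T o c a.rev * (X o a * Ring.inverse (X o o) * X i o)) := by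
    rw [mul_comm (colQ o), mul_smul, ← smul_mul_assoc, h3, neg_mul, smul_neg, sum_mul, smul_sum]
    congr 1
    refine sum_congr rfl fun a _ => ?_
    rw [smul_mul_assoc, smul_smul]
    simp only [mul_assoc]
  rw [h4, neg_add_eq_sub, ← sum_sub_distrib] at h1
  have h5 : (if c = i.rev then colQ i • (C * Y o o) else 0) =
      (if c = i.rev then colQ i • C else 0) * Y o o := by
    rw [ite_mul, zero_mul, smul_mul_assoc]
  rw [h5, ← h1, sum_mul, colContr, mul_sum]
  refine sum_congr rfl fun a ha => ?_
  have h6 : X o o * (schur T o c a.rev * schur Y o i a) = schur T o c a.rev *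
      (X i a - (pairSign i o * pairSign o o * (pairSign o a * pairSign i a)) •
        (X o a * Ring.inverse (X o o) * X i o)) * Y o o := by
    rw [← mul_assoc, ← (hcomm c hc _ (rev_mem_inner.2 ha)).eq, mul_assoc,
      ← fuse_bracket (h0 i hi) (hs i hi a ha) hX hY]
    exact (mul_assoc _ _ _).symm
  rw [mul_smul_comm, h6]
  refine Eq.trans ?_ (smul_mul_assoc _ _ _)
  congr 1
  rw [mul_sub, mul_smul_comm, smul_sub, smul_smul]
  congr 2
  linear_combination (-(colQ a * pairSign a a * pairSign i o * pairSign o o * pairSign o a)) *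
    pairSign_mul_self i a

end step
end Contraction
end OspRTT

namespace OspRTT

open Finset

/-! ### Recursion for the scalars and the product formula. -/

section Product

variable {m n : ℕ} {A : Type} [Ring A] [Algebra K A] {s : ℤˣ}
  {T : Idx m n → Idx m n → PowerSeries A}

lemma zExp_ne_zero (k : ℕ) : zExp m n k ≠ 0 := by
  unfold zExp; split_ifs <;> omega

/-- The scalar by which the matrix `gauss T k` contracts. -/
lemma exists_contr_gauss (hT : IsRTTFamily s (zeta m n) 0 T) (ht : IsTriangularFrom 0 T)
    {o : Idx m n} (ho : o.val ≤ m + n) :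
    ∃ C : PowerSeries A, (∀ i ∈ inner m n o.val, ∀ c ∈ inner m n o.val,
      colContr o.val (fun i j => shift s (q ^ zExp m n o.val) (gauss T o.val i j)) (gauss T o.val)
        i c = if c = i.rev then colQ i • C else 0) ∧
      ∀ j ∈ inner m n o.val, ∀ l ∈ inner m n o.val,
      rowContr o.val (fun i j => shift s (q ^ zExp m n o.val) (gauss T o.val i j)) (gauss T o.val)
        j l = if l = j.rev then rowQ j • C else 0 :=
  exists_contr ho (isRTTFamily_gauss hT ht o.val ho _ (zpow_ne_zero _ q_ne_zero))
    (zpow_ne_zero _ q_ne_zero) (q_zpow_ne_one (zExp_ne_zero _))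

/-- The `k`-th factor in the product for `c^±(z)`. -/
noncomputable def gaussRatio (s : ℤˣ) (T : Idx m n → Idx m n → PowerSeries A) (k : ℕ) :
    PowerSeries A :=
  if h : k < m + n then
    shift s (q ^ zExp m n k) (gauss T k (idx k h.le) (idx k h.le)) *
      Ring.inverse (shift s (q ^ zExp m n (k + 1)) (gauss T k (idx k h.le) (idx k h.le)))
  else 1

/-- The consecutive parameters differ by exactly `q^{2(ε_o, ε_o)}`, so the matrices shifted by them
are at the fusion point and `contr_step` applies. -/
lemma contr_recursion (hT : IsRTTFamily s (zeta m n) 0 T) (ht : IsTriangularFrom 0 T)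
    {o : Idx m n} (ho : o.val < m + n) {C C' : PowerSeries A}
    (hC : ∀ i ∈ inner m n o.val, ∀ c ∈ inner m n o.val,
      colContr o.val (fun i j => shift s (q ^ zExp m n o.val) (gauss T o.val i j)) (gauss T o.val)
        i c = if c = i.rev then colQ i • C else 0)
    (hC' : ∀ i ∈ inner m n (o.val + 1), ∀ c ∈ inner m n (o.val + 1),
      colContr (o.val + 1) (fun i j => shift s (q ^ zExp m n (o.val + 1)) (gauss T (o.val + 1) i j))
        (gauss T (o.val + 1)) i c = if c = i.rev then colQ i • C' else 0) :
    C = gaussRatio s T o.val * C' := by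
  set ζ := q ^ zExp m n o.val with hζ
  set ζ' := q ^ zExp m n (o.val + 1) with hζ'
  set G := gauss T o.val with hG
  have hz : ζ ≠ 0 := zpow_ne_zero _ q_ne_zero
  have hz' : ζ' ≠ 0 := zpow_ne_zero _ q_ne_zero
  have hp : qEps o ^ 2 * ζ' = ζ := by
    rw [hζ', ← q_zpow_zExp_succ ho, mul_inv_cancel_left₀ (pow_ne_zero _ (qEps_ne_zero o))]
  have hu : IsUnit (G o o) := ht.isUnit_gauss o
  have hrtt := isRTTFamily_gauss hT ht o.val ho.le
  have hgen := qEps_generic (m := m) (n := n) ho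
  have hfus : IsRTT ζ (qEps o ^ 2) o.val (fun i j => shift s ζ (G i j))
      (fun i j => shift s ζ' (G i j)) := by
    have := (hrtt (qEps o ^ 2) (pow_ne_zero _ (qEps_ne_zero o))).map (shiftHom s ζ')
    simpa only [shiftHom_apply, shift_shift, mul_comm ζ', hp] using this
  have hcomm (x : K) (hx : x ≠ 0) (i j : Idx m n) (hi : i ∈ inner m n (o.val + 1))
      (hj : j ∈ inner m n (o.val + 1)) : Commute (shift s x (schur G o i j)) (G o o) :=
    hrtt.commute_schur hz ho hgen hu hx hi hj
  have hcomm' (x y : K) (hx : x ≠ 0) (hy : y ≠ 0) (i j : Idx m n)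
      (hi : i ∈ inner m n (o.val + 1)) (hj : j ∈ inner m n (o.val + 1)) :
      Commute (shift s x (schur G o i j)) (shift s y (G o o)) := by
    have := (hcomm (y⁻¹ * x) (mul_ne_zero (inv_ne_zero hy) hx) i j hi hj).map (shiftHom s y)
    rwa [shiftHom_apply, shiftHom_apply, shift_shift, mul_inv_cancel_left₀ hy] at this
  have hsucc : gauss T (o.val + 1) = schur G o := gauss_succ T o
  rw [hsucc] at hC'
  -- The middle index belongs to every range, and one entry of the contraction suffices to compare
  -- the scalars.
  let i : Idx m n := idx (m + n) le_rfl
  have hival : i.val = m + n := rfl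
  have hi : i ∈ inner m n (o.val + 1) := by
    rw [mem_inner, Fin.val_rev]; omega
  have hi' := rev_mem_inner.2 hi
  have hsch : schur (fun i j => shift s ζ' (G i j)) o =
      fun i j => shift s ζ' (schur G o i j) := by
    funext a b; rw [shift_schur ζ' hu]
  have h := contr_step (X := fun i j => shift s ζ (G i j)) (Y := fun i j => shift s ζ' (G i j))
    (T := G) ho hC hu (isUnit_shift s ζ hu) (isUnit_shift s ζ' hu)
    (fun i hi => fuse_self ho hfus hgen hi) (fun i hi b hb => fuse_swap ho hfus hgen hi hb)
    (fun i hi b hb => by simpa using hcomm' 1 ζ one_ne_zero hz i b hi hb) hi hi'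
  rw [hsch, hC' i hi _ hi', if_pos rfl, if_pos rfl, mul_smul_comm] at h
  have h1 : C * shift s ζ' (G o o) = shift s ζ (G o o) * C' :=
    smul_right_injective _ (colQ_ne_zero i) h
  -- `C'` is a combination of products of entries of the Schur complement, which commute with every
  -- shift of the pivot; hence the ratio of pivots can be placed to its left.
  have h2 : Commute C' (shift s ζ' (G o o)) := by
    have h3 : C' = (colQ i)⁻¹ • colContr (o.val + 1) (fun i j => shift s ζ' (schur G o i j))
        (schur G o) i i.rev := by
      rw [hC' i hi _ hi', if_pos rfl, inv_smul_smul₀ (colQ_ne_zero i)]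
    rw [h3]
    refine Commute.smul_left (Commute.sum_left _ _ _ fun a ha => Commute.smul_left ?_ _) _
    exact Commute.mul_left (by simpa using hcomm' 1 ζ' one_ne_zero hz' _ _ hi' (rev_mem_inner.2 ha))
      (hcomm' ζ' ζ' hz' hz' _ _ hi ha)
  have h4 := (commute_inverse_left (isUnit_shift s ζ' hu) h2.symm)
  have hidx : idx o.val ho.le = o := rfl
  rw [gaussRatio, dif_pos ho, hidx, mul_assoc, h4.eq, ← mul_assoc, ← h1,
    Ring.mul_inverse_cancel_right _ _ (isUnit_shift s ζ' hu)]

/-- With only the middle index left, the contraction is a single product and the parity sign is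
trivial. -/
lemma contr_middle {o : Idx m n} (ho : o.val = m + n) {X Y : Idx m n → Idx m n → PowerSeries A}
    {C : PowerSeries A} (hC : ∀ i ∈ inner m n o.val, ∀ c ∈ inner m n o.val,
      colContr o.val X Y i c = if c = i.rev then colQ i • C else 0) : C = Y o o * X o o := by
  have hoI := self_mem_inner ho.le
  have hrev : o.rev = o := by
    ext; rw [Fin.val_rev]; omega
  have hinner : inner m n o.val = {o} := by
    ext i
    have := i.isLt
    simp only [mem_inner, mem_singleton, Fin.ext_iff, Fin.val_rev]
    omega
  have h := hC o hoI o hoI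
  rw [colContr, hinner, sum_singleton, if_pos hrev.symm, hrev, pairSign_mul_self, mul_one] at h
  exact (smul_right_injective _ (colQ_ne_zero o) h).symm

theorem contr_eq_prod (hT : IsRTTFamily s (zeta m n) 0 T) (ht : IsTriangularFrom 0 T)
    {C : PowerSeries A} (hC : ∀ i ∈ inner m n 0, ∀ c ∈ inner m n 0,
      colContr 0 (fun i j => shift s (zeta m n) (T i j)) T i c =
        if c = i.rev then colQ i • C else 0) :
    C = ((List.range (m + n)).map (gaussRatio s T)).prod *
      (gauss T (m + n) (idx (m + n) le_rfl) (idx (m + n) le_rfl) *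
        shift s q⁻¹ (gauss T (m + n) (idx (m + n) le_rfl) (idx (m + n) le_rfl))) := by
  have key : ∀ k (hk : k ≤ m + n), ∃ C' : PowerSeries A,
      (∀ i ∈ inner m n k, ∀ c ∈ inner m n k,
        colContr k (fun i j => shift s (q ^ zExp m n k) (gauss T k i j)) (gauss T k)
          i c = if c = i.rev then colQ i • C' else 0) ∧
      C = ((List.range k).map (gaussRatio s T)).prod * C' := by
    intro k hk
    induction k with
    | zero =>
      refine ⟨C, ?_, by simp⟩
      rw [q_zpow_zExp_zero]
      exact hC
    | succ k ih =>
      obtain ⟨C₁, h1, h2⟩ := ih (by omega)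
      obtain ⟨C₂, h3, -⟩ := exists_contr_gauss hT ht (o := idx (k + 1) hk) hk
      refine ⟨C₂, h3, ?_⟩
      have h4 := contr_recursion hT ht (o := idx k (by omega)) hk h1 h3
      rw [h2, h4, List.range_succ, List.map_append, List.prod_append, List.map_singleton,
        List.prod_singleton, mul_assoc]
      rfl
  obtain ⟨C', h1, h2⟩ := key (m + n) le_rfl
  have h3 := contr_middle (o := idx (m + n) le_rfl) rfl h1
  -- The last parameter is `q⁻¹`, the origin of the argument `q⁻¹ z` in the final factor.
  have hz : zExp m n (m + n) = -1 := by
    unfold zExp; split_ifs <;> push_cast <;> omega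
  rw [h2, h3, hz, zpow_neg_one]

end Product
end OspRTT

namespace OspRTT

open Finset

/-! ### The series `c^±(z)` and the theorem. -/

section Main

variable {m n : ℕ} {R : Coeffs m n (PowerSeries K)}

lemma twoRho_rev (i : Idx m n) : twoRho i.rev = -twoRho i := by
  have hi := i.isLt
  rcases lt_trichotomy i.val (n + m) with h | h | h
  · rw [twoRho, if_neg (by rw [Fin.val_rev]; omega), Fin.rev_rev, twoRho, if_pos h.le]
  · have hr : i.rev = i := by ext; rw [Fin.val_rev]; omega
    have h0 : twoRho i = 0 := by
      rw [twoRho, if_pos h.le, twoRhoHalf, if_neg (by omega), if_neg (by omega)]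
    rw [hr, h0, neg_zero]
  · rw [twoRho, if_pos (by rw [Fin.val_rev]; omega), twoRho, if_neg (by omega), neg_neg]

lemma xi_rev (i : Idx m n) : xi i.rev = sgn (par i) * xi i := by
  have hi := i.isLt
  unfold xi
  rw [par_rev]
  rcases par_eq_zero_or_one i with h | h
  · rw [h]; rfl
  · have hout : i.val < n ∨ n + 2 * m + 1 ≤ i.val := by
      unfold par at h
      by_contra hc
      rw [if_pos (by omega)] at h
      omega
    rw [h, if_neg one_ne_zero, if_neg one_ne_zero]
    have hs : sgn (i.rev.val + 1) = sgn (i.val + 1) := by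
      unfold sgn
      rw [Fin.val_rev]
      rcases Nat.even_or_odd (i.val + 1) with he | he
      · rw [he.neg_one_pow, Even.neg_one_pow]
        rw [Nat.even_iff] at he ⊢; omega
      · rw [he.neg_one_pow, Odd.neg_one_pow]
        rw [Nat.odd_iff] at he ⊢; omega
    have h1 : sgn 1 = -1 := rfl
    rw [hs, h1]
    rcases hout with h2 | h2
    · rw [if_neg (by rw [Fin.val_rev]; omega), if_pos h2, neg_one_mul]
    · rw [if_pos (by rw [Fin.val_rev]; omega), if_neg (by omega), neg_one_mul, neg_neg]

lemma colQ_rev (i : Idx m n) : colQ i.rev = rowQ i := by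
  rw [colQ, rowQ, xi_rev, twoRho_rev]; push_cast; ring

lemma rowQ_rev (i : Idx m n) : rowQ i.rev = colQ i := by
  rw [← colQ_rev, Fin.rev_rev]

/-- The signs of the super-transposition and the entries of `D` combine into the row and column
vectors of `Q`, so products with `L` become the contractions studied above. -/
lemma Lconj_apply (s : ℤˣ) (a b : Idx m n) :
    Lconj R s a b = (pairSign a b * pairSign a a * pairSign b b * (rowQ a * colQ b)) •
      shift s (zeta m n) (L R s b.rev a.rev) := by
  rw [Lconj, Matrix.mul_diagonal, Matrix.diagonal_mul, op₁, Matrix.of_apply, superT, L, op₁,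
    Matrix.of_apply, sgn_smul, sgn_smul, ← shiftHom_apply, ← shiftHom_apply, map_smul,
    ← Int.cast_smul_eq_zsmul K, ← Algebra.commutes, ← Algebra.smul_def, ← Algebra.smul_def,
    smul_smul, smul_smul, smul_smul, smul_smul]
  congr 1
  have hd : (dEntry b)⁻¹ = qh ^ twoRho b := by
    rw [dEntry, zpow_neg, inv_inv]
  rw [hd, dEntry, rowQ, colQ]
  push_cast
  simp only [intCast_sgn, pairSign, par_rev]
  rcases par_eq_zero_or_one a with h | h <;> rcases par_eq_zero_or_one b with h' | h' <;>
    simp only [h, h'] <;> ring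

lemma sum_rev (F : Idx m n → PowerSeries (U R)) : ∑ a, F a = ∑ a : Idx m n, F a.rev :=
  (Equiv.sum_comp Fin.revPerm F).symm

lemma inner_zero : inner m n 0 = univ := by ext; simp [mem_inner]

lemma L_mul_Lconj_apply (s : ℤˣ) (c d : Idx m n) :
    (L R s * Lconj R s) c d = (colQ d * pairSign d d) •
      colContr 0 (fun i j => shift s (zeta m n) (L R s i j)) (fun i j => L R s i j) d.rev c := by
  rw [Matrix.mul_apply, sum_rev, colContr, inner_zero, smul_sum]
  refine sum_congr rfl fun b _ => ?_
  rw [Lconj_apply, mul_smul_comm, smul_smul, Fin.rev_rev, rowQ_rev]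
  simp only [pairSign_rev_left, pairSign_rev_right]
  congr 1
  rw [pairSign_comm b d]; ring

lemma Lconj_mul_L_apply (s : ℤˣ) (a l : Idx m n) :
    (Lconj R s * L R s) a l = (rowQ a * pairSign a a) •
      rowContr 0 (fun i j => shift s (zeta m n) (L R s i j)) (fun i j => L R s i j) a.rev l := by
  rw [Matrix.mul_apply, sum_rev, rowContr, inner_zero, smul_sum]
  refine sum_congr rfl fun b _ => ?_
  rw [Lconj_apply, smul_mul_assoc, smul_smul, Fin.rev_rev, colQ_rev]
  simp only [pairSign_rev_left, pairSign_rev_right]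
  congr 1
  ring

variable (hR : R = Rfull m n ∨ R = Rtilde m n)
include hR

/-- Existence of the central series, with its value in terms of the Gauss decomposition. -/
theorem exists_isCSeries (s : ℤˣ) : ∃ C : PowerSeries (U R), IsCSeries R s C ∧
    C = ((List.range (m + n)).map (gaussRatio s fun i j => L R s i j)).prod *
      (gauss (fun i j => L R s i j) (m + n) (idx (m + n) le_rfl) (idx (m + n) le_rfl) *
        shift s q⁻¹ (gauss (fun i j => L R s i j) (m + n) (idx (m + n) le_rfl)
          (idx (m + n) le_rfl))) := by
  have hT := isRTTFamily_L hR s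
  have ht := isTriangularFrom_L (R := R) s
  obtain ⟨C, h1, h2⟩ := exists_contr_gauss hT ht (o := idx 0 (Nat.zero_le _)) (Nat.zero_le _)
  have h1 : ∀ i ∈ inner m n 0, ∀ c ∈ inner m n 0,
      colContr 0 (fun i j => shift s (zeta m n) (L R s i j)) (fun i j => L R s i j) i c =
        if c = i.rev then colQ i • C else 0 := by
    rw [← q_zpow_zExp_zero]; exact h1
  have h2 : ∀ i ∈ inner m n 0, ∀ c ∈ inner m n 0,
      rowContr 0 (fun i j => shift s (zeta m n) (L R s i j)) (fun i j => L R s i j) i c =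
        if c = i.rev then rowQ i • C else 0 := by
    rw [← q_zpow_zExp_zero]; exact h2
  have hmem (i : Idx m n) : i ∈ inner m n 0 := by rw [inner_zero]; exact mem_univ i
  refine ⟨C, ⟨?_, ?_⟩, contr_eq_prod hT ht h1⟩
  · ext1 a l
    rw [Lconj_mul_L_apply, h2 _ (hmem _) _ (hmem _), Fin.rev_rev, Matrix.diagonal_apply, rowQ_rev]
    by_cases h : a = l
    · rw [if_pos h.symm, if_pos h, smul_smul, mul_right_comm, rowQ_mul_colQ, pairSign_mul_self,
        one_smul]
    · rw [if_neg (Ne.symm h), if_neg h, smul_zero]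
  · ext1 c d
    rw [L_mul_Lconj_apply, h1 _ (hmem _) _ (hmem _), Fin.rev_rev, Matrix.diagonal_apply, colQ_rev]
    by_cases h : c = d
    · rw [if_pos h, if_pos h, smul_smul, mul_right_comm, mul_comm (colQ d), rowQ_mul_colQ,
        pairSign_mul_self, one_smul]
    · rw [if_neg h, if_neg h, smul_zero]

omit hR

lemma h_eq_gauss (s : ℤˣ) (i : Idx m n) :
    h R s i = gauss (fun i j => L R s i j) i.val i i := by
  have ht := isTriangularFrom_L (R := R) s
  exact quasideterminant_eq_gauss (fun i j => L R s i j) (fun i => ht.isUnit_gauss i) i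
    (ht.isUnit_leading i)

/-- The numerator and the denominator of each ratio are taken at consecutive parameters of the
tower. -/
lemma hRatio_eq (s : ℤˣ) (k : ℕ) (hk : k < m + n) :
    hRatio R s (idx k hk.le) (q ^ zExp m n k) (q ^ zExp m n (k + 1)) =
      gaussRatio s (fun i j => L R s i j) k := by
  rw [gaussRatio, dif_pos hk, hRatio, h_eq_gauss]
  rfl

lemma cProduct_eq (s : ℤˣ) : cProduct R s =
    ((List.range (m + n)).map (gaussRatio s fun i j => L R s i j)).prod *
      (gauss (fun i j => L R s i j) (m + n) (idx (m + n) le_rfl) (idx (m + n) le_rfl) *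
        shift s q⁻¹ (gauss (fun i j => L R s i j) (m + n) (idx (m + n) le_rfl)
          (idx (m + n) le_rfl))) := by
  have e1 : ((List.finRange n).map fun i : Fin n =>
      hRatio R s (idx i.val (by omega))
        (zeta m n * q ^ (2 * ((i.val : ℤ) + 1) - 2)) (zeta m n * q ^ (2 * ((i.val : ℤ) + 1)))) =
      (List.range n).map (gaussRatio s fun i j => L R s i j) := by
    rw [← List.map_coe_finRange_eq_range, List.map_map]
    refine List.map_congr_left fun i _ => ?_
    have hi := i.isLt
    have h1 : zeta m n * q ^ (2 * ((i.val : ℤ) + 1) - 2) = q ^ zExp m n i.val := by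
      rw [zeta, ← zpow_add₀ q_ne_zero, zExp, if_pos hi.le]
      congr 1; ring
    have h2 : zeta m n * q ^ (2 * ((i.val : ℤ) + 1)) = q ^ zExp m n (i.val + 1) := by
      rw [zeta, ← zpow_add₀ q_ne_zero, zExp, if_pos (Nat.succ_le_of_lt hi)]
      congr 1
    rw [h1, h2, hRatio_eq s i.val (by omega)]
    rfl
  have e2 : ((List.finRange m).map fun i : Fin m =>
      hRatio R s (idx (n + i.val) (by omega))
        (q ^ (2 * (m : ℤ) - 2 * ((i.val : ℤ) + 1) + 1))
        (q ^ (2 * (m : ℤ) - 2 * ((i.val : ℤ) + 1) - 1))) =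
      (List.range m).map fun i => gaussRatio s (fun i j => L R s i j) (n + i) := by
    rw [← List.map_coe_finRange_eq_range, List.map_map]
    refine List.map_congr_left fun i _ => ?_
    have hi := i.isLt
    have h1 : 2 * (m : ℤ) - 2 * ((i.val : ℤ) + 1) + 1 = zExp m n (n + i.val) := by
      unfold zExp; split_ifs <;> push_cast <;> omega
    have h2 : 2 * (m : ℤ) - 2 * ((i.val : ℤ) + 1) - 1 = zExp m n (n + i.val + 1) := by
      unfold zExp; split_ifs <;> push_cast <;> omega
    rw [h1, h2, hRatio_eq s (n + i.val) (by omega)]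
    rfl
  have e3 : List.range (m + n) = List.range n ++ (List.range m).map (n + ·) := by
    rw [add_comm m n, List.range_add]
  rw [cProduct, e1, e2, h_eq_gauss, e3, List.map_append, List.prod_append, List.map_map]
  rfl

end Main
end OspRTT

theorem proposition5 (m n : ℕ) (hm : 0 < m)
    (R : OspRTT.Coeffs m n (PowerSeries OspRTT.K))
    (hR : R = OspRTT.Rfull m n ∨ R = OspRTT.Rtilde m n) (s : ℤˣ) :
    (∀ i : OspRTT.Idx m n,
        IsUnit (OspRTT.leading R s i) ∧ IsUnit (OspRTT.h R s i)) ∧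
      (∀ i j : OspRTT.Idx m n, i.val ≤ m + n → j.val ≤ m + n → ∀ a b : ℕ,
        Commute (PowerSeries.coeff a (OspRTT.h R s i)) (PowerSeries.coeff b (OspRTT.h R s j))) ∧
      (∀ c : PowerSeries (OspRTT.U R),
        OspRTT.IsCSeries R s c ↔ c = OspRTT.cProduct R s) := by
  have hT := OspRTT.isRTTFamily_L hR s
  have ht := OspRTT.isTriangularFrom_L (R := R) s
  refine ⟨fun i => ⟨ht.isUnit_leading i, ?_⟩, fun i j hi hj a b => ?_, fun c => ?_⟩
  · rw [OspRTT.h_eq_gauss]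
    exact ht.isUnit_gauss i
  · rw [OspRTT.h_eq_gauss, OspRTT.h_eq_gauss]
    exact OspRTT.commute_coeff_of_commute_shift
      (fun x hx => OspRTT.commute_shift_gauss hT ht hi hj hx) a b
  · obtain ⟨C, hC, hprod⟩ := OspRTT.exists_isCSeries hR s
    rw [← OspRTT.cProduct_eq] at hprod
    refine ⟨fun hc => ?_, fun hc => hc ▸ hprod ▸ hC⟩
    rw [← hprod]
    -- Uniqueness: two such series are equal because they are the same diagonal entry of one
    -- product.
    have := congrFun (congrFun (hc.1.symm.trans hC.1) 0) 0
    rwa [Matrix.diagonal_apply_eq, Matrix.diagonal_apply_eq] at this
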